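/- Identify $\mathbb R^2$ with $\mathbb C$, let $\mathbb S^1\subset\mathbb R^2$ be the unit circle, let $J\subset\mathbb S^1$ be compact and connected with more than one point (so $J$ is a closed arc or $J=\mathbb S^1$), and let $\Omega\subset\mathbb R^2$ be open. For a map $f$ on $J$, write $\partial_\theta f$ for the derivative of $\theta\mapsto f(e^{i\theta})$ (one-sided at the end points of $J$, if any); $f\in C^k(J)$ means that $\theta\mapsto f(e^{i\theta})$ is of class $C^k$ up to the end points. Let $\Gamma\in C^2(J;\mathbb R^{2\times 2})$, with rows $\Gamma_1,\Gamma_2\colon J\to\mathbb R^2$, satisfy $$|\partial_\theta\Gamma|=1,\qquad \det(\partial_\theta\Gamma)=0,\qquad |\det(\partial_\theta^2\Gamma)|>0\qquad\text{on }J,$$ where $|\cdot|$ is the Euclidean (Frobenius) norm on $\mathbb R^{2\times 2}$, and define $$\mathrm{ENT}_\Gamma=\Big\{\Phi\in C^2(J;\mathbb R^2)\colon \exists\,\alpha^1,\alpha^2\in C^1(J;\mathbb R)\text{ such that }\partial_\theta\Phi=\alpha^1\,\partial_\theta\Gamma_1+\alpha^2\,\partial_\theta\Gamma_2\text{ on }J\Big\}.$$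 Let $m\colon\Omega\to J$ be a measurable map such that $$\nabla\cdot\Gamma_1(m)=\nabla\cdot\Gamma_2(m)=0\qquad\text{in }\mathcal D'(\Omega),$$ and assume that $m\in B^{1/3}_{p,\infty,\mathrm{loc}}(\Omega;\mathbb S^1)$ for some $p\in(3,\infty]$, that is, for every open set $U$ whose closure is compact and contained in $\Omega$, $$\sup_{0<|h|\le 1}\frac{\|D^hm\|_{L^p(U)}}{|h|^{1/3}}<\infty,\qquad D^hm(x)=\begin{cases} m(x+h)-m(x) & \text{if } x\in\Omega\text{ and }x+h\in\Omega,\\ 0&\text{otherwise.}\end{cases}$$ Then $$\nabla\cdot\Phi(m)=0\quad\text{in }\mathcal D'(\Omega)\qquad\text{for all }\Phi\in\mathrm{ENT}_\Gamma.$$ -/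

import Mathlib

open MeasureTheory TopologicalSpace
open scoped ENNReal NNReal Matrix.Norms.Frobenius Distributions

namespace EntropyProduction

/-- The Euclidean plane `ℝ²`. -/
abbrev Plane : Type := EuclideanSpace ℝ (Fin 2)

/-- The angles `θ` with `e^{iθ} ∈ J`, a `2π`-periodic set of real numbers. -/
def angles (J : Set Circle) : Set ℝ := {θ | Circle.exp θ ∈ J}

section Calculus

variable {E : Type*} [NormedAddCommGroup E] [NormedSpace ℝ E]

/-- `f ∈ C^k(J; E)`: the map `θ ↦ f(e^{iθ})` is of class `C^k`, up to the end points of `J`. Only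
the values of `f` on `J` are involved. -/
def IsCkOn (k : ℕ) (J : Set Circle) (f : Circle → E) : Prop :=
  ContDiffOn ℝ k (fun θ => f (Circle.exp θ)) (angles J)

/-- `∂_θ f` at the point `e^{iθ}` of `J`: the derivative of `θ ↦ f(e^{iθ})`, one-sided at the end
points of `J`. -/
noncomputable def dTheta (J : Set Circle) (f : Circle → E) (θ : ℝ) : E :=
  derivWithin (fun t => f (Circle.exp t)) (angles J) θ

/-- `∂_θ² f` at the point `e^{iθ}` of `J`. -/
noncomputable def dTheta2 (J : Set Circle) (f : Circle → E) (θ : ℝ) : E :=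
  derivWithin (dTheta J f) (angles J) θ

end Calculus

/-- The `j`-th row `Γ_j : 𝕊¹ → ℝ²` of a matrix-valued map. -/
def row (Γ : Circle → Matrix (Fin 2) (Fin 2) ℝ) (j : Fin 2) (z : Circle) : Plane :=
  WithLp.toLp 2 (Γ z j)

/-- The set `ENT_Γ` of entropies: maps `Φ ∈ C²(J; ℝ²)` such that
`∂_θ Φ = α¹ ∂_θ Γ₁ + α² ∂_θ Γ₂` on `J` for some `α¹, α² ∈ C¹(J; ℝ)`. -/
def ENT (J : Set Circle) (Γ : Circle → Matrix (Fin 2) (Fin 2) ℝ) : Set (Circle → Plane) :=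
  {Φ | IsCkOn 2 J Φ ∧ ∃ α₁ α₂ : Circle → ℝ, IsCkOn 1 J α₁ ∧ IsCkOn 1 J α₂ ∧
    ∀ θ ∈ angles J, dTheta J Φ θ =
      α₁ (Circle.exp θ) • dTheta J (row Γ 0) θ + α₂ (Circle.exp θ) • dTheta J (row Γ 1) θ}

/-- `∇ · F = 0` in `𝒟'(Ω)`: the field `F` is in `L¹_loc(Ω; ℝ²)` and `∫_Ω F · ∇ζ = 0` for every test
function `ζ ∈ C_c^∞(Ω)`; the integrand is written `dζ(x)[F(x)] = F(x) · ∇ζ(x)`. -/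
def IsDivFree (Ω : Opens Plane) (F : Plane → Plane) : Prop :=
  LocallyIntegrableOn F Ω ∧ ∀ ζ : 𝓓(Ω, ℝ), ∫ x in (Ω : Set Plane), fderiv ℝ ζ x (F x) = 0

/-- The difference `D^h m(x) = (m(x+h) - m(x)) 1_{x, x+h ∈ Ω}`. -/
noncomputable def diffOn (Ω : Opens Plane) (m : Plane → Circle) (h : Plane) : Plane → ℂ :=
  Set.indicator {x | x ∈ Ω ∧ x + h ∈ Ω} fun x => (m (x + h) : ℂ) - (m x : ℂ)

/-- `m ∈ B^s_{p,∞,loc}(Ω; 𝕊¹)`: for every open `U` with compact closure contained in `Ω`,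
`sup_{|h| ≤ 1} |h|^{-s} ‖D^h m‖_{L^p(U)} < ∞`. -/
def IsBesovLoc (s : ℝ) (p : ℝ≥0∞) (Ω : Opens Plane) (m : Plane → Circle) : Prop :=
  AEStronglyMeasurable m (volume.restrict (Ω : Set Plane)) ∧
  ∀ U : Set Plane, IsOpen U → IsCompact (closure U) → closure U ⊆ Ω →
    ∃ C : ℝ≥0, ∀ h : Plane, ‖h‖ ≤ 1 →
      eLpNorm (diffOn Ω m h) p (volume.restrict U) ≤ C * ENNReal.ofReal (‖h‖ ^ s)

end EntropyProduction

open EntropyProduction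

/-!
Let `m` take values in `J`, let the rows of `Γ(m)` be divergence-free, and let
`∂_θ Φ = ∑ⱼ αⱼ ∂_θ Γⱼ`. At a scale `ε > 0`, the map `m` is compared with a smooth map `P = exp(iϑ)`
into `J`, defined by a cut-off `χ`, the form `L = χ dϑ` and the local variance `V` of the angle of
`m` (`AngularApprox`): if `J` is a proper arc, `ϑ` is the mollification of an angle of `m`, and if
`J` is the circle, `ϑ` is the angle of the mollification of `m`, where it is not small.

With `gⱼ` the mollification of `Γⱼ(m)`, which is divergence-free, consider the divergence of
`Φ(P) + ∑ⱼ αⱼ(P) (gⱼ - Γⱼ(P))`. The terms with `∂_θ Φ` and `∂_θ Γⱼ` cancel, and what remains is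
`∑ⱼ αⱼ'(ϑ) dϑ · (gⱼ - Γⱼ(P))`. As `gⱼ - Γⱼ(P) = ½ Γⱼ''(ϑ) V` up to negligible terms, in the limit
`ε → 0` the entropy production `∇ · Φ(m)` is half the weak limit of
`∑ₖ ∑ⱼ αⱼ'(ϑ) Γⱼₖ''(ϑ) V Lₖ` (`AngularApprox.tendsto_integral_add_cubic`). This is cubic in the
increments of `m`, hence bounded in `L¹_loc` and, as `p > 3`, equi-integrable, by the Besov bound
of order `1/3`; the same bound makes the errors tend to zero (`IsSmall`).

The cubic expressions are then shown to vanish in the limit by a special choice of coefficients.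
Since `∂_θ Γ` is singular, the rows of its adjugate are admissible `αⱼ` for the entropy `Φ = 0`. For
these, the expression above is `½ det(∂_θ² Γ)(ϑ) V Lₗ`, for each direction `l`, so that this product
tends weakly to zero (`AngularApprox.tendsto_integral_det`). Because of the equi-integrability, the
same is true after multiplication with continuous functions of `m` (`tendsto_integral_comp_mul`) and
then of `P`. Dividing by `det(∂_θ² Γ) ≠ 0`, it follows that `f(P) V Lₗ` tends weakly to zero for
every continuous `f` (`AngularApprox.tendsto_integral_V_mul_L`), and so the entropy production of
every `Φ ∈ ENT_Γ` vanishes.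
-/

namespace EntropyProduction

open Metric Filter Topology

/-! ### Mollification by a smooth kernel -/

section Mollification

/-- A smooth bump function on the plane supported in the unit ball. -/
noncomputable def unitBump : ContDiffBump (0 : Plane) := ⟨1 / 2, 1, by norm_num, by norm_num⟩

/-- The mollification kernel: nonnegative, smooth, supported in the unit ball, of integral one. -/
noncomputable def kernel : Plane → ℝ := unitBump.normed volume

/-- The mollification of `f` at scale `ε`, in the rescaled form
`x ↦ ∫ kernel(y) f(x - εy) dy`. -/
noncomputable def mollify {F : Type*} [NormedAddCommGroup F] [NormedSpace ℝ F]
    (ε : ℝ) (f : Plane → F) (x : Plane) : F :=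
  ∫ y, kernel y • f (x - ε • y)

theorem kernel_nonneg (y : Plane) : 0 ≤ kernel y := unitBump.nonneg_normed y

theorem contDiff_kernel {n : ℕ∞} : ContDiff ℝ n kernel := unitBump.contDiff_normed

theorem continuous_kernel : Continuous kernel := unitBump.continuous_normed

theorem hasCompactSupport_kernel : HasCompactSupport kernel := unitBump.hasCompactSupport_normed

theorem integral_kernel : ∫ y, kernel y = 1 := unitBump.integral_normed

theorem integrable_kernel : Integrable kernel := unitBump.integrable_normed

theorem kernel_eq_zero {y : Plane} (hy : y ∉ ball (0 : Plane) 1) : kernel y = 0 := by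
  have h : Function.support kernel = ball 0 1 := unitBump.support_normed_eq
  rw [← h] at hy
  simpa using hy

theorem fderiv_kernel_eq_zero {y : Plane} (hy : y ∉ ball (0 : Plane) 1) :
    fderiv ℝ kernel y = 0 := by
  -- the kernel is minimal at `y`
  have : IsLocalMin kernel y := by
    refine Filter.Eventually.of_forall fun z => ?_
    rw [kernel_eq_zero hy]
    exact kernel_nonneg z
  exact this.fderiv_eq_zero

theorem continuous_fderiv_kernel : Continuous (fderiv ℝ kernel) :=
  (contDiff_kernel (n := 1)).continuous_fderiv (by norm_num)

theorem exists_kernel_bound :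
    ∃ C : ℝ, 0 < C ∧ (∀ y, kernel y ≤ C) ∧ ∀ y, ‖fderiv ℝ kernel y‖ ≤ C := by
  obtain ⟨C₁, h₁⟩ := continuous_kernel.bounded_above_of_compact_support hasCompactSupport_kernel
  obtain ⟨C₂, h₂⟩ := continuous_fderiv_kernel.bounded_above_of_compact_support
    (hasCompactSupport_kernel.fderiv (𝕜 := ℝ))
  refine ⟨max 1 (max C₁ C₂), by positivity, fun y => ?_, fun y => ?_⟩
  · exact (le_abs_self _).trans ((h₁ y).trans (by simp))
  · exact (h₂ y).trans (by simp)

theorem integrable_fderiv_kernel (v : Plane) : Integrable fun y => fderiv ℝ kernel y v := by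
  refine Continuous.integrable_of_hasCompactSupport
    (continuous_fderiv_kernel.clm_apply continuous_const) ?_
  exact hasCompactSupport_kernel.fderiv_apply (𝕜 := ℝ) v

theorem integral_fderiv_kernel (v : Plane) : ∫ y, fderiv ℝ kernel y v = 0 := by
  have h := integral_mul_fderiv_eq_neg_fderiv_mul_of_integrable (μ := (volume : Measure Plane))
    (f := fun _ => (1 : ℝ)) (g := kernel) (v := v) (by simp)
    (by simpa using integrable_fderiv_kernel v) (by simpa using integrable_kernel)
    (by simp) (fun x _ => (contDiff_kernel (n := 1)).differentiable (by norm_num) x)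
  simpa using h

theorem stronglyMeasurable_comp_sub_smul {E : Type*} [NormedAddCommGroup E] {f : Plane → E}
    (hf : StronglyMeasurable f) (ε : ℝ) (x : Plane) : StronglyMeasurable fun y => f (x - ε • y) :=
  hf.comp_measurable (by fun_prop)

theorem locallyIntegrable_of_bounded {E : Type*} [NormedAddCommGroup E] {f : Plane → E} {M : ℝ}
    (hf : StronglyMeasurable f) (hM : ∀ y, ‖f y‖ ≤ M) : LocallyIntegrable f :=
  (memLp_top_of_bound hf.aestronglyMeasurable M (Filter.Eventually.of_forall hM)).locallyIntegrable
    le_top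

variable {F : Type*} [NormedAddCommGroup F] [NormedSpace ℝ F]

theorem norm_integral_le_setAverage {g : Plane → F} {b : Plane → ℝ}
    (hb : IntegrableOn b (ball 0 1)) (h : ∀ y ∈ ball (0 : Plane) 1, ‖g y‖ ≤ b y)
    (h0 : ∀ y ∉ ball (0 : Plane) 1, g y = 0) :
    ‖∫ y, g y‖ ≤ volume.real (ball (0 : Plane) 1) * ⨍ y in ball 0 1, b y := by
  rw [setAverage_eq, smul_eq_mul, ← mul_assoc, mul_inv_cancel₀, one_mul]
  · rw [← setIntegral_eq_integral_of_forall_compl_eq_zero h0]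
    exact norm_integral_le_of_norm_le hb
      ((ae_restrict_iff' measurableSet_ball).2 (Filter.Eventually.of_forall h))
  · exact (ENNReal.toReal_pos (measure_ball_pos _ _ one_pos).ne' measure_ball_lt_top.ne).ne'

theorem integrable_kernel_smul {f : Plane → F} {M : ℝ} (hf : AEStronglyMeasurable f)
    (hM : ∀ y, ‖f y‖ ≤ M) : Integrable fun y => kernel y • f y :=
  integrable_kernel.smul_bdd M hf (Filter.Eventually.of_forall hM)

theorem integrable_fderiv_kernel_smul {f : Plane → F} {M : ℝ} (hf : AEStronglyMeasurable f)
    (hM : ∀ y, ‖f y‖ ≤ M) (v : Plane) : Integrable fun y => fderiv ℝ kernel y v • f y :=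
  (integrable_fderiv_kernel v).smul_bdd M hf (Filter.Eventually.of_forall hM)

theorem mollify_eq_convolution {ε : ℝ} (hε : 0 < ε) (f : Plane → F) :
    mollify ε f = fun x => (ε ^ 2)⁻¹ • MeasureTheory.convolution (fun t => kernel (ε⁻¹ • t)) f
      (ContinuousLinearMap.lsmul ℝ ℝ) volume x := by
  ext1 x
  have h := Measure.integral_comp_smul (volume : Measure Plane)
    (fun t => kernel (ε⁻¹ • t) • f (x - t)) ε
  simp only [smul_smul, inv_mul_cancel₀ hε.ne', one_smul] at h
  rw [mollify, h, convolution]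
  simp

theorem hasCompactSupport_kernel_smul {ε : ℝ} (hε : 0 < ε) :
    HasCompactSupport fun t => kernel (ε⁻¹ • t) :=
  hasCompactSupport_kernel.comp_smul (inv_ne_zero hε.ne')

theorem contDiff_mollify [CompleteSpace F] {ε : ℝ} (hε : 0 < ε) {f : Plane → F} {M : ℝ}
    (hf : StronglyMeasurable f)
    (hM : ∀ y, ‖f y‖ ≤ M) {n : ℕ∞} : ContDiff ℝ n (mollify ε f) := by
  rw [mollify_eq_convolution hε]
  refine contDiff_const.smul ?_
  exact (hasCompactSupport_kernel_smul hε).contDiff_convolution_left _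
    (contDiff_kernel.comp (contDiff_const_smul _)) (locallyIntegrable_of_bounded hf hM)

theorem fderiv_mollify_apply [CompleteSpace F] {ε : ℝ} (hε : 0 < ε) {f : Plane → F} {M : ℝ}
    (hf : StronglyMeasurable f)
    (hM : ∀ y, ‖f y‖ ≤ M) (x v : Plane) :
    fderiv ℝ (mollify ε f) x v = ε⁻¹ • ∫ y, fderiv ℝ kernel y v • f (x - ε • y) := by
  have hk : ContDiff ℝ 1 fun t : Plane => kernel (ε⁻¹ • t) :=
    (contDiff_kernel (n := 1)).comp (contDiff_const_smul _)
  have hd := (hasCompactSupport_kernel_smul hε).hasFDerivAt_convolution_left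
    (ContinuousLinearMap.lsmul ℝ ℝ) hk (locallyIntegrable_of_bounded hf hM) x
  have hd' : HasFDerivAt (fun x => (ε ^ 2)⁻¹ • MeasureTheory.convolution
      (fun t => kernel (ε⁻¹ • t)) f (ContinuousLinearMap.lsmul ℝ ℝ) volume x) _ x :=
    hd.const_smul ((ε ^ 2)⁻¹)
  rw [mollify_eq_convolution hε, hd'.fderiv]
  have hfd : ∀ t : Plane, fderiv ℝ (fun t : Plane => kernel (ε⁻¹ • t)) t =
      ε⁻¹ • fderiv ℝ kernel (ε⁻¹ • t) := fun t => fderiv_comp_smul _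
  have hint : Integrable fun t => (ContinuousLinearMap.precompL Plane
      (ContinuousLinearMap.lsmul ℝ ℝ : ℝ →L[ℝ] F →L[ℝ] F))
      (fderiv ℝ (fun t : Plane => kernel (ε⁻¹ • t)) t) (f (x - t)) := by
    refine HasCompactSupport.convolutionExists_left _ ?_ ?_ (locallyIntegrable_of_bounded hf hM) x
    · exact (hasCompactSupport_kernel_smul hε).fderiv (𝕜 := ℝ)
    · exact hk.continuous_fderiv (by norm_num)
  rw [smul_apply, convolution, ContinuousLinearMap.integral_apply hint]
  have h := Measure.integral_comp_smul (volume : Measure Plane)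
    (fun t => fderiv ℝ kernel (ε⁻¹ • t) v • f (x - t)) ε
  simp only [smul_smul, inv_mul_cancel₀ hε.ne', one_smul] at h
  simp only [ContinuousLinearMap.precompL_apply, hfd]
  rw [h]
  simp [mul_smul, integral_smul]
  exact smul_comm _ _ _

theorem volume_ball_pos : 0 < volume.real (ball (0 : Plane) 1) :=
  ENNReal.toReal_pos (measure_ball_pos _ _ one_pos).ne' measure_ball_lt_top.ne

/-- A constant that bounds averages weighted by the kernel, or by its derivative, in terms of
unweighted averages over the unit ball. -/
noncomputable def kernelConst : ℝ :=
  exists_kernel_bound.choose * volume.real (ball (0 : Plane) 1)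

theorem kernelConst_pos : 0 < kernelConst :=
  mul_pos exists_kernel_bound.choose_spec.1 volume_ball_pos

theorem norm_integral_kernel_smul_le {g : Plane → F} {b : Plane → ℝ}
    (hb : IntegrableOn b (ball 0 1)) (h : ∀ y ∈ ball (0 : Plane) 1, ‖g y‖ ≤ b y) :
    ‖∫ y, kernel y • g y‖ ≤ kernelConst * ⨍ y in ball 0 1, b y := by
  obtain ⟨h0, h1, -⟩ := exists_kernel_bound.choose_spec
  have := norm_integral_le_setAverage (g := fun y => kernel y • g y)
    (b := fun y => exists_kernel_bound.choose * b y) (hb.const_mul _) (fun y hy => by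
      rw [norm_smul, Real.norm_of_nonneg (kernel_nonneg y)]
      exact mul_le_mul (h1 y) (h y hy) (norm_nonneg _) h0.le)
    (fun y hy => by simp [kernel_eq_zero hy])
  refine this.trans_eq ?_
  simp only [setAverage_eq, integral_const_mul, smul_eq_mul, kernelConst]
  ring

theorem norm_integral_fderiv_kernel_smul_le {g : Plane → F} {b : Plane → ℝ}
    (hb : IntegrableOn b (ball 0 1)) (h : ∀ y ∈ ball (0 : Plane) 1, ‖g y‖ ≤ b y) (v : Plane) :
    ‖∫ y, fderiv ℝ kernel y v • g y‖ ≤ kernelConst * ‖v‖ * ⨍ y in ball 0 1, b y := by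
  obtain ⟨h0, -, h1⟩ := exists_kernel_bound.choose_spec
  have := norm_integral_le_setAverage (g := fun y => fderiv ℝ kernel y v • g y)
    (b := fun y => exists_kernel_bound.choose * ‖v‖ * b y) (hb.const_mul _) (fun y hy => by
      rw [norm_smul]
      exact mul_le_mul ((fderiv ℝ kernel y).le_of_opNorm_le (h1 y) v) (h y hy) (norm_nonneg _)
        (by positivity))
    (fun y hy => by simp [fderiv_kernel_eq_zero hy])
  refine this.trans_eq ?_
  simp only [setAverage_eq, integral_const_mul, smul_eq_mul, kernelConst]
  ring

end Mollification

/-! ### Mean oscillations -/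

section Oscillation

/-- The size of the increment of `m` from `x` to `x - εy`. -/
noncomputable def incr (m : Plane → Circle) (ε : ℝ) (x y : Plane) : ℝ :=
  ‖(m (x - ε • y) : ℂ) - m x‖

/-- The mean oscillation of `m` with exponent `k` at scale `ε` around `x`: the average over `y` in
the unit ball of `|m(x - εy) - m(x)|^k`. -/
noncomputable def osc (m : Plane → Circle) (ε k : ℝ) (x : Plane) : ℝ :=
  ⨍ y in ball (0 : Plane) 1, incr m ε x y ^ k

variable {m : Plane → Circle}

theorem incr_nonneg (ε : ℝ) (x y : Plane) : 0 ≤ incr m ε x y := norm_nonneg _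

theorem incr_le_two (ε : ℝ) (x y : Plane) : incr m ε x y ≤ 2 := by
  refine (norm_sub_le _ _).trans ?_
  simp only [Circle.norm_coe]
  norm_num

theorem measurable_incr (hm : StronglyMeasurable m) (ε : ℝ) :
    Measurable fun q : Plane × Plane => incr m ε q.1 q.2 := by
  have h1 : Measurable fun q : Plane × Plane => (m (q.1 - ε • q.2) : ℂ) :=
    (continuous_subtype_val.comp_stronglyMeasurable hm).measurable.comp (by fun_prop)
  have h2 : Measurable fun q : Plane × Plane => (m q.1 : ℂ) :=
    (continuous_subtype_val.comp_stronglyMeasurable hm).measurable.comp measurable_fst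
  exact (h1.sub h2).norm

theorem measurable_incr_right (hm : StronglyMeasurable m) (ε : ℝ) (x : Plane) :
    Measurable (incr m ε x) :=
  (measurable_incr hm ε).comp (measurable_const.prodMk measurable_id)

theorem incr_rpow_le {k : ℝ} (hk : 0 ≤ k) (ε : ℝ) (x y : Plane) : incr m ε x y ^ k ≤ 2 ^ k :=
  Real.rpow_le_rpow (incr_nonneg _ _ _) (incr_le_two _ _ _) hk

theorem norm_incr_rpow_le {k : ℝ} (hk : 0 ≤ k) (ε : ℝ) (x y : Plane) :
    ‖incr m ε x y ^ k‖ ≤ 2 ^ k := by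
  rw [Real.norm_of_nonneg (Real.rpow_nonneg (incr_nonneg _ _ _) _)]
  exact incr_rpow_le hk ε x y

theorem integrableOn_incr_rpow (hm : StronglyMeasurable m) (ε : ℝ) {k : ℝ} (hk : 0 ≤ k)
    (x : Plane) :
    IntegrableOn (fun y => incr m ε x y ^ k) (ball 0 1) := by
  refine Measure.integrableOn_of_bounded (M := 2 ^ k) measure_ball_lt_top.ne ?_ ?_
  · exact ((measurable_incr_right hm ε x).pow_const k).aestronglyMeasurable
  · exact Filter.Eventually.of_forall (norm_incr_rpow_le hk ε x)

theorem average_const_ball (a : ℝ) : ⨍ _y in ball (0 : Plane) 1, a = a :=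
  setAverage_const (measure_ball_pos _ _ one_pos).ne' measure_ball_lt_top.ne a

theorem average_mono {f g : Plane → ℝ} (hf : IntegrableOn f (ball 0 1))
    (hg : IntegrableOn g (ball 0 1)) (h : ∀ y, f y ≤ g y) :
    ⨍ y in ball (0 : Plane) 1, f y ≤ ⨍ y in ball (0 : Plane) 1, g y := by
  simp only [setAverage_eq, smul_eq_mul]
  exact mul_le_mul_of_nonneg_left (integral_mono hf hg h) (by positivity)

theorem average_add {f g : Plane → ℝ} (hf : IntegrableOn f (ball 0 1))
    (hg : IntegrableOn g (ball 0 1)) :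
    ⨍ y in ball (0 : Plane) 1, (f y + g y) =
      (⨍ y in ball (0 : Plane) 1, f y) + ⨍ y in ball (0 : Plane) 1, g y := by
  simp only [setAverage_eq, smul_eq_mul, integral_add hf hg, mul_add]

theorem average_const_mul (c : ℝ) (f : Plane → ℝ) :
    ⨍ y in ball (0 : Plane) 1, c * f y = c * ⨍ y in ball (0 : Plane) 1, f y := by
  simp only [setAverage_eq, smul_eq_mul, integral_const_mul]
  ring

theorem integrableOn_const_ball (a : ℝ) : IntegrableOn (fun _ : Plane => a) (ball 0 1) :=
  integrableOn_const measure_ball_lt_top.ne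

theorem osc_nonneg (ε k : ℝ) (x : Plane) : 0 ≤ osc m ε k x := by
  rw [osc, setAverage_eq]
  exact smul_nonneg (by positivity)
    (integral_nonneg fun y => Real.rpow_nonneg (incr_nonneg _ _ _) _)

theorem osc_le (hm : StronglyMeasurable m) (ε : ℝ) {k : ℝ} (hk : 0 ≤ k) (x : Plane) :
    osc m ε k x ≤ 2 ^ k := by
  rw [osc, ← average_const_ball (2 ^ k)]
  exact average_mono (integrableOn_incr_rpow hm ε hk x) (integrableOn_const_ball _)
    (incr_rpow_le hk ε x)

theorem measurable_osc (hm : StronglyMeasurable m) (ε k : ℝ) : Measurable (osc m ε k) := by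
  have h : StronglyMeasurable fun q : Plane × Plane => incr m ε q.1 q.2 ^ k :=
    ((measurable_incr hm ε).pow_const k).stronglyMeasurable
  have h2 := h.integral_prod_right' (ν := volume.restrict (ball (0 : Plane) 1))
  unfold osc
  simp only [setAverage_eq]
  exact h2.measurable.const_mul _

/-- Jensen's inequality for the mean oscillation. -/
theorem osc_one_rpow_le (hm : StronglyMeasurable m) (ε : ℝ) {k : ℝ} (hk : 1 ≤ k) (x : Plane) :
    osc m ε 1 x ^ k ≤ osc m ε k x := by
  have h := (convexOn_rpow hk).map_set_average_le (μ := (volume : Measure Plane))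
    (t := ball 0 1) (f := fun y => incr m ε x y)
    (Real.continuous_rpow_const (by linarith)).continuousOn isClosed_Ici
    (measure_ball_pos _ _ one_pos).ne' measure_ball_lt_top.ne
    (Filter.Eventually.of_forall fun y => incr_nonneg _ _ _)
    (by simpa using integrableOn_incr_rpow hm ε zero_le_one x)
    (integrableOn_incr_rpow hm ε (by linarith) x)
  simpa [osc] using h

/-- A pointwise bound between powers passes to the mean oscillations. -/
theorem osc_le_add (hm : StronglyMeasurable m) (ε : ℝ) {k p a b : ℝ} (hk : 0 ≤ k) (hp : 0 ≤ p)
    (h : ∀ d, 0 ≤ d → d ≤ 2 → d ^ k ≤ a + b * d ^ p) (x : Plane) :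
    osc m ε k x ≤ a + b * osc m ε p x := by
  have hi := integrableOn_incr_rpow hm ε hp x
  rw [osc, osc, ← average_const_mul, ← average_const_ball a,
    ← average_add (integrableOn_const_ball _) (hi.const_mul b)]
  exact average_mono (integrableOn_incr_rpow hm ε hk x)
    ((integrableOn_const_ball _).add (hi.const_mul b))
    fun y => h _ (incr_nonneg _ _ _) (incr_le_two _ _ _)

theorem osc_one_mul_osc_two_le (hm : StronglyMeasurable m) (ε : ℝ) (x : Plane) :
    osc m ε 1 x * osc m ε 2 x ≤ 2 * osc m ε 3 x := by
  set a := osc m ε 1 x with ha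
  have ha0 : 0 ≤ a := osc_nonneg _ _ _
  have hJ : a ^ (3 : ℝ) ≤ osc m ε 3 x := osc_one_rpow_le hm ε (by norm_num) x
  have h : a * osc m ε 2 x ≤ a ^ (3 : ℝ) + 1 * osc m ε 3 x := by
    have hi := integrableOn_incr_rpow hm ε (k := 3) (by norm_num) x
    rw [osc, osc, ← average_const_mul, ← average_const_mul, ← average_const_ball (a ^ (3 : ℝ)),
      ← average_add (integrableOn_const_ball _) (hi.const_mul 1)]
    refine average_mono ((integrableOn_incr_rpow hm ε (by norm_num) x).const_mul a)
      ((integrableOn_const_ball _).add (hi.const_mul 1)) fun y => ?_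
    have hd := incr_nonneg (m := m) ε x y
    set d := incr m ε x y
    norm_cast
    rcases le_total a d with h | h
    · nlinarith [mul_le_mul_of_nonneg_right h (sq_nonneg d), pow_nonneg ha0 3]
    · nlinarith [mul_le_mul_of_nonneg_left (pow_le_pow_left₀ hd h 2) ha0, pow_nonneg hd 3]
  linarith

/-- Averages of powers of a quantity controlled by the increment and the mean oscillation are
controlled by the mean oscillation. -/
theorem average_rpow_le (hm : StronglyMeasurable m) {ε k C : ℝ} (hk : 1 ≤ k) (hC : 0 ≤ C)
    {x : Plane} {δ : Plane → ℝ} (hδ : Measurable δ)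
    (h : ∀ y, |δ y| ≤ C * (incr m ε x y + osc m ε 1 x)) :
    IntegrableOn (fun y => |δ y| ^ k) (ball 0 1) ∧
    ⨍ y in ball (0 : Plane) 1, |δ y| ^ k ≤ 2 * (2 * C) ^ k * osc m ε k x := by
  have hk0 : 0 ≤ k := by linarith
  set a := osc m ε 1 x with ha
  have ha0 : 0 ≤ a := osc_nonneg _ _ _
  have hJ : a ^ k ≤ osc m ε k x := osc_one_rpow_le hm ε hk x
  have hi := integrableOn_incr_rpow hm ε hk0 x
  have key : ∀ y, |δ y| ^ k ≤ (2 * C) ^ k * (a ^ k + incr m ε x y ^ k) := fun y => by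
    have hd := incr_nonneg (m := m) ε x y
    set d := incr m ε x y
    have h1 : |δ y| ≤ 2 * C * max a d := by
      refine (h y).trans ?_
      nlinarith [mul_le_mul_of_nonneg_left (add_le_add (le_max_right a d) (le_max_left a d)) hC]
    refine (Real.rpow_le_rpow (abs_nonneg _) h1 hk0).trans ?_
    rw [Real.mul_rpow (by positivity) (by positivity)]
    refine mul_le_mul_of_nonneg_left ?_ (by positivity)
    rcases le_total a d with h | h
    · rw [max_eq_right h]; linarith [Real.rpow_nonneg ha0 k]
    · rw [max_eq_left h]; linarith [Real.rpow_nonneg hd k]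
  have hR : IntegrableOn (fun y => (2 * C) ^ k * (a ^ k + incr m ε x y ^ k)) (ball 0 1) :=
    ((integrableOn_const_ball _).add hi).const_mul _
  have hL : IntegrableOn (fun y => |δ y| ^ k) (ball 0 1) := by
    refine Integrable.mono' hR
      ((hδ.abs).pow_const k).aestronglyMeasurable (Filter.Eventually.of_forall fun y => ?_)
    rw [Real.norm_of_nonneg (by positivity)]
    exact key y
  refine ⟨hL, (average_mono hL hR key).trans ?_⟩
  rw [average_const_mul, average_add (integrableOn_const_ball _) hi, average_const_ball]
  have : (0 : ℝ) ≤ (2 * C) ^ k := by positivity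
  change (2 * C) ^ k * (a ^ k + osc m ε k x) ≤ _
  nlinarith

end Oscillation

/-! ### Mollification of functions of a circle-valued map -/

section MollificationBounds

variable {F : Type*} [NormedAddCommGroup F] [NormedSpace ℝ F] [CompleteSpace F]
  {m : Plane → Circle} {f : Plane → F} {M C : ℝ}

theorem mollify_sub_const (hf : StronglyMeasurable f) (hM : ∀ y, ‖f y‖ ≤ M) (ε : ℝ) (x : Plane)
    (c : F) : mollify ε f x - c = ∫ y, kernel y • (f (x - ε • y) - c) := by
  simp only [smul_sub]
  rw [integral_sub (integrable_kernel_smul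
    (stronglyMeasurable_comp_sub_smul hf ε x).aestronglyMeasurable fun y => hM _)
    (integrable_kernel.smul_const c), integral_smul_const, integral_kernel, one_smul, mollify]

theorem norm_mollify_sub_le (hm : StronglyMeasurable m) (hf : StronglyMeasurable f)
    (hM : ∀ y, ‖f y‖ ≤ M) (hC : ∀ x x', ‖f x' - f x‖ ≤ C * ‖(m x' : ℂ) - m x‖)
    (ε : ℝ) (x : Plane) :
    ‖mollify ε f x - f x‖ ≤ kernelConst * C * osc m ε 1 x := by
  rw [mollify_sub_const hf hM]
  have hi := (integrableOn_incr_rpow hm ε zero_le_one x).const_mul C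
  have := norm_integral_kernel_smul_le (g := fun y => f (x - ε • y) - f x)
    (b := fun y => C * incr m ε x y ^ (1 : ℝ)) hi
    (fun y _ => by rw [Real.rpow_one]; exact hC _ _)
  rw [average_const_mul] at this
  rw [mul_assoc]
  exact this

theorem norm_fderiv_mollify_le (hm : StronglyMeasurable m) (hf : StronglyMeasurable f)
    (hM : ∀ y, ‖f y‖ ≤ M) (hC0 : 0 ≤ C) (hC : ∀ x x', ‖f x' - f x‖ ≤ C * ‖(m x' : ℂ) - m x‖)
    {ε : ℝ} (hε : 0 < ε) (x : Plane) :
    ‖fderiv ℝ (mollify ε f) x‖ ≤ kernelConst * C / ε * osc m ε 1 x := by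
  have hK := kernelConst_pos.le
  refine ContinuousLinearMap.opNorm_le_bound _ (mul_nonneg (by positivity) (osc_nonneg _ _ _))
    fun v => ?_
  have hi := (integrableOn_incr_rpow hm ε zero_le_one x).const_mul C
  have h := norm_integral_fderiv_kernel_smul_le (g := fun y => f (x - ε • y) - f x)
    (b := fun y => C * incr m ε x y ^ (1 : ℝ)) hi
    (fun y _ => by rw [Real.rpow_one]; exact hC _ _) v
  have h2 : ∫ y, fderiv ℝ kernel y v • (f (x - ε • y) - f x) =
      ∫ y, fderiv ℝ kernel y v • f (x - ε • y) := by
    simp only [smul_sub]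
    rw [integral_sub (integrable_fderiv_kernel_smul
      (stronglyMeasurable_comp_sub_smul hf ε x).aestronglyMeasurable (fun y => hM _) v)
      ((integrable_fderiv_kernel v).smul_const _), integral_smul_const, integral_fderiv_kernel,
      zero_smul, sub_zero]
  rw [h2, average_const_mul] at h
  rw [fderiv_mollify_apply hε hf hM, norm_smul, Real.norm_of_nonneg (by positivity)]
  refine (mul_le_mul_of_nonneg_left h (by positivity)).trans_eq ?_
  change ε⁻¹ * (kernelConst * ‖v‖ * (C * osc m ε 1 x)) = _
  field_simp

end MollificationBounds

/-! ### Negligible error terms -/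

section Smallness

variable {m : Plane → Circle} {p : ℝ}

/-- The splitting behind the equi-integrability of `ε⁻¹ osc m ε 3`. -/
theorem osc_three_le (hm : StronglyMeasurable m) (hp : 3 < p) {ε N : ℝ} (hε : 0 < ε) (hN : 0 < N)
    (x : Plane) :
    ε⁻¹ * osc m ε 3 x ≤ N + N ^ (1 - p / 3) * (ε ^ (-(p / 3)) * osc m ε p x) := by
  have h := osc_le_add hm ε (k := 3) (p := p) (a := ε * N)
    (b := ε * (N ^ (1 - p / 3) * ε ^ (-(p / 3)))) (by norm_num) (by linarith) (fun d hd _ => ?_) x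
  · rw [inv_mul_le_iff₀ hε]
    refine h.trans_eq ?_
    ring
  · have hNN : N ^ (1 - p / 3) = N * N ^ (-(p / 3)) := by
      rw [sub_eq_add_neg, Real.rpow_add hN, Real.rpow_one]
    set t := d ^ (3 : ℝ) / (ε * N) with ht
    have ht0 : 0 ≤ t := by positivity
    have h1 : t ≤ 1 + t ^ (p / 3) := by
      rcases le_total t 1 with h | h
      · linarith [Real.rpow_nonneg ht0 (p / 3)]
      · have := Real.rpow_le_rpow_of_exponent_le h (show (1 : ℝ) ≤ p / 3 by linarith)
        rw [Real.rpow_one] at this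
        linarith
    have h2 : t ^ (p / 3) = N ^ (-(p / 3)) * ε ^ (-(p / 3)) * d ^ p := by
      rw [ht, Real.div_rpow (by positivity) (by positivity), ← Real.rpow_mul hd,
        Real.mul_rpow hε.le hN.le, Real.rpow_neg hε.le, Real.rpow_neg hN.le,
        show (3 : ℝ) * (p / 3) = p by ring]
      field_simp
    have h3 : d ^ (3 : ℝ) = ε * N * t := by rw [ht]; field_simp
    rw [h3, hNN]
    calc ε * N * t ≤ ε * N * (1 + t ^ (p / 3)) := by gcongr
      _ = _ := by rw [h2]; ring

/-- Errors that vanish in the limit: for every `η > 0` they are pointwise at most `η` times a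
family bounded in `L¹_loc`, up to a multiple of `ε⁻¹ osc m ε p`, which tends to zero in `L¹_loc`
since `p > 3`. -/
def IsSmall (m : Plane → Circle) (p : ℝ) (E : ℝ → Plane → ℝ) : Prop :=
  ∀ η > 0, ∃ C : ℝ, 0 ≤ C ∧ ∀ ε, 0 < ε → ε ≤ 1 → ∀ x,
    |E ε x| ≤ η * (1 + ε ^ (-(p / 3)) * osc m ε p x) + C * (ε⁻¹ * osc m ε p x)

theorem IsSmall.of_le {E E' : ℝ → Plane → ℝ} (h : IsSmall m p E) {M : ℝ}
    (hE : ∀ ε, 0 < ε → ε ≤ 1 → ∀ x, |E' ε x| ≤ M * |E ε x|) : IsSmall m p E' := by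
  intro η hη
  obtain ⟨C, hC, h⟩ := h (η / (|M| + 1)) (by positivity)
  refine ⟨(|M| + 1) * C, by positivity, fun ε hε hε1 x => ?_⟩
  have h1 : |E' ε x| ≤ (|M| + 1) * |E ε x| :=
    (hE ε hε hε1 x).trans (mul_le_mul_of_nonneg_right (by linarith [le_abs_self M])
      (abs_nonneg _))
  refine h1.trans ((mul_le_mul_of_nonneg_left (h ε hε hε1 x) (by positivity)).trans_eq ?_)
  field_simp

theorem IsSmall.add {E E' : ℝ → Plane → ℝ} (h : IsSmall m p E) (h' : IsSmall m p E') :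
    IsSmall m p fun ε x => E ε x + E' ε x := by
  intro η hη
  obtain ⟨C, hC, h⟩ := h (η / 2) (by positivity)
  obtain ⟨C', hC', h'⟩ := h' (η / 2) (by positivity)
  refine ⟨C + C', by positivity, fun ε hε hε1 x => ?_⟩
  have := (abs_add_le (E ε x) (E' ε x)).trans (add_le_add (h ε hε hε1 x) (h' ε hε hε1 x))
  linarith

theorem IsSmall.sum {ι : Type*} (s : Finset ι) {E : ι → ℝ → Plane → ℝ}
    (h : ∀ i ∈ s, IsSmall m p (E i)) : IsSmall m p fun ε x => ∑ i ∈ s, E i ε x := by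
  classical
  induction s using Finset.induction_on with
  | empty =>
    intro η hη
    refine ⟨0, le_rfl, fun ε hε _ x => ?_⟩
    have := osc_nonneg (m := m) ε p x
    simp only [Finset.sum_empty, abs_zero, zero_mul, add_zero]
    positivity
  | insert a s ha ih =>
    simp only [Finset.sum_insert ha]
    exact (h a (by simp)).add (ih fun i hi => h i (by simp [hi]))

theorem rpow_le_add_of_lt {k : ℝ} (hk : 0 < k) (hkp : k ≤ p) {η : ℝ} (hη : 0 < η) :
    ∃ C : ℝ, 0 ≤ C ∧ ∀ d : ℝ, 0 ≤ d → d ≤ 2 → d ^ k ≤ η + C * d ^ p := by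
  -- split at the value `r` of `d` where `d ^ k = η`
  set r := η ^ k⁻¹ with hr
  have hr0 : 0 < r := by positivity
  have hrk : r ^ k = η := by rw [hr, ← Real.rpow_mul hη.le, inv_mul_cancel₀ hk.ne', Real.rpow_one]
  refine ⟨r ^ (k - p), by positivity, fun d hd _ => ?_⟩
  rcases le_total d r with h | h
  · have := Real.rpow_le_rpow hd h hk.le
    have h2 : 0 ≤ r ^ (k - p) * d ^ p := by positivity
    linarith
  · have hd' : 0 < d := hr0.trans_le h
    have h1 : d ^ k = d ^ (k - p) * d ^ p := by rw [← Real.rpow_add hd']; ring_nf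
    have h2 : d ^ (k - p) ≤ r ^ (k - p) :=
      Real.rpow_le_rpow_of_nonpos hr0 h (by linarith)
    rw [h1]
    have := mul_le_mul_of_nonneg_right h2 (Real.rpow_nonneg hd p)
    linarith

theorem isSmall_osc (hm : StronglyMeasurable m) {k : ℝ} (hk : 0 < k) (hkp : k ≤ p) :
    IsSmall m p fun ε x => osc m ε k x := by
  intro η hη
  obtain ⟨C, hC, h⟩ := rpow_le_add_of_lt hk hkp hη
  refine ⟨C, hC, fun ε hε hε1 x => ?_⟩
  have ho := osc_nonneg (m := m) ε p x
  rw [abs_of_nonneg (osc_nonneg _ _ _)]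
  refine (osc_le_add hm ε hk.le (hk.le.trans hkp) h x).trans ?_
  have h1 : osc m ε p x ≤ ε⁻¹ * osc m ε p x :=
    le_mul_of_one_le_left ho ((one_le_inv₀ hε).2 hε1)
  have h2 : 0 ≤ η * (ε ^ (-(p / 3)) * osc m ε p x) := by positivity
  nlinarith [mul_le_mul_of_nonneg_left h1 hC]

theorem isSmall_inv_mul_osc : IsSmall m p fun ε x => ε⁻¹ * osc m ε p x := by
  intro η hη
  refine ⟨1, zero_le_one, fun ε hε hε1 x => ?_⟩
  have ho := osc_nonneg (m := m) ε p x
  rw [abs_of_nonneg (by positivity), one_mul]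
  exact le_add_of_nonneg_left (by positivity)

/-- The product of a cubic quantity `ε⁻¹ osc m ε 1 * osc m ε 2`, bounded in `L¹_loc`, with a
quantity that tends to zero. -/
theorem isSmall_cubic (hm : StronglyMeasurable m) (hp : 3 < p) {E : ℝ → Plane → ℝ}
    (h : ∀ η > 0, ∃ C : ℝ, 0 ≤ C ∧ ∀ ε, 0 < ε → ε ≤ 1 → ∀ x,
      |E ε x| ≤ ε⁻¹ * osc m ε 1 x * (η * osc m ε 2 x + C * osc m ε p x)) :
    IsSmall m p E := by
  intro η hη
  obtain ⟨C, hC, h⟩ := h (η / 2) (by positivity)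
  refine ⟨2 * C, by positivity, fun ε hε hε1 x => (h ε hε hε1 x).trans ?_⟩
  have ho := osc_nonneg (m := m) ε p x
  have h1 := osc_one_mul_osc_two_le hm ε x
  have h2 := osc_three_le hm hp hε one_pos x
  have h3 : osc m ε 1 x ≤ 2 := by simpa using osc_le hm ε zero_le_one x
  rw [Real.one_rpow, one_mul] at h2
  have hi : 0 < ε⁻¹ := by positivity
  calc ε⁻¹ * osc m ε 1 x * (η / 2 * osc m ε 2 x + C * osc m ε p x)
      = η / 2 * (ε⁻¹ * (osc m ε 1 x * osc m ε 2 x)) +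
          C * (ε⁻¹ * (osc m ε 1 x * osc m ε p x)) := by ring
    _ ≤ η / 2 * (ε⁻¹ * (2 * osc m ε 3 x)) + C * (ε⁻¹ * (2 * osc m ε p x)) := by gcongr
    _ = η * (ε⁻¹ * osc m ε 3 x) + 2 * C * (ε⁻¹ * osc m ε p x) := by ring
    _ ≤ _ := by gcongr

/-- The quantitative form of `m ∈ B^{1/3}_{p,∞,loc}` for finite `p`: on compact subsets of `Ω`, the
`p`-th moments of the increments `m(x + h) - m(x)` are at most of order `|h|^{p/3}`. -/
def HasIncrementBound (Ω : Opens Plane) (m : Plane → Circle) (p : ℝ) : Prop :=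
  ∀ K : Set Plane, IsCompact K → K ⊆ Ω → ∃ C : ℝ, 0 ≤ C ∧ ∃ r : ℝ, 0 < r ∧ ∀ h : Plane,
    ‖h‖ < r → ∫ x in K, ‖(m (x + h) : ℂ) - m x‖ ^ p ≤ C * ‖h‖ ^ (p / 3)

theorem integrableOn_osc (hm : StronglyMeasurable m) {k : ℝ} (hk : 0 ≤ k) (ε : ℝ) {K : Set Plane}
    (hK : IsCompact K) : IntegrableOn (osc m ε k) K := by
  refine Measure.integrableOn_of_bounded (M := 2 ^ k) hK.measure_lt_top.ne
    (measurable_osc hm ε k).aestronglyMeasurable (Eventually.of_forall fun x => ?_)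
  rw [Real.norm_of_nonneg (osc_nonneg _ _ _)]
  exact osc_le hm ε hk x

theorem HasIncrementBound.integral_osc_le {Ω : Opens Plane} (hB : HasIncrementBound Ω m p)
    (hm : StronglyMeasurable m) (hp : 0 < p) {K : Set Plane} (hK : IsCompact K) (hKΩ : K ⊆ Ω) :
    ∃ C : ℝ, 0 ≤ C ∧ ∃ r : ℝ, 0 < r ∧ ∀ ε, 0 < ε → ε < r →
      ∫ x in K, osc m ε p x ≤ C * ε ^ (p / 3) := by
  obtain ⟨C, hC, r, hr, h⟩ := hB K hK hKΩ
  refine ⟨C, hC, r, hr, fun ε hε hεr => ?_⟩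
  have hmeas : Measurable fun q : Plane × Plane => incr m ε q.1 q.2 ^ p :=
    (measurable_incr hm ε).pow_const p
  have : IsFiniteMeasure (volume.restrict K) := ⟨by simpa using hK.measure_lt_top⟩
  have : IsFiniteMeasure (volume.restrict (ball (0 : Plane) 1)) :=
    ⟨by simp⟩
  have hint : Integrable (Function.uncurry fun x y => incr m ε x y ^ p)
      ((volume.restrict K).prod (volume.restrict (ball (0 : Plane) 1))) :=
    Integrable.of_bound hmeas.aestronglyMeasurable (2 ^ p)
      (Eventually.of_forall fun q => norm_incr_rpow_le hp.le ε q.1 q.2)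
  unfold osc
  simp only [setAverage_eq]
  rw [integral_smul, integral_integral_swap hint, smul_eq_mul]
  have h2 : ∫ y in ball (0 : Plane) 1, ∫ x in K, incr m ε x y ^ p ≤
      ∫ y in ball (0 : Plane) 1, C * ε ^ (p / 3) := by
    refine setIntegral_mono_on hint.swap.integral_prod_left (integrableOn_const_ball _)
      measurableSet_ball fun y hy => ?_
    have hy' : ‖y‖ < 1 := by simpa using hy
    have hn : ‖-(ε • y)‖ = ε * ‖y‖ := by rw [norm_neg, norm_smul, Real.norm_of_nonneg hε.le]
    have h3 := h (-(ε • y)) (by rw [hn]; nlinarith [norm_nonneg y])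
    simp only [← sub_eq_add_neg] at h3
    refine h3.trans ?_
    rw [hn]
    gcongr
    nlinarith [norm_nonneg y]
  rw [setIntegral_const, smul_eq_mul] at h2
  rw [inv_mul_le_iff₀ volume_ball_pos]
  exact h2

theorem IsSmall.tendsto_integral {E : ℝ → Plane → ℝ} (hE : IsSmall m p E) {Ω : Opens Plane}
    (hB : HasIncrementBound Ω m p) (hm : StronglyMeasurable m) (hp : 3 < p) {K : Set Plane}
    (hK : IsCompact K) (hKΩ : K ⊆ Ω) (h0 : ∀ ε, ∀ x ∉ K, E ε x = 0) :
    Tendsto (fun ε => ∫ x, E ε x) (𝓝[>] 0) (𝓝 0) := by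
  obtain ⟨B, hB0, r, hr, hBr⟩ := hB.integral_osc_le hm (by linarith) hK hKΩ
  rw [Metric.tendsto_nhds]
  intro η hη
  set V := volume.real K with hV
  have hV0 : 0 ≤ V := measureReal_nonneg
  obtain ⟨C, hC, h⟩ := hE (η / (2 * (V + B + 1))) (by positivity)
  have hlim : Tendsto (fun ε : ℝ => C * B * ε ^ (p / 3 - 1)) (𝓝[>] 0) (𝓝 0) := by
    have : Tendsto (fun ε : ℝ => ε ^ (p / 3 - 1)) (𝓝[>] 0) (𝓝 0) := by
      have h1 := (Real.continuous_rpow_const (show 0 ≤ p / 3 - 1 by linarith)).tendsto 0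
      rw [Real.zero_rpow (by linarith)] at h1
      exact h1.mono_left nhdsWithin_le_nhds
    simpa using this.const_mul (C * B)
  have hev := (Metric.tendsto_nhds.1 hlim) (η / 2) (by positivity)
  filter_upwards [hev, self_mem_nhdsWithin, Ioo_mem_nhdsGT (lt_min hr one_pos)] with ε h1 hε0 hε
  have hε0 : 0 < ε := hε0
  have hεr : ε < r := hε.2.trans_le (min_le_left _ _)
  have hε1 : ε ≤ 1 := (hε.2.trans_le (min_le_right _ _)).le
  rw [dist_zero_right] at h1 ⊢
  set η' := η / (2 * (V + B + 1)) with hη'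
  have hη'0 : 0 < η' := by positivity
  have hi := integrableOn_osc hm (by linarith : 0 ≤ p) ε hK
  have hc : IntegrableOn (fun _ : Plane => (1 : ℝ)) K := integrableOn_const hK.measure_lt_top.ne
  have hb := hBr ε hε0 hεr
  have hle : ‖∫ x, E ε x‖ ≤ ∫ x in K, (η' * (1 + ε ^ (-(p / 3)) * osc m ε p x) +
      C * (ε⁻¹ * osc m ε p x)) := by
    rw [← setIntegral_eq_integral_of_forall_compl_eq_zero (h0 ε)]
    refine norm_integral_le_of_norm_le ?_ (Eventually.of_forall (h ε hε0 hε1))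
    exact ((hc.add (hi.const_mul _)).const_mul _).add ((hi.const_mul _).const_mul _)
  have heq : ∫ x in K, (η' * (1 + ε ^ (-(p / 3)) * osc m ε p x) + C * (ε⁻¹ * osc m ε p x)) =
      η' * (V + ε ^ (-(p / 3)) * ∫ x in K, osc m ε p x) + C * (ε⁻¹ * ∫ x in K, osc m ε p x) := by
    have hs : IntegrableOn (fun x => 1 + ε ^ (-(p / 3)) * osc m ε p x) K :=
      hc.add (hi.const_mul _)
    rw [integral_add (hs.const_mul _) ((hi.const_mul _).const_mul _), integral_const_mul,
      integral_const_mul, integral_const_mul, integral_add hc (hi.const_mul _),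
      integral_const_mul, setIntegral_const]
    simp [hV]
  have hpow1 : ε ^ (-(p / 3)) * ε ^ (p / 3) = 1 := by
    rw [← Real.rpow_add hε0]; simp
  have hpow2 : ε⁻¹ * ε ^ (p / 3) = ε ^ (p / 3 - 1) := by
    rw [Real.rpow_sub_one hε0.ne']; ring
  have hfin : η' * (V + ε ^ (-(p / 3)) * ∫ x in K, osc m ε p x) +
      C * (ε⁻¹ * ∫ x in K, osc m ε p x) ≤ η' * (V + B) + C * B * ε ^ (p / 3 - 1) := by
    calc _ ≤ η' * (V + ε ^ (-(p / 3)) * (B * ε ^ (p / 3))) + C * (ε⁻¹ * (B * ε ^ (p / 3))) := by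
            gcongr
      _ = η' * (V + B * (ε ^ (-(p / 3)) * ε ^ (p / 3))) + C * B * (ε⁻¹ * ε ^ (p / 3)) := by ring
      _ = _ := by rw [hpow1, hpow2]; ring
  have h4 : η' * (V + B) < η / 2 := by
    rw [hη', div_mul_eq_mul_div, div_lt_div_iff₀ (by positivity) (by positivity)]
    nlinarith
  have h5 := (le_abs_self _).trans_lt h1
  linarith [hle.trans (heq.le.trans hfin)]

end Smallness

/-! ### Calculus along arcs of the circle -/

section CircleCalculus

variable {E : Type*} [NormedAddCommGroup E] [NormedSpace ℝ E] {J : Set Circle} {f : Circle → E}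

theorem arg_mem_angles {z : Circle} (hz : z ∈ J) : Complex.arg z ∈ angles J := by
  change Circle.exp _ ∈ J
  rwa [Circle.exp_arg]

theorem add_two_pi_mem_angles {θ : ℝ} : θ + 2 * Real.pi ∈ angles J ↔ θ ∈ angles J := by
  simp only [angles, Set.mem_ofPred_eq, Circle.periodic_exp θ]

open scoped Pointwise in
theorem periodic_derivWithin_angles {g : ℝ → E} (hg : Function.Periodic g (2 * Real.pi)) :
    Function.Periodic (derivWithin g (angles J)) (2 * Real.pi) := by
  intro θ
  have h := derivWithin_comp_add_const g (2 * Real.pi) (angles J) θ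
  rw [show (fun x => g (x + 2 * Real.pi)) = g from funext hg,
    show (2 * Real.pi) +ᵥ angles J = angles J from ?_] at h
  · exact h.symm
  · ext t
    rw [Set.mem_vadd_set_iff_neg_vadd_mem, vadd_eq_add, ← add_two_pi_mem_angles]
    ring_nf

theorem apply_arg_exp {α : Type*} {g : ℝ → α} (hg : Function.Periodic g (2 * Real.pi)) (θ : ℝ) :
    g (Complex.arg (Circle.exp θ)) = g θ := by
  obtain ⟨k, hk⟩ := Circle.exp_eq_exp.1 (Circle.exp_arg (Circle.exp θ))
  rw [hk]
  exact hg.int_mul k θ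

theorem periodic_comp_exp {α : Type*} (f : Circle → α) :
    Function.Periodic (fun θ => f (Circle.exp θ)) (2 * Real.pi) :=
  fun θ => by simp only [Circle.periodic_exp θ]

theorem periodic_dTheta : Function.Periodic (dTheta J f) (2 * Real.pi) :=
  periodic_derivWithin_angles (periodic_comp_exp f)

theorem periodic_dTheta2 : Function.Periodic (dTheta2 J f) (2 * Real.pi) :=
  periodic_derivWithin_angles periodic_dTheta

theorem IsCkOn.hasDerivWithinAt {k : ℕ} (hf : IsCkOn k J f) (hk : k ≠ 0) {θ : ℝ}
    (hθ : θ ∈ angles J) :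
    HasDerivWithinAt (fun t => f (Circle.exp t)) (dTheta J f θ) (angles J) θ :=
  (hf.differentiableOn (by exact_mod_cast hk) θ hθ).hasDerivWithinAt

theorem IsCkOn.contDiffOn_dTheta (hu : UniqueDiffOn ℝ (angles J)) {k : ℕ}
    (hf : IsCkOn (k + 1) J f) : ContDiffOn ℝ k (dTheta J f) (angles J) :=
  ContDiffOn.derivWithin hf hu (by norm_cast)

theorem IsCkOn.hasDerivWithinAt_dTheta (hu : UniqueDiffOn ℝ (angles J)) (hf : IsCkOn 2 J f)
    {θ : ℝ} (hθ : θ ∈ angles J) :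
    HasDerivWithinAt (dTheta J f) (dTheta2 J f θ) (angles J) θ :=
  ((hf.contDiffOn_dTheta (k := 1) hu).differentiableOn (by norm_num) θ hθ).hasDerivWithinAt

theorem IsCkOn.continuousOn_dTheta (hu : UniqueDiffOn ℝ (angles J)) (hf : IsCkOn 1 J f) :
    ContinuousOn (dTheta J f) (angles J) :=
  (hf.contDiffOn_dTheta (k := 0) hu).continuousOn

theorem IsCkOn.continuousOn_dTheta2 (hu : UniqueDiffOn ℝ (angles J)) (hf : IsCkOn 2 J f) :
    ContinuousOn (dTheta2 J f) (angles J) :=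
  ContDiffOn.continuousOn (n := 0)
    (ContDiffOn.derivWithin (hf.contDiffOn_dTheta (k := 1) hu) hu (by norm_num))

theorem IsCkOn.of_le {k l : ℕ} (hf : IsCkOn l J f) (h : k ≤ l) : IsCkOn k J f :=
  ContDiffOn.of_le hf (by exact_mod_cast h)

theorem dTheta_eq_of_hasDerivWithinAt (hu : UniqueDiffOn ℝ (angles J)) {θ : ℝ}
    (hθ : θ ∈ angles J) {f' : E}
    (h : HasDerivWithinAt (fun t => f (Circle.exp t)) f' (angles J) θ) : dTheta J f θ = f' :=
  h.derivWithin (hu θ hθ)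

/-- A map on `J` that is continuous in the angle is continuous. -/
theorem continuousOn_of_comp_exp {α : Type*} [TopologicalSpace α] {f : Circle → α}
    (hf : ContinuousOn (fun θ => f (Circle.exp θ)) (angles J)) : ContinuousOn f J := by
  intro z₀ hz₀
  -- a continuous determination of the angle near `z₀`
  set τ : Circle → ℝ := fun z => Complex.arg ((z : ℂ) / z₀) + Complex.arg z₀ with hτ
  have hexp : ∀ z, Circle.exp (τ z) = z := fun z => by
    rw [hτ]
    simp only
    rw [Circle.exp_add, Circle.exp_arg, ← Circle.coe_div, Circle.exp_arg, div_mul_cancel]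
  have hτc : ContinuousAt τ z₀ := by
    refine ContinuousAt.add ?_ continuousAt_const
    refine ContinuousAt.comp (g := Complex.arg) (f := fun z : Circle => (z : ℂ) / z₀)
      (Complex.continuousAt_arg ?_) (by fun_prop (disch := simp))
    simp
  have hz : f = (fun θ => f (Circle.exp θ)) ∘ τ := by
    ext z
    simp [hexp]
  rw [hz]
  refine ContinuousWithinAt.comp (t := angles J) (hf (τ z₀) ?_) hτc.continuousWithinAt
    fun z hz => ?_
  · change Circle.exp _ ∈ J
    rwa [hexp]
  · change Circle.exp _ ∈ J
    rwa [hexp]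

theorem IsCkOn.continuousOn {k : ℕ} (hf : IsCkOn k J f) : ContinuousOn f J :=
  continuousOn_of_comp_exp (ContDiffOn.continuousOn hf)

theorem continuousOn_comp_arg {α : Type*} [TopologicalSpace α] {g : ℝ → α}
    (hg : Function.Periodic g (2 * Real.pi)) (hc : ContinuousOn g (angles J)) :
    ContinuousOn (fun z : Circle => g (Complex.arg z)) J := by
  refine continuousOn_of_comp_exp ?_
  simp only [apply_arg_exp hg]
  exact hc

/-- A modulus of continuity in affine form, for maps that are uniformly continuous and bounded. -/
theorem exists_modulus {E : Type*} [SeminormedAddCommGroup E] {f : Circle → E}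
    (hJ : IsCompact J) (hf : ContinuousOn f J) {η : ℝ} (hη : 0 < η) :
    ∃ C : ℝ, 0 ≤ C ∧ ∀ z ∈ J, ∀ w ∈ J, ‖f z - f w‖ ≤ η + C * ‖(z : ℂ) - w‖ := by
  obtain ⟨B, hB⟩ := hJ.exists_bound_of_continuousOn hf
  have hu := hJ.uniformContinuousOn_of_continuous hf
  obtain ⟨δ, hδ, h⟩ := Metric.uniformContinuousOn_iff.1 hu η hη
  refine ⟨2 * |B| / δ, by positivity, fun z hz w hw => ?_⟩
  rcases lt_or_ge (dist z w) δ with hlt | hge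
  · have := h z hz w hw hlt
    rw [dist_eq_norm] at this
    have h0 : 0 ≤ 2 * |B| / δ * ‖(z : ℂ) - w‖ := by positivity
    linarith
  · have hd : δ ≤ ‖(z : ℂ) - w‖ := by rw [← dist_eq_norm]; exact hge
    have h1 : ‖f z - f w‖ ≤ 2 * |B| := by
      have := norm_sub_le (f z) (f w)
      linarith [hB z hz, hB w hw, le_abs_self B]
    have h2 : 2 * |B| ≤ 2 * |B| / δ * ‖(z : ℂ) - w‖ := by
      rw [div_mul_eq_mul_div, le_div_iff₀ hδ]
      exact mul_le_mul_of_nonneg_left hd (by positivity)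
    linarith

theorem measurable_comp_of_continuousOn {X : Type*} [MeasurableSpace X] {g : ℝ → ℝ} {S : Set ℝ}
    (hg : ContinuousOn g S) {ϑ : X → ℝ} (hϑ : Measurable ϑ)
    (hmem : ∀ x, ϑ x ∈ S) : Measurable fun x => g (ϑ x) := by
  have h1 : Measurable (S.domRestrict g) := hg.domRestrict.measurable
  exact h1.comp (hϑ.subtype_mk (h := hmem))

theorem stronglyMeasurable_comp_circle {m : Plane → Circle}
    (hm : StronglyMeasurable m) (hmJ : ∀ x, m x ∈ J) {f : Circle → ℝ} (hf : ContinuousOn f J) :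
    StronglyMeasurable fun x => f (m x) := by
  have h1 : ContinuousOn (fun θ => f (Circle.exp θ)) (angles J) :=
    hf.comp Circle.exp.continuous.continuousOn fun θ hθ => hθ
  have h2 : Measurable fun x => Complex.arg (m x) :=
    Complex.measurable_arg.comp (continuous_subtype_val.comp_stronglyMeasurable hm).measurable
  have h3 := measurable_comp_of_continuousOn h1 h2
    fun x => arg_mem_angles (hmJ x)
  simp only [Circle.exp_arg] at h3
  exact h3.stronglyMeasurable

end CircleCalculus

/-! ### Taylor expansion in the angle -/

section Taylor

variable {J : Set Circle} {p : ℝ}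

/-- Second order Taylor expansion of a `C²` function of the angle, with a remainder `o(|t - s|²)`
uniform on compact intervals. -/
theorem taylor_angle (hu : UniqueDiffOn ℝ (angles J)) {c d : ℝ} (hcd : Set.Icc c d ⊆ angles J)
    {γ : Circle → ℝ} (hγ : IsCkOn 2 J γ) (hp : 0 ≤ p) {η : ℝ} (hη : 0 < η) :
    ∃ C : ℝ, 0 ≤ C ∧ ∀ s ∈ Set.Icc c d, ∀ t ∈ Set.Icc c d,
      |γ (Circle.exp t) - γ (Circle.exp s) - dTheta J γ s * (t - s) -
        1 / 2 * dTheta2 J γ s * (t - s) ^ 2| ≤ η * |t - s| ^ 2 + C * |t - s| ^ p := by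
  have hcont2 : ContinuousOn (dTheta2 J γ) (Set.Icc c d) := (hγ.continuousOn_dTheta2 hu).mono hcd
  have hcont1 : ContinuousOn (dTheta J γ) (Set.Icc c d) :=
    ((hγ.of_le (by norm_num)).continuousOn_dTheta hu).mono hcd
  have hcont0 : ContinuousOn (fun t => γ (Circle.exp t)) (Set.Icc c d) :=
    (ContDiffOn.continuousOn hγ).mono hcd
  obtain ⟨B2, hB2⟩ := isCompact_Icc.exists_bound_of_continuousOn hcont2
  obtain ⟨B1, hB1⟩ := isCompact_Icc.exists_bound_of_continuousOn hcont1
  obtain ⟨B0, hB0⟩ := isCompact_Icc.exists_bound_of_continuousOn hcont0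
  obtain ⟨δ, hδ, h⟩ := Metric.uniformContinuousOn_iff.1
    (isCompact_Icc.uniformContinuousOn_of_continuous hcont2) η hη
  set R := |d - c| with hR
  set B := 2 * |B0| + |B1| * R + |B2| * R ^ 2 with hB
  refine ⟨B * δ ^ (-p), by positivity, fun s hs t ht => ?_⟩
  rcases lt_or_ge |t - s| δ with hlt | hge
  · -- two applications of the mean value inequality
    have hsub : Set.uIcc s t ⊆ Set.Icc c d := Set.uIcc_subset_Icc hs ht
    have hconv : Convex ℝ (Set.uIcc s t) := convex_uIcc s t
    have hdist : ∀ r ∈ Set.uIcc s t, |r - s| ≤ |t - s| := fun r hr =>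
      Set.abs_sub_left_of_mem_uIcc hr
    have hd1 : ∀ r ∈ Set.uIcc s t,
        HasDerivWithinAt (fun r => dTheta J γ r - dTheta2 J γ s * (r - s))
          (dTheta2 J γ r - dTheta2 J γ s) (Set.uIcc s t) r := fun r hr => by
      have h1 := (hγ.hasDerivWithinAt_dTheta hu (hcd (hsub hr))).mono (hsub.trans hcd)
      have h2 := (((hasDerivWithinAt_id r (Set.uIcc s t)).sub_const s).const_mul
        (dTheta2 J γ s))
      convert! h1.sub h2 using 1
      simp
    have hb1 : ∀ r ∈ Set.uIcc s t, ‖dTheta2 J γ r - dTheta2 J γ s‖ ≤ η := fun r hr => by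
      have := h r (hsub hr) s hs ((hdist r hr).trans_lt hlt)
      rw [dist_eq_norm] at this
      exact this.le
    have hd0 : ∀ r ∈ Set.uIcc s t,
        HasDerivWithinAt (fun r => γ (Circle.exp r) - dTheta J γ s * (r - s) -
          1 / 2 * dTheta2 J γ s * (r - s) ^ 2)
          (dTheta J γ r - dTheta2 J γ s * (r - s) - dTheta J γ s) (Set.uIcc s t) r :=
      fun r hr => by
      have h1 := (hγ.hasDerivWithinAt two_ne_zero (hcd (hsub hr))).mono (hsub.trans hcd)
      have h2 := (((hasDerivWithinAt_id r (Set.uIcc s t)).sub_const s).const_mul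
        (dTheta J γ s))
      have h3 := ((((hasDerivWithinAt_id r (Set.uIcc s t)).sub_const s).pow 2).const_mul
        (1 / 2 * dTheta2 J γ s))
      convert! (h1.sub h2).sub h3 using 1
      simp
      ring
    have hb0 : ∀ r ∈ Set.uIcc s t,
        ‖dTheta J γ r - dTheta2 J γ s * (r - s) - dTheta J γ s‖ ≤ η * |t - s| := fun r hr => by
      have := hconv.norm_image_sub_le_of_norm_hasDerivWithin_le hd1 hb1 Set.left_mem_uIcc hr
      simp only [sub_self, mul_zero, sub_zero] at this
      refine this.trans ?_
      rw [Real.norm_eq_abs]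
      exact mul_le_mul_of_nonneg_left (hdist r hr) hη.le
    have := hconv.norm_image_sub_le_of_norm_hasDerivWithin_le hd0 hb0 Set.left_mem_uIcc
      Set.right_mem_uIcc
    simp only [sub_self, mul_zero, sub_zero, Real.norm_eq_abs, ne_eq, OfNat.ofNat_ne_zero,
      not_false_eq_true, zero_pow] at this
    have h0 : 0 ≤ B * δ ^ (-p) * |t - s| ^ p := by positivity
    have heq : γ (Circle.exp t) - γ (Circle.exp s) - dTheta J γ s * (t - s) -
        1 / 2 * dTheta2 J γ s * (t - s) ^ 2 = γ (Circle.exp t) - dTheta J γ s * (t - s) -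
        1 / 2 * dTheta2 J γ s * (t - s) ^ 2 - γ (Circle.exp s) := by ring
    rw [heq]
    refine this.trans ?_
    rw [pow_two, ← mul_assoc]
    linarith
  · have hts : |t - s| ≤ R := by
      rw [hR, abs_le]
      have := le_abs_self (d - c)
      constructor <;> linarith [hs.1, hs.2, ht.1, ht.2]
    have h1 : |γ (Circle.exp t) - γ (Circle.exp s) - dTheta J γ s * (t - s) -
        1 / 2 * dTheta2 J γ s * (t - s) ^ 2| ≤ B := by
      have e0 := (hB0 t ht).trans (le_abs_self B0)
      have e0' := (hB0 s hs).trans (le_abs_self B0)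
      have e1 := (hB1 s hs).trans (le_abs_self B1)
      have e2 := (hB2 s hs).trans (le_abs_self B2)
      simp only [Real.norm_eq_abs] at e0 e0' e1 e2
      have f1 : |dTheta J γ s * (t - s)| ≤ |B1| * R := by
        rw [abs_mul]; gcongr
      have f2 : |1 / 2 * dTheta2 J γ s * (t - s) ^ 2| ≤ |B2| * R ^ 2 := by
        rw [abs_mul, abs_mul, abs_pow]
        gcongr
        rw [abs_of_pos (by norm_num : (0 : ℝ) < 1 / 2)]
        linarith [abs_nonneg (dTheta2 J γ s)]
      have g1 := abs_sub (γ (Circle.exp t)) (γ (Circle.exp s))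
      have g2 := abs_sub (γ (Circle.exp t) - γ (Circle.exp s)) (dTheta J γ s * (t - s))
      have g3 := abs_sub (γ (Circle.exp t) - γ (Circle.exp s) - dTheta J γ s * (t - s))
        (1 / 2 * dTheta2 J γ s * (t - s) ^ 2)
      linarith
    have h2 : 1 ≤ δ ^ (-p) * |t - s| ^ p := by
      rw [Real.rpow_neg hδ.le, inv_mul_eq_div, one_le_div (by positivity)]
      exact Real.rpow_le_rpow hδ.le hge hp
    have h3 : 0 ≤ B := (abs_nonneg _).trans h1
    have h4 : 0 ≤ η * |t - s| ^ 2 := by positivity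
    nlinarith [mul_le_mul_of_nonneg_left h2 h3]

theorem cube_le {η : ℝ} (hη : 0 < η) (hp : 3 ≤ p) :
    ∃ C : ℝ, 0 ≤ C ∧ ∀ t : ℝ, |t| ^ 3 ≤ η * |t| ^ 2 + C * |t| ^ p := by
  refine ⟨η ^ (3 - p), by positivity, fun t => ?_⟩
  rcases le_total |t| η with h | h
  · have : 0 ≤ η ^ (3 - p) * |t| ^ p := by positivity
    nlinarith [mul_le_mul_of_nonneg_right h (sq_nonneg |t|)]
  · have ht : 0 < |t| := hη.trans_le h
    have h1 : |t| ^ 3 = |t| ^ (3 - p) * |t| ^ p := by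
      rw [← Real.rpow_add ht, sub_add_cancel]; norm_cast
    have h2 : |t| ^ (3 - p) ≤ η ^ (3 - p) := Real.rpow_le_rpow_of_nonpos hη h (by linarith)
    have h3 := mul_le_mul_of_nonneg_right h2 (Real.rpow_nonneg ht.le p)
    have h4 : 0 ≤ η * |t| ^ 2 := by positivity
    linarith

theorem norm_exp_sub_exp (s t : ℝ) :
    ‖(Circle.exp s : ℂ) - Circle.exp t‖ = 2 * |Real.sin ((s - t) / 2)| := by
  have h : (Circle.exp s : ℂ) - Circle.exp t =
      Circle.exp t * (Complex.exp (Complex.I * ((s - t : ℝ) : ℂ)) - 1) := by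
    rw [mul_sub, mul_one, Circle.coe_exp, Circle.coe_exp, ← Complex.exp_add]
    congr 2
    push_cast
    ring
  rw [h, norm_mul, Circle.norm_coe, one_mul, Complex.norm_exp_I_mul_ofReal_sub_one]
  simp

/-- The angle is controlled by the chord, away from a full turn. -/
theorem exists_abs_sub_le_norm_exp_sub {R : ℝ} (hR : R < 2 * Real.pi) :
    ∃ C : ℝ, 0 ≤ C ∧ ∀ s t : ℝ, |s - t| ≤ R →
      |s - t| ≤ C * ‖(Circle.exp s : ℂ) - Circle.exp t‖ := by
  have hpi := Real.pi_pos
  set Y := (max R 0 + 2 * Real.pi) / 4 with hY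
  have hR0 : max R 0 < 2 * Real.pi := max_lt hR (by positivity)
  have hR1 : 0 ≤ max R 0 := le_max_right _ _
  have hY0 : 0 < Y := by positivity
  have hYpi : Y < Real.pi := by rw [hY]; linarith
  have hsin : 0 < Real.sin Y := Real.sin_pos_of_pos_of_lt_pi hY0 hYpi
  refine ⟨Y / Real.sin Y, by positivity, fun s t hst => ?_⟩
  rw [norm_exp_sub_exp]
  set y := |(s - t) / 2| with hy
  have hy0 : 0 ≤ y := abs_nonneg _
  have hsy : |s - t| = 2 * y := by rw [hy, abs_div]; norm_num; ring
  have hyY : y ≤ Y := by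
    have := le_max_left R 0
    rw [hY]; linarith
  have habs : |Real.sin ((s - t) / 2)| = Real.sin y := by
    rw [Real.abs_sin_eq_sin_abs_of_abs_le_pi]
    linarith
  -- the graph of the sine lies above its chord on `[0, Y]`
  have hconc := strictConcaveOn_sin_Icc.concaveOn.2
    (show (0 : ℝ) ∈ Set.Icc 0 Real.pi from ⟨le_rfl, hpi.le⟩)
    (show Y ∈ Set.Icc 0 Real.pi from ⟨hY0.le, hYpi.le⟩)
    (show 0 ≤ 1 - y / Y by rw [sub_nonneg, div_le_one hY0]; exact hyY)
    (show 0 ≤ y / Y by positivity) (by ring)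
  simp only [smul_eq_mul, Real.sin_zero, mul_zero, zero_add, div_mul_cancel₀ _ hY0.ne'] at hconc
  rw [habs, hsy, div_mul_eq_mul_div, le_div_iff₀ hsin]
  rw [div_mul_eq_mul_div, div_le_iff₀ hY0] at hconc
  linarith

end Taylor

/-! ### Averages of second order expansions -/

section Averaging

variable {m : Plane → Circle} {p : ℝ}

theorem abs_integral_kernel_smul_le (hm : StronglyMeasurable m) (hp : 1 ≤ p) {ε C₀ η C : ℝ}
    (hC₀ : 0 ≤ C₀) {x : Plane} {δ G : Plane → ℝ} (hδ : Measurable δ)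
    (h : ∀ y, |δ y| ≤ C₀ * (incr m ε x y + osc m ε 1 x)) (hη : 0 ≤ η) (hC : 0 ≤ C)
    (hG : ∀ y, |G y| ≤ η * |δ y| ^ 2 + C * |δ y| ^ p) :
    |∫ y, kernel y • G y| ≤ kernelConst * (2 * (2 * C₀) ^ 2) * η * osc m ε 2 x +
      kernelConst * (2 * (2 * C₀) ^ p) * C * osc m ε p x := by
  obtain ⟨hi2, h2⟩ := average_rpow_le hm one_le_two hC₀ hδ h
  obtain ⟨hip, hpp⟩ := average_rpow_le hm hp hC₀ hδ h
  simp only [Real.rpow_two] at hi2 h2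
  have hi : IntegrableOn (fun y => η * |δ y| ^ 2 + C * |δ y| ^ p) (ball 0 1) :=
    (hi2.const_mul η).add (hip.const_mul C)
  have h0 := norm_integral_kernel_smul_le (g := G) hi (fun y _ => hG y)
  rw [average_add (hi2.const_mul η) (hip.const_mul C), average_const_mul,
    average_const_mul] at h0
  refine h0.trans ?_
  have hK := kernelConst_pos
  calc _ ≤ kernelConst * (η * (2 * (2 * C₀) ^ 2 * osc m ε 2 x) +
        C * (2 * (2 * C₀) ^ p * osc m ε p x)) := by gcongr
    _ = _ := by ring

theorem integral_kernel_smul_taylor {g σ : Plane → ℝ} {M R a b c : ℝ}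
    (hg : AEStronglyMeasurable g) (hM : ∀ y, ‖g y‖ ≤ M) (hσ : AEStronglyMeasurable σ)
    (hR : ∀ y, ‖σ y‖ ≤ R) (h0 : ∫ y, kernel y • σ y = 0) :
    (∫ y, kernel y • g y) - a - 1 / 2 * c * ∫ y, kernel y • σ y ^ 2 =
      ∫ y, kernel y • (g y - a - b * σ y - 1 / 2 * c * σ y ^ 2) := by
  have i1 := integrable_kernel_smul hg hM
  have i2 := integrable_kernel_smul hσ hR
  have i3 : Integrable fun y => kernel y • σ y ^ 2 :=
    integrable_kernel_smul (M := R ^ 2) (hσ.pow 2) fun y => by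
      rw [norm_pow]; exact pow_le_pow_left₀ (norm_nonneg _) (hR y) 2
  have i4 : Integrable fun y => kernel y • a := integrable_kernel.smul_const a
  have heq : ∀ y, kernel y • (g y - a - b * σ y - 1 / 2 * c * σ y ^ 2) =
      kernel y • g y - kernel y • a - b * (kernel y • σ y) -
        1 / 2 * c * (kernel y • σ y ^ 2) := fun y => by
    simp only [smul_eq_mul]; ring
  simp only [heq]
  have i5 : Integrable fun y => kernel y • g y - kernel y • a := i1.sub i4
  have i6 : Integrable fun y => kernel y • g y - kernel y • a - b * (kernel y • σ y) :=
    i5.sub (i2.const_mul b)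
  rw [integral_sub i6 (i3.const_mul _), integral_sub i5 (i2.const_mul b), integral_sub i1 i4,
    integral_const_mul, integral_const_mul, h0, integral_smul_const, integral_kernel]
  simp

end Averaging

/-! ### Approximation of a map into an arc by smooth maps -/

/-- Smooth approximations of a map `m` into `J` by maps `x ↦ exp(iϑ)` into `J`, at every scale
`ε > 0`, away from an exceptional set where the cut-off `χ` is not `1`. The angle `ϑ` itself may
jump; the form `L` is `χ dϑ`, and `V` is the local variance of the angle of `m`. All bounds are in
terms of the mean oscillations of `m`; the exponent `p` is the one of the Besov bound, so that
`ε⁻¹ osc m ε p` is negligible. The last field expands the mollification of `γ(m)` to second order: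
there is no term of first order, since `ϑ` is chosen as a mean value. -/
structure AngularApprox (J : Set Circle) (m : Plane → Circle) (p : ℝ) where
  /-- the cut-off -/
  χ : ℝ → Plane → ℝ
  /-- the derivative of the cut-off -/
  dχ : ℝ → Plane → Plane →L[ℝ] ℝ
  /-- the approximate angle -/
  ϑ : ℝ → Plane → ℝ
  /-- the differential of the approximate angle, times the cut-off -/
  L : ℝ → Plane → Plane →L[ℝ] ℝ
  /-- the local variance of the angle -/
  V : ℝ → Plane → ℝ
  /-- a constant for all bounds -/
  C : ℝ
  C_nonneg : 0 ≤ C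
  measurable_ϑ : ∀ ε, 0 < ε → Measurable (ϑ ε)
  measurable_L : ∀ ε, 0 < ε → ∀ v, Measurable fun x => L ε x v
  measurable_V : ∀ ε, 0 < ε → Measurable (V ε)
  mem_angles : ∀ ε x, ϑ ε x ∈ angles J
  χ_nonneg : ∀ ε x, 0 ≤ χ ε x
  χ_le_one : ∀ ε x, χ ε x ≤ 1
  hasFDerivAt_mul : ∀ ε, 0 < ε → ∀ f : Circle → ℝ, IsCkOn 1 J f → ∀ x,
    HasFDerivAt (fun x => χ ε x * f (Circle.exp (ϑ ε x)))
      (f (Circle.exp (ϑ ε x)) • dχ ε x + dTheta J f (ϑ ε x) • L ε x) x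
  norm_L_le : ∀ ε, 0 < ε → ∀ x, ‖L ε x‖ ≤ C * (ε⁻¹ * osc m ε 1 x)
  norm_dχ_le : ∀ ε, 0 < ε → ∀ x, ‖dχ ε x‖ ≤ C * (ε⁻¹ * osc m ε p x)
  one_sub_χ_le : ∀ ε, 0 < ε → ∀ x, 1 - χ ε x ≤ C * osc m ε p x
  abs_V_le : ∀ ε, 0 < ε → ∀ x, |V ε x| ≤ C * osc m ε 2 x
  norm_exp_sub_le : ∀ ε, 0 < ε → ∀ x, ‖(Circle.exp (ϑ ε x) : ℂ) - m x‖ ≤ C * osc m ε 1 x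
  taylor : ∀ γ : Circle → ℝ, IsCkOn 2 J γ → ∀ η, 0 < η → ∃ C' : ℝ, 0 ≤ C' ∧
    ∀ ε, 0 < ε → ∀ x, |mollify ε (fun y => γ (m y)) x - γ (Circle.exp (ϑ ε x)) -
      1 / 2 * dTheta2 J γ (ϑ ε x) * V ε x| ≤ η * osc m ε 2 x + C' * osc m ε p x

/-! ### Approximation of maps into a proper arc -/

section Arc

variable {J : Set Circle} {m : Plane → Circle} {p : ℝ}

theorem norm_exp_sub_exp_le (s t : ℝ) : ‖(Circle.exp s : ℂ) - Circle.exp t‖ ≤ |s - t| := by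
  rw [norm_exp_sub_exp]
  have := Real.abs_sin_le_abs (x := (s - t) / 2)
  rw [abs_div, abs_of_pos (two_pos : (0 : ℝ) < 2)] at this
  linarith

theorem mollify_mem_Icc {u : Plane → ℝ} (hu : Measurable u) {c d : ℝ}
    (hcd : ∀ x, u x ∈ Set.Icc c d) (ε : ℝ) (x : Plane) : mollify ε u x ∈ Set.Icc c d := by
  have hM : ∀ y, ‖u y‖ ≤ max |c| |d| := fun y => abs_le_max_abs_abs (hcd y).1 (hcd y).2
  constructor
  · have h := mollify_sub_const hu.stronglyMeasurable hM ε x c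
    have : 0 ≤ ∫ y, kernel y • (u (x - ε • y) - c) := integral_nonneg fun y =>
      smul_nonneg (kernel_nonneg y) (sub_nonneg.2 (hcd _).1)
    linarith
  · have h := mollify_sub_const hu.stronglyMeasurable hM ε x d
    have : ∫ y, kernel y • (u (x - ε • y) - d) ≤ 0 := integral_nonpos fun y =>
      smul_nonpos_of_nonneg_of_nonpos (kernel_nonneg y) (sub_nonpos.2 (hcd _).2)
    linarith

/-- If `m` has a measurable bounded lift `u`, as regular as `m`, then the mollification of `u` is an
approximate angle; no cut-off is needed since it stays in the convex hull of the values of `u`. -/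
theorem nonempty_angularApprox_of_lift (hu : UniqueDiffOn ℝ (angles J)) (hJ : IsCompact J)
    (hm : StronglyMeasurable m) (hmJ : ∀ x, m x ∈ J) (hp : 1 ≤ p) {u : Plane → ℝ}
    (hum : Measurable u) {c d : ℝ}
    (hcd : Set.Icc c d ⊆ angles J) (huc : ∀ x, u x ∈ Set.Icc c d)
    (hexp : ∀ x, Circle.exp (u x) = m x) {A : ℝ} (hA : 0 ≤ A)
    (huA : ∀ x y, |u y - u x| ≤ A * ‖(m y : ℂ) - m x‖) :
    Nonempty (AngularApprox J m p) := by
  have hM : ∀ y, ‖u y‖ ≤ max |c| |d| := fun y => abs_le_max_abs_abs (huc y).1 (huc y).2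
  have hK := kernelConst_pos
  set K := kernelConst with hKdef
  have hmem : ∀ ε x, mollify ε u x ∈ Set.Icc c d := mollify_mem_Icc hum huc
  have hclose : ∀ ε x, |mollify ε u x - u x| ≤ K * A * osc m ε 1 x := fun ε x =>
    norm_mollify_sub_le hm hum.stronglyMeasurable hM huA ε x
  set C₀ := A * (1 + K) with hC₀
  have hC₀0 : 0 ≤ C₀ := by positivity
  have hδm : ∀ ε x, Measurable fun y => u (x - ε • y) - mollify ε u x := fun ε x =>
    (hum.comp (by fun_prop)).sub_const _
  have hδ : ∀ ε x y, |u (x - ε • y) - mollify ε u x| ≤ C₀ * (incr m ε x y + osc m ε 1 x) :=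
    fun ε x y => by
    have h1 := huA x (x - ε • y)
    have h2 := hclose ε x
    have h3 := abs_sub_le (u (x - ε • y)) (u x) (mollify ε u x)
    rw [abs_sub_comm (u x)] at h3
    have h4 := incr_nonneg (m := m) ε x y
    have h5 := osc_nonneg (m := m) ε 1 x
    change _ ≤ A * incr m ε x y at h1
    have h6 : 0 ≤ A * K * incr m ε x y := by positivity
    have h7 : 0 ≤ A * osc m ε 1 x := by positivity
    rw [hC₀]
    linarith
  have hcont : ∀ ε, 0 < ε → ContDiff ℝ 1 (mollify ε u) := fun ε hε =>
    contDiff_mollify hε hum.stronglyMeasurable hM (n := 1)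
  have hR : ∀ ε x y, ‖u (x - ε • y) - mollify ε u x‖ ≤ |d - c| := fun ε x y => by
    rw [Real.norm_eq_abs, abs_le]
    have := le_abs_self (d - c)
    constructor <;> linarith [(huc (x - ε • y)).1, (huc (x - ε • y)).2, (hmem ε x).1,
      (hmem ε x).2]
  refine ⟨{
    χ := fun _ _ => 1
    dχ := fun _ _ => 0
    ϑ := fun ε => mollify ε u
    L := fun ε => fderiv ℝ (mollify ε u)
    V := fun ε x => ∫ y, kernel y • (u (x - ε • y) - mollify ε u x) ^ 2
    C := K * A + K * (2 * (2 * C₀) ^ 2)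
    C_nonneg := by positivity
    measurable_ϑ := fun ε hε => (hcont ε hε).continuous.measurable
    measurable_L := fun ε hε v => measurable_fderiv_apply_const ℝ _ v
    measurable_V := fun ε hε => ?_
    mem_angles := fun ε x => hcd (hmem ε x)
    χ_nonneg := fun _ _ => zero_le_one
    χ_le_one := fun _ _ => le_rfl
    hasFDerivAt_mul := fun ε hε f hf x => ?_
    norm_L_le := fun ε hε x => ?_
    norm_dχ_le := fun ε hε x => ?_
    one_sub_χ_le := fun ε hε x => ?_
    abs_V_le := fun ε hε x => ?_
    norm_exp_sub_le := fun ε hε x => ?_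
    taylor := fun γ hγ η hη => ?_ }⟩
  · have h1 : Measurable fun q : Plane × Plane =>
        kernel q.2 • (u (q.1 - ε • q.2) - mollify ε u q.1) ^ 2 := by
      refine (continuous_kernel.measurable.comp measurable_snd).smul (Measurable.pow_const ?_ 2)
      exact (hum.comp (by fun_prop)).sub
        ((hcont ε hε).continuous.measurable.comp measurable_fst)
    exact (h1.stronglyMeasurable.integral_prod_right' (ν := volume)).measurable
  · have h1 := hf.hasDerivWithinAt one_ne_zero (hcd (hmem ε x))
    have h2 : HasFDerivAt (mollify ε u) (fderiv ℝ (mollify ε u) x) x :=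
      ((hcont ε hε).differentiable (by norm_num) x).hasFDerivAt
    have h3 := h1.comp_hasFDerivAt x h2 (Eventually.of_forall fun y => hcd (hmem ε y))
    simpa using! h3
  · have h := norm_fderiv_mollify_le hm hum.stronglyMeasurable hM hA huA hε x
    refine h.trans ?_
    rw [div_mul_eq_mul_div, div_eq_mul_inv, mul_assoc, mul_comm (osc m ε 1 x)]
    refine mul_le_mul_of_nonneg_right ?_ (mul_nonneg (by positivity) (osc_nonneg _ _ _))
    exact le_add_of_nonneg_right (by positivity)
  · rw [norm_zero]
    exact mul_nonneg (by positivity) (mul_nonneg (by positivity) (osc_nonneg _ _ _))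
  · rw [sub_self]
    exact mul_nonneg (by positivity) (osc_nonneg _ _ _)
  · have h := abs_integral_kernel_smul_le hm le_rfl hC₀0 (hδm ε x) (hδ ε x) zero_le_one
      le_rfl (G := fun y => (u (x - ε • y) - mollify ε u x) ^ 2) (fun y => by simp)
    refine h.trans ?_
    have := osc_nonneg (m := m) ε 2 x
    have h' : 0 ≤ K * A * osc m ε 2 x := by positivity
    simp only [mul_zero, zero_mul, add_zero, mul_one]
    linarith
  · rw [← hexp]
    refine (norm_exp_sub_exp_le _ _).trans ((hclose ε x).trans ?_)
    refine mul_le_mul_of_nonneg_right ?_ (osc_nonneg _ _ _)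
    exact le_add_of_nonneg_right (by positivity)
  · obtain ⟨Bγ, hBγ⟩ := hJ.exists_bound_of_continuousOn hγ.continuousOn
    set D₂ := K * (2 * (2 * C₀) ^ 2) with hD₂
    set Dp := K * (2 * (2 * C₀) ^ p) with hDp
    have hD₂0 : 0 ≤ D₂ := by positivity
    obtain ⟨C', hC', hT⟩ := taylor_angle hu hcd hγ (by linarith : 0 ≤ p)
      (show 0 < η / (D₂ + 1) by positivity)
    refine ⟨Dp * C', by positivity, fun ε hε x => ?_⟩
    have h0 : ∫ y, kernel y • (u (x - ε • y) - mollify ε u x) = 0 := by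
      rw [← mollify_sub_const hum.stronglyMeasurable hM, sub_self]
    have hg : StronglyMeasurable fun y => γ (m (x - ε • y)) :=
      stronglyMeasurable_comp_sub_smul
        (stronglyMeasurable_comp_circle hm hmJ hγ.continuousOn) ε x
    have h1 := integral_kernel_smul_taylor (a := γ (Circle.exp (mollify ε u x)))
      (b := dTheta J γ (mollify ε u x)) (c := dTheta2 J γ (mollify ε u x))
      hg.aestronglyMeasurable (fun y => hBγ _ (hmJ _))
      (hδm ε x).aestronglyMeasurable (hR ε x) h0
    unfold mollify at h1 ⊢
    rw [h1]
    have h2 := abs_integral_kernel_smul_le hm hp hC₀0 (hδm ε x) (hδ ε x)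
      (show 0 ≤ η / (D₂ + 1) by positivity) hC' (G := _)
      (fun y => by
        have := hT _ (hmem ε x) _ (huc (x - ε • y))
        rw [hexp] at this
        exact this)
    refine h2.trans ?_
    have h3 : D₂ * (η / (D₂ + 1)) ≤ η := by
      rw [mul_div_assoc', div_le_iff₀ (by positivity)]
      nlinarith
    exact add_le_add (mul_le_mul_of_nonneg_right h3 (osc_nonneg _ _ _)) le_rfl

/-- A proper arc of the circle has a bi-Lipschitz continuous determination of the angle. -/
theorem nonempty_angularApprox_of_ne_univ (hu : UniqueDiffOn ℝ (angles J)) (hJ : IsCompact J)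
    (hJc : IsConnected J) (hJu : J ≠ Set.univ) (hm : StronglyMeasurable m) (hmJ : ∀ x, m x ∈ J)
    (hp : 1 ≤ p) : Nonempty (AngularApprox J m p) := by
  obtain ⟨z₀, hz₀⟩ := (Set.ne_univ_iff_exists_notMem J).1 hJu
  -- the determination of the angle with its jump at `z₀`
  set a := Complex.arg z₀ + Real.pi with ha
  set T : Circle → ℝ := fun z => Complex.arg (z / Circle.exp a : Circle) + a with hT
  have hexp : ∀ z, Circle.exp (T z) = z := fun z => by
    rw [hT]
    simp only
    rw [Circle.exp_add, Circle.exp_arg, div_mul_cancel]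
  have hTc : ContinuousOn T J := by
    intro z hz
    refine (ContinuousAt.add ?_ continuousAt_const).continuousWithinAt
    have hc : Continuous fun z : Circle => ((z / Circle.exp a : Circle) : ℂ) := by fun_prop
    refine ContinuousAt.comp (g := Complex.arg)
      (f := fun z : Circle => ((z / Circle.exp a : Circle) : ℂ))
      (Complex.continuousAt_arg ?_) hc.continuousAt
    rw [Complex.mem_slitPlane_iff_arg]
    refine ⟨fun h => hz₀ ?_, Circle.coe_ne_zero _⟩
    have h1 : Circle.exp (Real.pi + a) = z := by
      rw [← h]
      exact hexp z
    rw [show Real.pi + a = Complex.arg z₀ + 2 * Real.pi by rw [ha]; ring,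
      Circle.periodic_exp, Circle.exp_arg] at h1
    rwa [h1]
  have hcompact := hJ.image_of_continuousOn hTc
  have himg := eq_Icc_of_connected_compact (hJc.image T hTc) hcompact
  set c := sInf (T '' J)
  set d := sSup (T '' J)
  have hTmem : ∀ z ∈ J, T z ∈ Set.Icc c d := fun z hz => himg ▸ Set.mem_image_of_mem T hz
  have hcd : Set.Icc c d ⊆ angles J := by
    rw [← himg]
    rintro _ ⟨z, hz, rfl⟩
    change Circle.exp _ ∈ J
    rwa [hexp]
  obtain ⟨z₁, hz₁⟩ := hJc.nonempty
  have hle : c ≤ d := (hTmem z₁ hz₁).1.trans (hTmem z₁ hz₁).2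
  have hR : d - c < 2 * Real.pi := by
    obtain ⟨zc, hzc, hc⟩ : c ∈ T '' J := himg ▸ Set.left_mem_Icc.2 hle
    obtain ⟨zd, hzd, hd⟩ : d ∈ T '' J := himg ▸ Set.right_mem_Icc.2 hle
    rw [← hc, ← hd, hT]
    have h1 := Complex.neg_pi_lt_arg (zc / Circle.exp a : Circle)
    have h2 := Complex.arg_le_pi (zd / Circle.exp a : Circle)
    simp only
    linarith
  obtain ⟨A, hA, hAle⟩ := exists_abs_sub_le_norm_exp_sub hR
  refine nonempty_angularApprox_of_lift hu hJ hm hmJ hp (u := fun x => T (m x)) ?_ hcd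
    (fun x => hTmem _ (hmJ x)) (fun x => hexp _) hA fun x y => ?_
  · have h1 : Measurable fun x => (m x : ℂ) :=
      (continuous_subtype_val.comp_stronglyMeasurable hm).measurable
    have h2 : Measurable fun x => ((m x / Circle.exp a : Circle) : ℂ) := by
      simp only [Circle.coe_div]
      exact h1.div_const _
    exact (Complex.measurable_arg.comp h2).add_const _
  · have := hAle (T (m y)) (T (m x)) ?_
    · rwa [hexp, hexp] at this
    · have h1 := hTmem _ (hmJ x)
      have h2 := hTmem _ (hmJ y)
      rw [abs_le]
      constructor <;> linarith [h1.1, h1.2, h2.1, h2.2]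

end Arc

/-! ### Approximation of maps into the full circle -/

section FullCircle

variable {m : Plane → Circle} {p : ℝ}

theorem norm_mul_exp_arg (z : ℂ) : (‖z‖ : ℂ) * Circle.exp (Complex.arg z) = z := by
  rw [Circle.coe_exp]
  exact Complex.norm_mul_exp_arg_mul_I z

theorem exp_arg_div_add {w z : ℂ} (hw : w ≠ 0) (hz : z ≠ 0) :
    Circle.exp (Complex.arg (w / z) + Complex.arg z) = Circle.exp (Complex.arg w) := by
  apply Subtype.ext
  have h1 : ((‖w‖ : ℝ) : ℂ) ≠ 0 := by simpa using hw
  apply mul_left_cancel₀ h1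
  have h2 := norm_mul_exp_arg (w / z)
  have h3 := norm_mul_exp_arg z
  have h4 : ((‖w‖ : ℝ) : ℂ) = (‖w / z‖ : ℂ) * (‖z‖ : ℂ) := by
    rw [norm_div]
    have : ((‖z‖ : ℝ) : ℂ) ≠ 0 := by simpa using hz
    push_cast
    field_simp
  change _ * ((Circle.exp _ : Circle) : ℂ) = _ * ((Circle.exp _ : Circle) : ℂ)
  rw [norm_mul_exp_arg w, Circle.exp_add, Circle.coe_mul, h4]
  calc _ = ((‖w / z‖ : ℂ) * Circle.exp (Complex.arg (w / z))) *
        ((‖z‖ : ℂ) * Circle.exp (Complex.arg z)) := by ring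
    _ = w := by rw [h2, h3]; field_simp

theorem hasFDerivAt_comp_exp_arg {Z : Plane → ℂ} {Z' : Plane →L[ℝ] ℂ} {x : Plane}
    (hZ : HasFDerivAt Z Z' x) (h0 : Z x ≠ 0) {f : Circle → ℝ} {D : ℝ}
    (hf : HasDerivAt (fun t => f (Circle.exp t)) D (Complex.arg (Z x))) :
    HasFDerivAt (fun x' => f (Circle.exp (Complex.arg (Z x'))))
      (D • Complex.imCLM.comp ((Z x)⁻¹ • Z')) x := by
  -- near `x` the angle may be replaced by a smooth determination
  set h : Plane → ℝ := fun x' => Complex.arg ((Z x)⁻¹ • Z x') + Complex.arg (Z x) with hh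
  have hx1 : (Z x)⁻¹ • Z x = 1 := by simp [h0]
  have hlog : HasDerivAt Complex.log 1 ((Z x)⁻¹ • Z x) := by
    rw [hx1]
    simpa using (Complex.hasStrictDerivAt_log (x := 1) (by simp)).hasDerivAt
  have h1 := hlog.comp_hasFDerivAt x (hZ.const_smul ((Z x)⁻¹))
  have h2 : HasFDerivAt h (Complex.imCLM.comp ((Z x)⁻¹ • Z')) x := by
    have h3 := (Complex.imCLM.hasFDerivAt.comp x h1).add_const (Complex.arg (Z x))
    rw [one_smul] at h3
    exact h3.congr_of_eventuallyEq (Eventually.of_forall fun x' => by simp [hh, Complex.log_im])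
  have hhx : h x = Complex.arg (Z x) := by rw [hh]; simp only [hx1]; simp
  rw [← hhx] at hf
  have h4 := hf.comp_hasFDerivAt x h2
  refine h4.congr_of_eventuallyEq ?_
  filter_upwards [hZ.continuousAt.eventually_ne h0] with x' hx'
  change f _ = f (Circle.exp (Complex.arg ((Z x)⁻¹ • Z x') + Complex.arg (Z x)))
  rw [smul_eq_mul, inv_mul_eq_div, exp_arg_div_add hx' h0]

/-- Second order Taylor expansion on the circle with `sin t` in place of the angle `t`; unlike the
angle, `sin t` is the restriction of a linear form to the circle. -/
theorem taylor_sine {γ : Circle → ℝ} (hγ : IsCkOn 2 Set.univ γ) (hp : 3 ≤ p) {η : ℝ}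
    (hη : 0 < η) :
    ∃ C : ℝ, 0 ≤ C ∧ ∀ s t : ℝ, |s| ≤ Real.pi → |t| ≤ Real.pi →
      |γ (Circle.exp (s + t)) - γ (Circle.exp s) - dTheta Set.univ γ s * Real.sin t -
        1 / 2 * dTheta2 Set.univ γ s * Real.sin t ^ 2| ≤ η * |t| ^ 2 + C * |t| ^ p := by
  have huniv : angles Set.univ = Set.univ := by ext; simp [angles]
  have hu : UniqueDiffOn ℝ (angles Set.univ) := by rw [huniv]; exact uniqueDiffOn_univ
  have hsub : Set.Icc (-(2 * Real.pi)) (2 * Real.pi) ⊆ angles Set.univ := by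
    rw [huniv]; exact Set.subset_univ _
  obtain ⟨B₁, hB₁⟩ := isCompact_Icc.exists_bound_of_continuousOn
    (((hγ.of_le (by norm_num)).continuousOn_dTheta hu).mono hsub)
  obtain ⟨B₂, hB₂⟩ := isCompact_Icc.exists_bound_of_continuousOn
    ((hγ.continuousOn_dTheta2 hu).mono hsub)
  obtain ⟨C', hC', hT⟩ := taylor_angle hu hsub hγ (by linarith : 0 ≤ p)
    (show 0 < η / 2 by positivity)
  have hpi := Real.pi_pos
  set W := |B₁| + |B₂| * Real.pi with hW
  have hW0 : 0 ≤ W := by positivity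
  obtain ⟨C₃, hC₃, h3⟩ := cube_le (p := p) (show 0 < η / 2 / (W + 1) by positivity) hp
  refine ⟨C' + W * C₃, by positivity, fun s t hs ht => ?_⟩
  have hs' := abs_le.1 hs
  have ht' := abs_le.1 ht
  have hsI : s ∈ Set.Icc (-(2 * Real.pi)) (2 * Real.pi) := by
    constructor <;> linarith
  have hT' := hT s hsI (s + t) (by constructor <;> linarith)
  rw [add_sub_cancel_left] at hT'
  have h3' := h3 t
  have e1 := (hB₁ _ hsI).trans (le_abs_self B₁)
  have e2 := (hB₂ _ hsI).trans (le_abs_self B₂)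
  rw [Real.norm_eq_abs] at e1 e2
  set γ₁ := dTheta Set.univ γ s
  set γ₂ := dTheta2 Set.univ γ s
  have s1 : |t - Real.sin t| ≤ |t| ^ 3 :=
    (Real.abs_sub_sin_le t).trans (by have := pow_nonneg (abs_nonneg t) 3; linarith)
  have s2 : |t + Real.sin t| ≤ 2 * Real.pi := by
    have := abs_add_le t (Real.sin t)
    have := Real.abs_sin_le_abs (x := t)
    linarith
  have hdiff : |γ₁ * (t - Real.sin t) + 1 / 2 * γ₂ * ((t - Real.sin t) * (t + Real.sin t))| ≤
      W * |t| ^ 3 := by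
    refine (abs_add_le _ _).trans ?_
    rw [abs_mul, abs_mul, abs_mul, abs_mul, abs_of_pos (by norm_num : (0 : ℝ) < 1 / 2), hW,
      add_mul]
    refine add_le_add (mul_le_mul e1 s1 (abs_nonneg _) (abs_nonneg _)) ?_
    calc 1 / 2 * |γ₂| * (|t - Real.sin t| * |t + Real.sin t|)
        ≤ 1 / 2 * |B₂| * (|t| ^ 3 * (2 * Real.pi)) := by gcongr
      _ = _ := by ring
  have hWc : W * |t| ^ 3 ≤ η / 2 * |t| ^ 2 + W * C₃ * |t| ^ p := by
    have hW1 : W * (η / 2 / (W + 1)) ≤ η / 2 := by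
      rw [mul_div_assoc', div_le_iff₀ (by positivity)]
      nlinarith
    calc W * |t| ^ 3 ≤ W * (η / 2 / (W + 1) * |t| ^ 2 + C₃ * |t| ^ p) := by gcongr
      _ = W * (η / 2 / (W + 1)) * |t| ^ 2 + W * C₃ * |t| ^ p := by ring
      _ ≤ _ := by gcongr
  have heq : γ (Circle.exp (s + t)) - γ (Circle.exp s) - γ₁ * Real.sin t -
      1 / 2 * γ₂ * Real.sin t ^ 2 =
      (γ (Circle.exp (s + t)) - γ (Circle.exp s) - γ₁ * t - 1 / 2 * γ₂ * t ^ 2) +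
      (γ₁ * (t - Real.sin t) + 1 / 2 * γ₂ * ((t - Real.sin t) * (t + Real.sin t))) := by
    ring
  rw [heq]
  refine (abs_add_le _ _).trans ((add_le_add hT' (hdiff.trans hWc)).trans_eq ?_)
  ring

/-- The cut-off away from the centre of the disc. -/
noncomputable def radialCutoff (z : ℂ) : ℝ := Real.smoothTransition (4 * ‖z‖ ^ 2 - 1)

theorem contDiff_radialCutoff : ContDiff ℝ 1 radialCutoff := by
  have h : ContDiff ℝ 1 fun z : ℂ => 4 * ‖z‖ ^ 2 - 1 :=
    (contDiff_const.mul (contDiff_norm_sq ℝ)).sub contDiff_const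
  exact (Real.smoothTransition.contDiff (n := 1)).comp h

theorem radialCutoff_nonneg (z : ℂ) : 0 ≤ radialCutoff z := Real.smoothTransition.nonneg _

theorem radialCutoff_le_one (z : ℂ) : radialCutoff z ≤ 1 := Real.smoothTransition.le_one _

theorem radialCutoff_eq_one {z : ℂ} (hz : 3 / 4 ≤ ‖z‖) : radialCutoff z = 1 :=
  Real.smoothTransition.one_of_one_le (by nlinarith)

theorem radialCutoff_eq_zero {z : ℂ} (hz : ‖z‖ ≤ 1 / 2) : radialCutoff z = 0 :=
  Real.smoothTransition.zero_of_nonpos (by nlinarith [norm_nonneg z])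

/-- If `m` takes values in the whole circle, its mollification takes values in the disc, and the
angle of the mollification is used where it is at distance at least `1/2` from the centre. -/
theorem nonempty_angularApprox_univ (hm : StronglyMeasurable m) (hp : 3 ≤ p) :
    Nonempty (AngularApprox Set.univ m p) := by
  have huniv : angles Set.univ = Set.univ := by ext; simp [angles]
  have hu : UniqueDiffOn ℝ (angles Set.univ) := by rw [huniv]; exact uniqueDiffOn_univ
  have hmC : StronglyMeasurable fun x => (m x : ℂ) :=
    continuous_subtype_val.comp_stronglyMeasurable hm
  have hM : ∀ y, ‖(m y : ℂ)‖ ≤ 1 := fun y => (Circle.norm_coe _).le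
  have hLip : ∀ x y, ‖(m y : ℂ) - m x‖ ≤ 1 * ‖(m y : ℂ) - m x‖ := fun x y => (one_mul _).ge
  have hK := kernelConst_pos
  set K := kernelConst with hKdef
  set Z : ℝ → Plane → ℂ := fun ε => mollify ε fun x => (m x : ℂ) with hZ
  have hZc : ∀ ε, 0 < ε → ContDiff ℝ 1 (Z ε) := fun ε hε => contDiff_mollify hε hmC hM (n := 1)
  have hZd : ∀ ε, 0 < ε → ∀ x, HasFDerivAt (Z ε) (fderiv ℝ (Z ε) x) x := fun ε hε x =>
    ((hZc ε hε).differentiable (by norm_num) x).hasFDerivAt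
  have hclose : ∀ ε x, ‖Z ε x - m x‖ ≤ K * osc m ε 1 x := fun ε x => by
    simpa using norm_mollify_sub_le hm hmC hM hLip ε x
  have hZ1 : ∀ ε x, |1 - ‖Z ε x‖| ≤ K * osc m ε 1 x := fun ε x => by
    have := abs_norm_sub_norm_le (m x : ℂ) (Z ε x)
    rw [Circle.norm_coe, norm_sub_rev] at this
    exact this.trans (hclose ε x)
  have hDZ : ∀ ε, 0 < ε → ∀ x, ‖fderiv ℝ (Z ε) x‖ ≤ K * (ε⁻¹ * osc m ε 1 x) := fun ε hε x => by
    refine (norm_fderiv_mollify_le hm hmC hM zero_le_one hLip hε x).trans_eq ?_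
    rw [mul_one, div_eq_mul_inv, mul_assoc]
  have hZle : ∀ ε x, ‖Z ε x‖ ≤ 1 + 2 * K := fun ε x => by
    have h1 := (abs_le.1 (hZ1 ε x)).1
    have h2 : osc m ε 1 x ≤ 2 := by simpa using osc_le hm ε zero_le_one x
    nlinarith
  -- the exceptional set, where the mean value of `m` is not close to the circle
  obtain ⟨B, hB, hbad⟩ : ∃ B : ℝ, 0 ≤ B ∧ ∀ ε x, ‖Z ε x‖ < 3 / 4 → 1 ≤ B * osc m ε p x := by
    obtain ⟨C₁, hC₁, h⟩ := rpow_le_add_of_lt (p := p) one_pos (by linarith)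
      (show 0 < 1 / (8 * K) by positivity)
    refine ⟨8 * K * C₁, by positivity, fun ε x hx => ?_⟩
    have h1 := osc_le_add hm ε zero_le_one (by linarith) h x
    have h2 := (le_abs_self _).trans (hZ1 ε x)
    have h3 : K * osc m ε 1 x ≤ 1 / 8 + K * C₁ * osc m ε p x := by
      calc _ ≤ K * (1 / (8 * K) + C₁ * osc m ε p x) := by gcongr
        _ = _ := by field_simp
    linarith
  set P : ℝ → Plane → Circle := fun ε x => Circle.exp (Complex.arg (Z ε x)) with hP
  have hZP : ∀ ε x, (‖Z ε x‖ : ℂ) * P ε x = Z ε x := fun ε x => norm_mul_exp_arg _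
  have hPm : ∀ ε x, ‖(P ε x : ℂ) - m x‖ ≤ 2 * K * osc m ε 1 x := fun ε x => by
    have h1 : (P ε x : ℂ) - Z ε x = ((1 - ‖Z ε x‖ : ℝ) : ℂ) * P ε x := by
      push_cast
      linear_combination hZP ε x
    have h2 : ‖(P ε x : ℂ) - Z ε x‖ = |1 - ‖Z ε x‖| := by
      rw [h1, norm_mul, Circle.norm_coe, mul_one, Complex.norm_real, Real.norm_eq_abs]
    have h3 := norm_sub_le_norm_sub_add_norm_sub (P ε x : ℂ) (Z ε x) (m x)
    have h4 := hZ1 ε x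
    have h5 := hclose ε x
    rw [h2] at h3
    linarith
  -- the angle between `m` and its approximation
  set δ : ℝ → Plane → Plane → ℝ := fun ε x y =>
    Complex.arg (m (x - ε • y) / P ε x : Circle) with hδdef
  have hexpδ : ∀ ε x y, Circle.exp (Complex.arg (Z ε x) + δ ε x y) = m (x - ε • y) :=
    fun ε x y => by
    rw [add_comm, Circle.exp_add, hδdef]
    simp only
    rw [Circle.exp_arg, div_mul_cancel]
  obtain ⟨A, hA, hAle⟩ := exists_abs_sub_le_norm_exp_sub
    (show Real.pi < 2 * Real.pi by linarith [Real.pi_pos])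
  have hδpi : ∀ ε x y, |δ ε x y| ≤ Real.pi := fun ε x y => Complex.abs_arg_le_pi _
  have hδ' : ∀ ε x y, |δ ε x y| ≤ A * ‖(m (x - ε • y) : ℂ) - P ε x‖ := fun ε x y => by
    have := hAle (Complex.arg (Z ε x) + δ ε x y) (Complex.arg (Z ε x))
      (by rw [add_sub_cancel_left]; exact hδpi ε x y)
    rwa [add_sub_cancel_left, hexpδ] at this
  set C₀ := A * (1 + 2 * K) with hC₀
  have hC₀0 : 0 ≤ C₀ := by positivity
  have hδ : ∀ ε x y, |δ ε x y| ≤ C₀ * (incr m ε x y + osc m ε 1 x) := fun ε x y => by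
    have h1 := hδ' ε x y
    have h2 := norm_sub_le_norm_sub_add_norm_sub (m (x - ε • y) : ℂ) (m x) (P ε x)
    rw [norm_sub_rev (m x : ℂ)] at h2
    have h3 := hPm ε x
    have h4 := incr_nonneg (m := m) ε x y
    have h5 := osc_nonneg (m := m) ε 1 x
    have h6 : A * ‖(m (x - ε • y) : ℂ) - P ε x‖ ≤
        A * (incr m ε x y + 2 * K * osc m ε 1 x) :=
      mul_le_mul_of_nonneg_left (h2.trans (add_le_add le_rfl h3)) hA
    have h7 : 0 ≤ A * (2 * K) * incr m ε x y := by positivity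
    have h8 : 0 ≤ A * osc m ε 1 x := by positivity
    rw [hC₀]
    linarith
  have hcoe : ∀ ε x y, ((m (x - ε • y) / P ε x : Circle) : ℂ) =
      (m (x - ε • y) : ℂ) * (P ε x : ℂ)⁻¹ := fun ε x y => by
    rw [Circle.coe_div, div_eq_mul_inv]
  set σ : ℝ → Plane → Plane → ℝ := fun ε x y =>
    ((m (x - ε • y) : ℂ) * (P ε x : ℂ)⁻¹).im with hσdef
  have hσδ : ∀ ε x y, σ ε x y = Real.sin (δ ε x y) := fun ε x y => by
    rw [hδdef]
    simp only
    rw [Complex.sin_arg, Circle.norm_coe, div_one, hcoe]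
  have hσ1 : ∀ ε x y, ‖σ ε x y‖ ≤ 1 := fun ε x y => by
    rw [hσδ]; exact Real.abs_sin_le_one _
  have hmy : ∀ ε x, Measurable fun y => (m (x - ε • y) : ℂ) := fun ε x =>
    (stronglyMeasurable_comp_sub_smul hmC ε x).measurable
  have hσm : ∀ ε x, Measurable (σ ε x) := fun ε x =>
    Complex.measurable_im.comp ((hmy ε x).mul_const _)
  have hδm : ∀ ε x, Measurable (δ ε x) := fun ε x => by
    rw [hδdef]
    simp only [hcoe]
    exact Complex.measurable_arg.comp ((hmy ε x).mul_const _)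
  -- the mean value of `m / P` is `‖Z‖`, which is real
  have hσ0 : ∀ ε x, ∫ y, kernel y • σ ε x y = 0 := fun ε x => by
    have hi : Integrable fun y => kernel y • (m (x - ε • y) : ℂ) :=
      integrable_kernel_smul (hmy ε x).aestronglyMeasurable fun y => hM _
    have h1 : ∀ y, kernel y • σ ε x y =
        RCLike.im ((kernel y • (m (x - ε • y) : ℂ)) * (P ε x : ℂ)⁻¹) := fun y => by
      simp [hσdef, mul_assoc]
    simp only [h1]
    rw [integral_im (hi.mul_const _), integral_mul_const]
    change (Z ε x * (P ε x : ℂ)⁻¹).im = 0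
    rw [← hZP ε x, mul_assoc, mul_inv_cancel₀ (Circle.coe_ne_zero _), mul_one]
    exact Complex.ofReal_im _
  have hZne : ∀ ε x, radialCutoff (Z ε x) ≠ 0 → 1 / 2 < ‖Z ε x‖ := fun ε x h => by
    by_contra hcon
    exact h (radialCutoff_eq_zero (not_lt.1 hcon))
  -- a bound for the gradient of the cut-off on the disc
  obtain ⟨Q, hQ⟩ := (isCompact_closedBall (0 : ℂ) (1 + 2 * K)).exists_bound_of_continuousOn
    (contDiff_radialCutoff.continuous_fderiv (by norm_num)).continuousOn
  have hQ' : ∀ ε x, ‖fderiv ℝ radialCutoff (Z ε x)‖ ≤ |Q| := fun ε x =>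
    (hQ _ (by simpa using hZle ε x)).trans (le_abs_self Q)
  have hcut : ∀ z, HasFDerivAt radialCutoff (fderiv ℝ radialCutoff z) z := fun z =>
    (contDiff_radialCutoff.differentiable (by norm_num) z).hasFDerivAt
  refine ⟨{
    χ := fun ε x => radialCutoff (Z ε x)
    dχ := fun ε x => (fderiv ℝ radialCutoff (Z ε x)).comp (fderiv ℝ (Z ε) x)
    ϑ := fun ε x => Complex.arg (Z ε x)
    L := fun ε x => radialCutoff (Z ε x) • Complex.imCLM.comp ((Z ε x)⁻¹ • fderiv ℝ (Z ε) x)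
    V := fun ε x => ∫ y, kernel y • σ ε x y ^ 2
    C := 2 * K + |Q| * K * 2 * B + B + K * (2 * (2 * C₀) ^ 2)
    C_nonneg := by positivity
    measurable_ϑ := fun ε hε => Complex.measurable_arg.comp (hZc ε hε).continuous.measurable
    measurable_L := fun ε hε v => ?_
    measurable_V := fun ε hε => ?_
    mem_angles := fun ε x => by rw [huniv]; trivial
    χ_nonneg := fun _ _ => radialCutoff_nonneg _
    χ_le_one := fun _ _ => radialCutoff_le_one _
    hasFDerivAt_mul := fun ε hε f hf x => ?_
    norm_L_le := fun ε hε x => ?_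
    norm_dχ_le := fun ε hε x => ?_
    one_sub_χ_le := fun ε hε x => ?_
    abs_V_le := fun ε hε x => ?_
    norm_exp_sub_le := fun ε hε x => ?_
    taylor := fun γ hγ η hη => ?_ }⟩
  · have h1 : Measurable fun x => fderiv ℝ (Z ε) x v := measurable_fderiv_apply_const ℝ _ v
    have h2 : Measurable (Z ε) := (hZc ε hε).continuous.measurable
    have h3 : Measurable fun x => radialCutoff (Z ε x) :=
      contDiff_radialCutoff.continuous.measurable.comp h2
    exact h3.mul (Complex.measurable_im.comp (h2.inv.mul h1))
  · have h2 : Measurable fun x => (P ε x : ℂ) :=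
      (continuous_subtype_val.comp Circle.exp.continuous).measurable.comp
        (Complex.measurable_arg.comp (hZc ε hε).continuous.measurable)
    have h1 : Measurable fun q : Plane × Plane => kernel q.2 • σ ε q.1 q.2 ^ 2 := by
      refine (continuous_kernel.measurable.comp measurable_snd).smul (Measurable.pow_const ?_ 2)
      refine Complex.measurable_im.comp (Measurable.mul ?_ (h2.comp measurable_fst).inv)
      exact hmC.measurable.comp (by fun_prop)
    exact (h1.stronglyMeasurable.integral_prod_right' (ν := volume)).measurable
  · by_cases h0 : Z ε x = 0
    · have hz : ‖Z ε x‖ < 1 / 2 := by rw [h0, norm_zero]; norm_num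
      have hev : (fun x => radialCutoff (Z ε x) * f (Circle.exp (Complex.arg (Z ε x))))
          =ᶠ[𝓝 x] fun _ => 0 := by
        filter_upwards [(hZc ε hε).continuous.norm.continuousAt.eventually_lt
          continuousAt_const hz] with x' hx'
        rw [radialCutoff_eq_zero hx'.le, zero_mul]
      have h1 : fderiv ℝ radialCutoff (Z ε x) = 0 := by
        have : radialCutoff =ᶠ[𝓝 (Z ε x)] fun _ => 0 := by
          filter_upwards [continuous_norm.continuousAt.eventually_lt continuousAt_const hz]
            with z hz'
          exact radialCutoff_eq_zero hz'.le
        rw [this.fderiv_eq, fderiv_fun_const, Pi.zero_apply]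
      rw [h1, radialCutoff_eq_zero hz.le, zero_smul, smul_zero, ContinuousLinearMap.zero_comp,
        smul_zero, add_zero]
      exact (hasFDerivAt_const (0 : ℝ) x).congr_of_eventuallyEq hev
    · have hd := hf.hasDerivWithinAt one_ne_zero (θ := Complex.arg (Z ε x))
        (by rw [huniv]; trivial)
      rw [huniv, hasDerivWithinAt_univ] at hd
      have h1 := hasFDerivAt_comp_exp_arg (hZd ε hε x) h0 hd
      have h2 := ((hcut (Z ε x)).comp x (hZd ε hε x)).mul h1
      refine h2.congr_fderiv ?_
      rw [add_comm, Function.comp_apply, smul_comm (radialCutoff _)]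
  · have h1 : ‖Complex.imCLM.comp ((Z ε x)⁻¹ • fderiv ℝ (Z ε) x)‖ ≤
        ‖Z ε x‖⁻¹ * ‖fderiv ℝ (Z ε) x‖ := by
      refine (ContinuousLinearMap.opNorm_comp_le _ _).trans ?_
      rw [Complex.imCLM_norm, one_mul]
      exact (norm_smul_le ((Z ε x)⁻¹) (fderiv ℝ (Z ε) x)).trans_eq (by rw [norm_inv])
    have ho : 0 ≤ ε⁻¹ * osc m ε 1 x := mul_nonneg (by positivity) (osc_nonneg _ _ _)
    have h2 : ‖radialCutoff (Z ε x) • Complex.imCLM.comp ((Z ε x)⁻¹ • fderiv ℝ (Z ε) x)‖ ≤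
        2 * K * (ε⁻¹ * osc m ε 1 x) := by
      by_cases hχ : radialCutoff (Z ε x) = 0
      · rw [hχ, zero_smul, norm_zero]
        positivity
      · have h3 : ‖Z ε x‖⁻¹ ≤ 2 := by
          have := hZne ε x hχ
          rw [inv_le_comm₀ (by linarith) (by norm_num)]
          linarith
        rw [norm_smul, Real.norm_of_nonneg (radialCutoff_nonneg _)]
        calc _ ≤ 1 * (‖Z ε x‖⁻¹ * ‖fderiv ℝ (Z ε) x‖) :=
              mul_le_mul (radialCutoff_le_one _) h1 (norm_nonneg _) zero_le_one
          _ ≤ 1 * (2 * (K * (ε⁻¹ * osc m ε 1 x))) := by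
              gcongr
              exact hDZ ε hε x
          _ = _ := by ring
    refine h2.trans (mul_le_mul_of_nonneg_right ?_ ho)
    have : 0 ≤ |Q| * K * 2 * B + B + K * (2 * (2 * C₀) ^ 2) := by positivity
    linarith
  · have ho : 0 ≤ ε⁻¹ * osc m ε p x := mul_nonneg (by positivity) (osc_nonneg _ _ _)
    have h2 : ‖(fderiv ℝ radialCutoff (Z ε x)).comp (fderiv ℝ (Z ε) x)‖ ≤
        |Q| * K * 2 * B * (ε⁻¹ * osc m ε p x) := by
      rcases lt_or_ge ‖Z ε x‖ (3 / 4) with hlt | hge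
      · have h3 := hbad ε x hlt
        have h4 : osc m ε 1 x ≤ 2 := by simpa using osc_le hm ε zero_le_one x
        refine (ContinuousLinearMap.opNorm_comp_le _ _).trans ?_
        calc _ ≤ |Q| * (K * (ε⁻¹ * osc m ε 1 x)) :=
              mul_le_mul (hQ' ε x) (hDZ ε hε x) (norm_nonneg _) (abs_nonneg _)
          _ ≤ |Q| * (K * (ε⁻¹ * 2)) := by gcongr
          _ = |Q| * K * 2 * ε⁻¹ * 1 := by ring
          _ ≤ |Q| * K * 2 * ε⁻¹ * (B * osc m ε p x) := by gcongr
          _ = _ := by ring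
      · -- the cut-off has its maximum where it is equal to one
        have hmax : IsLocalMax radialCutoff (Z ε x) := Eventually.of_forall fun z => by
          rw [radialCutoff_eq_one hge]
          exact radialCutoff_le_one _
        rw [hmax.fderiv_eq_zero, ContinuousLinearMap.zero_comp, norm_zero]
        positivity
    refine h2.trans (mul_le_mul_of_nonneg_right ?_ ho)
    have : 0 ≤ 2 * K + B + K * (2 * (2 * C₀) ^ 2) := by positivity
    linarith
  · have ho := osc_nonneg (m := m) ε p x
    have h2 : 1 - radialCutoff (Z ε x) ≤ B * osc m ε p x := by
      rcases lt_or_ge ‖Z ε x‖ (3 / 4) with hlt | hge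
      · have : 0 ≤ radialCutoff (Z ε x) := radialCutoff_nonneg _
        linarith [hbad ε x hlt]
      · rw [radialCutoff_eq_one hge, sub_self]
        positivity
    refine h2.trans (mul_le_mul_of_nonneg_right ?_ ho)
    have : 0 ≤ 2 * K + |Q| * K * 2 * B + K * (2 * (2 * C₀) ^ 2) := by positivity
    linarith
  · have h := abs_integral_kernel_smul_le hm le_rfl hC₀0 (hδm ε x) (hδ ε x) zero_le_one
      le_rfl (G := fun y => σ ε x y ^ 2) (fun y => by
        rw [hσδ, zero_mul, add_zero, one_mul, abs_of_nonneg (sq_nonneg _), sq_abs]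
        exact sq_le_sq.2 Real.abs_sin_le_abs)
    refine h.trans ?_
    have := osc_nonneg (m := m) ε 2 x
    have h' : 0 ≤ (2 * K + |Q| * K * 2 * B + B) * osc m ε 2 x := by positivity
    simp only [mul_zero, zero_mul, add_zero, mul_one]
    linarith
  · refine (hPm ε x).trans (mul_le_mul_of_nonneg_right ?_ (osc_nonneg _ _ _))
    have : 0 ≤ |Q| * K * 2 * B + B + K * (2 * (2 * C₀) ^ 2) := by positivity
    linarith
  · obtain ⟨Bγ, hBγ⟩ := isCompact_univ.exists_bound_of_continuousOn hγ.continuousOn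
    set D₂ := K * (2 * (2 * C₀) ^ 2) with hD₂
    set Dp := K * (2 * (2 * C₀) ^ p) with hDp
    have hD₂0 : 0 ≤ D₂ := by positivity
    obtain ⟨C', hC', hT⟩ := taylor_sine hγ hp (show 0 < η / (D₂ + 1) by positivity)
    refine ⟨Dp * C', by positivity, fun ε hε x => ?_⟩
    have hg : StronglyMeasurable fun y => γ (m (x - ε • y)) :=
      stronglyMeasurable_comp_sub_smul
        (stronglyMeasurable_comp_circle hm (fun _ => Set.mem_univ _) hγ.continuousOn) ε x
    have h1 := integral_kernel_smul_taylor (a := γ (P ε x))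
      (b := dTheta Set.univ γ (Complex.arg (Z ε x)))
      (c := dTheta2 Set.univ γ (Complex.arg (Z ε x)))
      hg.aestronglyMeasurable (fun y => hBγ _ (Set.mem_univ _))
      (hσm ε x).aestronglyMeasurable (hσ1 ε x) (hσ0 ε x)
    have h2 := abs_integral_kernel_smul_le hm (by linarith : 1 ≤ p) hC₀0 (hδm ε x) (hδ ε x)
      (show 0 ≤ η / (D₂ + 1) by positivity) hC'
      (G := fun y => γ (m (x - ε • y)) - γ (P ε x) -
        dTheta Set.univ γ (Complex.arg (Z ε x)) * σ ε x y -
        1 / 2 * dTheta2 Set.univ γ (Complex.arg (Z ε x)) * σ ε x y ^ 2) (fun y => by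
        have := hT (Complex.arg (Z ε x)) (δ ε x y) (Complex.abs_arg_le_pi _) (hδpi ε x y)
        rw [hexpδ] at this
        rw [hσδ]
        exact this)
    change |(∫ y, kernel y • γ (m (x - ε • y))) - γ (P ε x) - _| ≤ _
    rw [h1]
    refine h2.trans ?_
    have h4 : D₂ * (η / (D₂ + 1)) ≤ η := by
      rw [mul_div_assoc', div_le_iff₀ (by positivity)]
      nlinarith
    exact add_le_add (mul_le_mul_of_nonneg_right h4 (osc_nonneg _ _ _)) le_rfl

end FullCircle

/-! ### Error terms of an approximation -/

section SmallFamilies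

variable {J : Set Circle} {m : Plane → Circle} {p : ℝ}

theorem IsSmall.mul_of_bounded {E : ℝ → Plane → ℝ} (h : IsSmall m p E) {F : ℝ → Plane → ℝ} {M : ℝ}
    (hF : ∀ ε, 0 < ε → ∀ x, |F ε x| ≤ M) : IsSmall m p fun ε x => F ε x * E ε x :=
  h.of_le fun ε hε _ x => by
    rw [abs_mul]
    exact mul_le_mul_of_nonneg_right (hF ε hε x) (abs_nonneg _)

theorem isSmall_of_modulus (hm : StronglyMeasurable m) (hp : 1 ≤ p) {E : ℝ → Plane → ℝ}
    (h : ∀ η > 0, ∃ C : ℝ, 0 ≤ C ∧ ∀ ε, 0 < ε → ∀ x, |E ε x| ≤ η + C * osc m ε 1 x) :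
    IsSmall m p E := by
  intro η hη
  obtain ⟨C, hC, h⟩ := h (η / 2) (by positivity)
  obtain ⟨C', hC', h'⟩ := isSmall_osc hm one_pos hp (η / 2 / (C + 1)) (by positivity)
  refine ⟨C * C', by positivity, fun ε hε hε1 x => ?_⟩
  have h1 := h ε hε x
  have h2 := (le_abs_self _).trans (h' ε hε hε1 x)
  have ho := osc_nonneg (m := m) ε p x
  set S := ε ^ (-(p / 3)) * osc m ε p x with hS
  have hS0 : 0 ≤ S := by positivity
  have h3 : C * osc m ε 1 x ≤
      C * (η / 2 / (C + 1) * (1 + S) + C' * (ε⁻¹ * osc m ε p x)) := by gcongr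
  have h4 : C * (η / 2 / (C + 1)) ≤ η / 2 := by
    rw [mul_div_assoc', div_le_iff₀ (by positivity)]
    nlinarith
  have h5 : C * (η / 2 / (C + 1)) * (1 + S) ≤ η / 2 * (1 + S) := by gcongr
  have h6 : 0 ≤ η / 2 * S := by positivity
  linarith

variable (A : AngularApprox J m p)

namespace AngularApprox

theorem exp_mem (ε : ℝ) (x : Plane) : Circle.exp (A.ϑ ε x) ∈ J := A.mem_angles ε x

theorem exists_modulus_apply_sub (hJ : IsCompact J) (hmJ : ∀ x, m x ∈ J) {f : Circle → ℝ}
    (hf : ContinuousOn f J) : ∀ η > 0, ∃ C : ℝ, 0 ≤ C ∧ ∀ ε, 0 < ε → ∀ x,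
      |f (m x) - f (Circle.exp (A.ϑ ε x))| ≤ η + C * osc m ε 1 x := by
  intro η hη
  obtain ⟨C, hC, h⟩ := exists_modulus hJ hf hη
  refine ⟨C * A.C, mul_nonneg hC A.C_nonneg, fun ε hε x => ?_⟩
  have h1 := h _ (A.exp_mem ε x) _ (hmJ x)
  rw [norm_sub_rev, Real.norm_eq_abs] at h1
  refine h1.trans ?_
  rw [mul_assoc]
  gcongr
  exact A.norm_exp_sub_le ε hε x

theorem isSmall_apply_sub (hJ : IsCompact J) (hm : StronglyMeasurable m) (hmJ : ∀ x, m x ∈ J)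
    (hp : 1 ≤ p) {f : Circle → ℝ} (hf : ContinuousOn f J) :
    IsSmall m p fun ε x => f (m x) - f (Circle.exp (A.ϑ ε x)) :=
  isSmall_of_modulus hm hp (A.exists_modulus_apply_sub hJ hmJ hf)

theorem isSmall_one_sub : IsSmall m p fun ε x => 1 - A.χ ε x := by
  refine isSmall_inv_mul_osc.of_le (M := A.C) fun ε hε hε1 x => ?_
  have ho := osc_nonneg (m := m) ε p x
  rw [abs_of_nonneg (sub_nonneg.2 (A.χ_le_one ε x)), abs_of_nonneg (by positivity)]
  refine (A.one_sub_χ_le ε hε x).trans (mul_le_mul_of_nonneg_left ?_ A.C_nonneg)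
  exact le_mul_of_one_le_left ho ((one_le_inv₀ hε).2 hε1)

theorem isSmall_dχ {v : Plane} (hv : ‖v‖ ≤ 1) : IsSmall m p fun ε x => A.dχ ε x v := by
  refine isSmall_inv_mul_osc.of_le (M := A.C) fun ε hε hε1 x => ?_
  have ho := osc_nonneg (m := m) ε p x
  have h1 := (A.dχ ε x).le_of_opNorm_le (A.norm_dχ_le ε hε x) v
  rw [Real.norm_eq_abs] at h1
  rw [abs_of_nonneg (by positivity : 0 ≤ ε⁻¹ * osc m ε p x)]
  refine h1.trans (mul_le_of_le_one_right ?_ hv)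
  exact mul_nonneg A.C_nonneg (by positivity)

theorem abs_L_apply_le {ε : ℝ} (hε : 0 < ε) (x : Plane) {v : Plane} (hv : ‖v‖ ≤ 1) :
    |A.L ε x v| ≤ A.C * (ε⁻¹ * osc m ε 1 x) := by
  have h1 := (A.L ε x).le_of_opNorm_le (A.norm_L_le ε hε x) v
  rw [Real.norm_eq_abs] at h1
  refine h1.trans (mul_le_of_le_one_right ?_ hv)
  exact mul_nonneg A.C_nonneg (mul_nonneg (by positivity) (osc_nonneg _ _ _))

/-- `m` may be replaced by its angular approximation in the mollification of `γ(m)`. -/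
theorem isSmall_apply_sub_mollify (hm : StronglyMeasurable m) (hp : 2 ≤ p) {γ : Circle → ℝ}
    (hγ : IsCkOn 2 J γ) {M : ℝ} (hM : ∀ θ ∈ angles J, |dTheta2 J γ θ| ≤ M) :
    IsSmall m p fun ε x => γ (Circle.exp (A.ϑ ε x)) - mollify ε (fun y => γ (m y)) x := by
  obtain ⟨C', hC', hT⟩ := A.taylor γ hγ 1 one_pos
  have h1 : IsSmall m p fun ε x => (1 + 1 / 2 * M * A.C) * osc m ε 2 x :=
    (isSmall_osc hm two_pos hp).mul_of_bounded (M := |1 + 1 / 2 * M * A.C|) fun _ _ _ => le_rfl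
  have h2 : IsSmall m p fun ε x => C' * osc m ε p x :=
    (isSmall_osc hm (by linarith) le_rfl).mul_of_bounded (M := |C'|) fun _ _ _ => le_rfl
  refine (h1.add h2).of_le (M := 1) fun ε hε hε1 x => ?_
  rw [one_mul]
  refine le_trans ?_ (le_abs_self _)
  have e1 := hT ε hε x
  have e2 := hM _ (A.mem_angles ε x)
  have e3 := A.abs_V_le ε hε x
  have hM0 : 0 ≤ M := (abs_nonneg _).trans e2
  have e4 : |1 / 2 * dTheta2 J γ (A.ϑ ε x) * A.V ε x| ≤ 1 / 2 * M * (A.C * osc m ε 2 x) := by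
    rw [abs_mul, abs_mul, abs_of_pos (by norm_num : (0 : ℝ) < 1 / 2)]
    gcongr
  have e5 := abs_add_le (mollify ε (fun y => γ (m y)) x - γ (Circle.exp (A.ϑ ε x)) -
      1 / 2 * dTheta2 J γ (A.ϑ ε x) * A.V ε x) (1 / 2 * dTheta2 J γ (A.ϑ ε x) * A.V ε x)
  rw [sub_add_cancel] at e5
  rw [abs_sub_comm]
  linarith

/-- The remainder in the second order expansion of the mollification of `γ(m)` is negligible, even
against the differential of the angle. -/
theorem isSmall_L_mul (hm : StronglyMeasurable m) (hp : 3 < p) {γ : Circle → ℝ}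
    (hγ : IsCkOn 2 J γ) {v : Plane} (hv : ‖v‖ ≤ 1) :
    IsSmall m p fun ε x => A.L ε x v * (mollify ε (fun y => γ (m y)) x -
      γ (Circle.exp (A.ϑ ε x)) - 1 / 2 * dTheta2 J γ (A.ϑ ε x) * A.V ε x) := by
  have hC := A.C_nonneg
  refine isSmall_cubic hm hp fun η hη => ?_
  obtain ⟨C', hC', hT⟩ := A.taylor γ hγ (η / (A.C + 1)) (by positivity)
  refine ⟨A.C * C', by positivity, fun ε hε hε1 x => ?_⟩
  have h1 := osc_nonneg (m := m) ε 1 x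
  have h2 := osc_nonneg (m := m) ε 2 x
  have h4 : A.C * (η / (A.C + 1)) ≤ η := by
    rw [mul_div_assoc', div_le_iff₀ (by positivity)]
    nlinarith
  rw [abs_mul]
  calc _ ≤ A.C * (ε⁻¹ * osc m ε 1 x) * (η / (A.C + 1) * osc m ε 2 x + C' * osc m ε p x) :=
        mul_le_mul (A.abs_L_apply_le hε x hv) (hT ε hε x) (abs_nonneg _) (by positivity)
    _ = ε⁻¹ * osc m ε 1 x * (A.C * (η / (A.C + 1)) * osc m ε 2 x +
          A.C * C' * osc m ε p x) := by ring
    _ ≤ _ := by gcongr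

end AngularApprox

theorem exists_bound_of_periodic (hJ : IsCompact J) {g : ℝ → ℝ}
    (hg : Function.Periodic g (2 * Real.pi)) (hc : ContinuousOn g (angles J)) :
    ∃ M : ℝ, 0 ≤ M ∧ ∀ θ ∈ angles J, |g θ| ≤ M := by
  obtain ⟨M, hM⟩ := hJ.exists_bound_of_continuousOn (continuousOn_comp_arg hg hc)
  refine ⟨|M|, abs_nonneg _, fun θ hθ => ?_⟩
  have := (hM _ hθ).trans (le_abs_self M)
  rwa [apply_arg_exp hg, Real.norm_eq_abs] at this

end SmallFamilies

/-! ### Mollification of divergence-free fields -/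

section Divergence

/-- The coordinate directions of the plane. -/
noncomputable def coordVec (k : Fin 2) : Plane := EuclideanSpace.single k (1 : ℝ)

theorem norm_coordVec (k : Fin 2) : ‖coordVec k‖ ≤ 1 := by simp [coordVec]

theorem apply_eq_sum_coordVec (ℓ : Plane →L[ℝ] ℝ) (v : Plane) :
    ℓ v = ∑ k, ℓ (coordVec k) * v k := by
  have h : v = ∑ k, v k • coordVec k := by
    ext i
    fin_cases i <;> simp [coordVec, Fin.sum_univ_two]
  conv_lhs => rw [h]
  simp [mul_comm]

theorem norm_mollify_le {F : Type*} [NormedAddCommGroup F] [NormedSpace ℝ F] {f : Plane → F}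
    {M : ℝ} (hM : ∀ y, ‖f y‖ ≤ M) (ε : ℝ) (x : Plane) :
    ‖mollify ε f x‖ ≤ M := by
  have h : ‖mollify ε f x‖ ≤ ∫ y, kernel y * M := by
    refine norm_integral_le_of_norm_le (integrable_kernel.mul_const M)
      (Eventually.of_forall fun y => ?_)
    rw [norm_smul, Real.norm_of_nonneg (kernel_nonneg y)]
    exact mul_le_mul_of_nonneg_left (hM _) (kernel_nonneg y)
  rwa [integral_mul_const, integral_kernel, one_mul] at h

/-- A divergence-free field tested against the translated and rescaled kernel. -/
theorem IsDivFree.integral_fderiv_kernel_eq_zero {Ω : Opens Plane} {F : Plane → Plane}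
    (hF : IsDivFree Ω F) {ε : ℝ} (hε : 0 < ε) {x : Plane} (hx : closedBall x ε ⊆ Ω) :
    ∫ y, fderiv ℝ kernel y (F (x - ε • y)) = 0 := by
  set ψ : Plane → ℝ := fun z => kernel (ε⁻¹ • (x - z)) with hψ
  have hball : ∀ z, ε⁻¹ • (x - z) ∈ ball (0 : Plane) 1 → z ∈ closedBall x ε := fun z hmem => by
    rw [mem_ball_zero_iff, norm_smul, Real.norm_of_nonneg (by positivity),
      inv_mul_lt_iff₀ hε, mul_one] at hmem
    rw [mem_closedBall, dist_comm, dist_eq_norm]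
    exact hmem.le
  have hsupp : Function.support ψ ⊆ closedBall x ε := fun z hz => by
    by_contra hcon
    exact hz (kernel_eq_zero fun hmem => hcon (hball z hmem))
  have hψd : ContDiff ℝ ((⊤ : ℕ∞) : WithTop ℕ∞) ψ :=
    contDiff_kernel.comp (by fun_prop :
      ContDiff ℝ ((⊤ : ℕ∞) : WithTop ℕ∞) fun z : Plane => ε⁻¹ • (x - z))
  set ζ : 𝓓(Ω, ℝ) := ⟨ψ, hψd,
    HasCompactSupport.of_support_subset_isCompact (isCompact_closedBall x ε) hsupp,
    (closure_minimal hsupp isClosed_closedBall).trans hx⟩ with hζ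
  have h0 := hF.2 ζ
  have hd : ∀ z v, fderiv ℝ ζ z v = -(ε⁻¹ * fderiv ℝ kernel (ε⁻¹ • (x - z)) v) := fun z v => by
    have h1 : HasFDerivAt kernel (fderiv ℝ kernel (ε⁻¹ • (x - z))) (ε⁻¹ • (x - z)) :=
      ((contDiff_kernel (n := 1)).differentiable (by norm_num) _).hasFDerivAt
    have h2 : HasFDerivAt (fun z : Plane => ε⁻¹ • (x - z))
        (ε⁻¹ • -(ContinuousLinearMap.id ℝ Plane)) z :=
      ((hasFDerivAt_id z).const_sub x).const_smul ε⁻¹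
    have h3 := (h1.comp z h2).fderiv
    change fderiv ℝ (kernel ∘ fun z : Plane => ε⁻¹ • (x - z)) z v = _
    rw [h3]
    simp
  simp only [hd] at h0
  rw [integral_neg, integral_const_mul, neg_eq_zero, mul_eq_zero] at h0
  have h1 := h0.resolve_left (by positivity)
  rw [setIntegral_eq_integral_of_forall_compl_eq_zero fun z hz => by
    rw [fderiv_kernel_eq_zero fun hmem => hz (hx (hball z hmem)), zero_apply]]
    at h1
  have h2 := integral_sub_left_eq_self (fun w => fderiv ℝ kernel (ε⁻¹ • w) (F (x - w)))
    (volume : Measure Plane) x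
  simp only [sub_sub_cancel] at h2
  have h3 := Measure.integral_comp_smul (volume : Measure Plane)
    (fun w => fderiv ℝ kernel (ε⁻¹ • w) (F (x - w))) ε
  simp only [smul_smul, inv_mul_cancel₀ hε.ne', one_smul] at h3
  rw [h3, ← h2, h1, smul_zero]

/-- The mollification of a divergence-free field is divergence-free, away from the boundary. -/
theorem IsDivFree.sum_fderiv_mollify_eq_zero {Ω : Opens Plane} {f : Fin 2 → Plane → ℝ}
    (hF : IsDivFree Ω fun x => WithLp.toLp 2 fun k => f k x)
    (hf : ∀ k, StronglyMeasurable (f k)) {M : ℝ} (hM : ∀ k y, ‖f k y‖ ≤ M) {ε : ℝ} (hε : 0 < ε)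
    {x : Plane} (hx : closedBall x ε ⊆ Ω) :
    ∑ k, fderiv ℝ (mollify ε (f k)) x (coordVec k) = 0 := by
  have h := hF.integral_fderiv_kernel_eq_zero hε hx
  have h1 : ∀ y, fderiv ℝ kernel y (WithLp.toLp 2 fun k => f k (x - ε • y)) =
      ∑ k, fderiv ℝ kernel y (coordVec k) • f k (x - ε • y) := fun y => by
    rw [apply_eq_sum_coordVec]
    simp
  simp only [h1] at h
  rw [integral_finsetSum _ fun k _ => integrable_fderiv_kernel_smul
    (stronglyMeasurable_comp_sub_smul (hf k) ε x).aestronglyMeasurable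
    (fun y => hM k _) _] at h
  simp only [fderiv_mollify_apply hε (hf _) (hM _)]
  rw [← Finset.smul_sum, h, smul_zero]

end Divergence

/-! ### Products and bounds -/

section Calculus

variable {J : Set Circle} {f g : Circle → ℝ}

theorem IsCkOn.mul {k : ℕ} (hf : IsCkOn k J f) (hg : IsCkOn k J g) :
    IsCkOn k J fun z => f z * g z :=
  ContDiffOn.mul hf hg

theorem dTheta_mul (hu : UniqueDiffOn ℝ (angles J)) (hf : IsCkOn 1 J f) (hg : IsCkOn 1 J g) {θ : ℝ}
    (hθ : θ ∈ angles J) : dTheta J (fun z => f z * g z) θ =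
      dTheta J f θ * g (Circle.exp θ) + f (Circle.exp θ) * dTheta J g θ :=
  dTheta_eq_of_hasDerivWithinAt hu hθ
    ((hf.hasDerivWithinAt one_ne_zero hθ).mul (hg.hasDerivWithinAt one_ne_zero hθ))

theorem exists_bound_of_continuousOn (hJ : IsCompact J) (hf : ContinuousOn f J) :
    ∃ M : ℝ, 0 ≤ M ∧ ∀ z ∈ J, |f z| ≤ M := by
  obtain ⟨M, hM⟩ := hJ.exists_bound_of_continuousOn hf
  exact ⟨|M|, abs_nonneg _, fun z hz => (hM z hz).trans (le_abs_self M)⟩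

end Calculus

section Integrability

variable {ζ f : Plane → ℝ}

theorem integrable_mul_of_bounded (hζ : Continuous ζ) (hs : HasCompactSupport ζ)
    (hf : AEStronglyMeasurable f) {M : ℝ} (hM : ∀ x, |f x| ≤ M) :
    Integrable fun x => ζ x * f x :=
  (hζ.integrable_of_hasCompactSupport hs).mul_bdd (c := M) hf (Eventually.of_forall hM)

theorem continuous_fderiv_apply_of_contDiff (hζ : ContDiff ℝ 1 ζ) (v : Plane) :
    Continuous fun x => fderiv ℝ ζ x v :=
  (hζ.continuous_fderiv one_ne_zero).clm_apply continuous_const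

theorem abs_fderiv_mollify_le {f : Plane → ℝ} {M : ℝ} (hf : StronglyMeasurable f)
    (hM : ∀ y, ‖f y‖ ≤ M) {ε : ℝ} (hε : 0 < ε) (x v : Plane) :
    |fderiv ℝ (mollify ε f) x v| ≤ ε⁻¹ * (kernelConst * ‖v‖ * M) := by
  rw [fderiv_mollify_apply hε hf hM, smul_eq_mul, abs_mul, abs_of_pos (inv_pos.2 hε)]
  gcongr
  have h := norm_integral_fderiv_kernel_smul_le (g := fun y => f (x - ε • y))
    (integrableOn_const_ball M) (fun y _ => hM _) v
  rwa [average_const_ball] at h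

end Integrability

/-! ### The corrected field and its divergence -/

namespace AngularApprox

variable {J : Set Circle} {m : Plane → Circle} {p : ℝ} (A : AngularApprox J m p)

/-- The value `φ(P) + ∑ⱼ αⱼ(P) (gⱼ - γⱼ(P))` at the approximation `P = exp(iϑ)` of `m`, with `gⱼ`
the mollification of `γⱼ(m)`. If `φ' = ∑ⱼ αⱼ γⱼ'`, the terms of first order in its differential
involve the `gⱼ` only. -/
noncomputable def corrected (φ : Circle → ℝ) (α γ : Fin 2 → Circle → ℝ) (ε : ℝ) (x : Plane) : ℝ :=
  φ (Circle.exp (A.ϑ ε x)) + ∑ j, α j (Circle.exp (A.ϑ ε x)) *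
    (mollify ε (fun y => γ j (m y)) x - γ j (Circle.exp (A.ϑ ε x)))

variable {φ : Circle → ℝ} {α γ : Fin 2 → Circle → ℝ}

theorem exists_bound_corrected (hJ : IsCompact J) (hmJ : ∀ x, m x ∈ J) (hφ : IsCkOn 1 J φ)
    (hα : ∀ j, IsCkOn 1 J (α j)) (hγ : ∀ j, IsCkOn 2 J (γ j)) :
    ∃ M : ℝ, 0 ≤ M ∧ ∀ ε x, |A.corrected φ α γ ε x| ≤ M := by
  obtain ⟨M₁, h₁, hM₁⟩ := exists_bound_of_continuousOn hJ hφ.continuousOn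
  choose M₂ h₂ hM₂ using fun j => exists_bound_of_continuousOn hJ (hα j).continuousOn
  choose M₃ h₃ hM₃ using fun j => exists_bound_of_continuousOn hJ (hγ j).continuousOn
  refine ⟨M₁ + ∑ j, M₂ j * (M₃ j + M₃ j), ?_, fun ε x => ?_⟩
  · exact add_nonneg h₁ (Finset.sum_nonneg fun j _ => mul_nonneg (h₂ j) (by linarith [h₃ j]))
  refine (abs_add_le _ _).trans (add_le_add (hM₁ _ (A.exp_mem ε x)) ?_)
  refine (Finset.abs_sum_le_sum_abs _ _).trans (Finset.sum_le_sum fun j _ => ?_)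
  rw [abs_mul]
  refine mul_le_mul (hM₂ j _ (A.exp_mem ε x)) ((abs_sub _ _).trans (add_le_add ?_
    (hM₃ j _ (A.exp_mem ε x)))) (abs_nonneg _) (h₂ j)
  exact norm_mollify_le (f := fun y => γ j (m y)) (fun y => hM₃ j _ (hmJ y)) ε x

/-- The terms with `φ'` and `γⱼ'` in the differential cancel. -/
theorem hasFDerivAt_mul_corrected (hu : UniqueDiffOn ℝ (angles J)) (hJ : IsCompact J)
    (hm : StronglyMeasurable m) (hmJ : ∀ x, m x ∈ J) (hφ : IsCkOn 1 J φ)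
    (hα : ∀ j, IsCkOn 1 J (α j)) (hγ : ∀ j, IsCkOn 2 J (γ j))
    (h : ∀ θ ∈ angles J, dTheta J φ θ = ∑ j, α j (Circle.exp θ) * dTheta J (γ j) θ)
    {ε : ℝ} (hε : 0 < ε) (x : Plane) :
    HasFDerivAt (fun x => A.χ ε x * A.corrected φ α γ ε x)
      (A.corrected φ α γ ε x • A.dχ ε x + ∑ j, ((dTheta J (α j) (A.ϑ ε x) *
          (mollify ε (fun y => γ j (m y)) x - γ j (Circle.exp (A.ϑ ε x)))) • A.L ε x +
        (A.χ ε x * α j (Circle.exp (A.ϑ ε x))) •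
          fderiv ℝ (mollify ε fun y => γ j (m y)) x)) x := by
  have hg : ∀ j, HasFDerivAt (mollify ε fun y => γ j (m y))
      (fderiv ℝ (mollify ε fun y => γ j (m y)) x) x := fun j => by
    obtain ⟨M, -, hM⟩ := exists_bound_of_continuousOn hJ (hγ j).continuousOn
    exact ((contDiff_mollify hε (stronglyMeasurable_comp_circle hm hmJ (hγ j).continuousOn)
      (fun y => hM _ (hmJ y)) (n := 1)).differentiable (by norm_num) x).hasFDerivAt
  have hγ1 : ∀ j, IsCkOn 1 J (γ j) := fun j => (hγ j).of_le one_le_two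
  have h1 := A.hasFDerivAt_mul ε hε φ hφ x
  have h2 := fun j => A.hasFDerivAt_mul ε hε _ ((hα j).mul (hγ1 j)) x
  have h3 := fun j => (A.hasFDerivAt_mul ε hε _ (hα j) x).mul (hg j)
  have h4 := h1.add (HasFDerivAt.fun_sum (u := Finset.univ) fun j _ => (h3 j).sub (h2 j))
  have hθ := A.mem_angles ε x
  refine (h4.congr_fderiv ?_).congr_of_eventuallyEq (Eventually.of_forall fun z => ?_)
  · ext v
    simp only [corrected, Fin.sum_univ_two, dTheta_mul hu (hα _) (hγ1 _) hθ, h _ hθ,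
      add_apply, sub_apply,
      smul_apply, smul_eq_mul]
    ring
  · simp only [corrected, Fin.sum_univ_two, Pi.add_apply, Pi.sub_apply, Pi.mul_apply]
    ring

theorem isSmall_apply_sub_corrected (hu : UniqueDiffOn ℝ (angles J)) (hJ : IsCompact J)
    (hm : StronglyMeasurable m) (hmJ : ∀ x, m x ∈ J) (hp : 3 < p) (hφ : IsCkOn 1 J φ)
    (hα : ∀ j, IsCkOn 1 J (α j)) (hγ : ∀ j, IsCkOn 2 J (γ j)) :
    IsSmall m p fun ε x => φ (m x) - A.χ ε x * A.corrected φ α γ ε x := by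
  obtain ⟨M, -, hM⟩ := A.exists_bound_corrected hJ hmJ hφ hα hγ
  choose M₂ h₂ hM₂ using fun j => exists_bound_of_continuousOn hJ (hα j).continuousOn
  choose M₃ h₃ hM₃ using fun j =>
    exists_bound_of_periodic hJ periodic_dTheta2 ((hγ j).continuousOn_dTheta2 hu)
  have e1 := A.isSmall_apply_sub hJ hm hmJ (by linarith : 1 ≤ p) hφ.continuousOn
  have e2 := A.isSmall_one_sub.mul_of_bounded fun ε _ x => hM ε x
  have e3 := IsSmall.sum Finset.univ fun j _ => (A.isSmall_apply_sub_mollify hm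
    (by linarith : 2 ≤ p) (hγ j) (hM₃ j)).mul_of_bounded
      (F := fun ε x => α j (Circle.exp (A.ϑ ε x))) fun ε _ x => hM₂ j _ (A.exp_mem ε x)
  refine ((e1.add e2).add e3).of_le (M := 1) fun ε _ _ x => le_of_eq ?_
  rw [one_mul]
  congr 1
  simp only [corrected, Fin.sum_univ_two]
  ring

/-- The directional derivative of `χ` times the corrected value, apart from the part with the
derivatives of the mollified `γⱼ(m)`, equals `½ ∑ⱼ αⱼ' γⱼ'' V L` up to a negligible term. -/
theorem isSmall_remainder (hu : UniqueDiffOn ℝ (angles J)) (hJ : IsCompact J)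
    (hm : StronglyMeasurable m) (hmJ : ∀ x, m x ∈ J) (hp : 3 < p) (hφ : IsCkOn 1 J φ)
    (hα : ∀ j, IsCkOn 1 J (α j)) (hγ : ∀ j, IsCkOn 2 J (γ j)) {v : Plane} (hv : ‖v‖ ≤ 1) :
    IsSmall m p fun ε x => A.corrected φ α γ ε x * A.dχ ε x v +
      ∑ j, dTheta J (α j) (A.ϑ ε x) * (A.L ε x v * (mollify ε (fun y => γ j (m y)) x -
        γ j (Circle.exp (A.ϑ ε x)) - 1 / 2 * dTheta2 J (γ j) (A.ϑ ε x) * A.V ε x)) := by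
  obtain ⟨M, -, hM⟩ := A.exists_bound_corrected hJ hmJ hφ hα hγ
  choose M₂ h₂ hM₂ using fun j =>
    exists_bound_of_periodic hJ periodic_dTheta ((hα j).continuousOn_dTheta hu)
  refine ((A.isSmall_dχ hv).mul_of_bounded fun ε _ x => hM ε x).add
    (IsSmall.sum Finset.univ fun j _ => (A.isSmall_L_mul hm hp (hγ j) hv).mul_of_bounded
      (F := fun ε x => dTheta J (α j) (A.ϑ ε x)) fun ε _ x => hM₂ j _ (A.mem_angles ε x))

theorem exists_bound_V (hm : StronglyMeasurable m) : ∃ M : ℝ, ∀ ε, 0 < ε → ∀ x, |A.V ε x| ≤ M :=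
  ⟨A.C * 2 ^ (2 : ℝ), fun ε hε x => (A.abs_V_le ε hε x).trans
    (mul_le_mul_of_nonneg_left (osc_le hm ε zero_le_two x) A.C_nonneg)⟩

theorem exists_bound_L (hm : StronglyMeasurable m) {ε : ℝ} (hε : 0 < ε) {v : Plane}
    (hv : ‖v‖ ≤ 1) : ∃ M : ℝ, ∀ x, |A.L ε x v| ≤ M :=
  ⟨A.C * (ε⁻¹ * 2 ^ (1 : ℝ)), fun x => (A.abs_L_apply_le hε x hv).trans
    (mul_le_mul_of_nonneg_left (mul_le_mul_of_nonneg_left (osc_le hm ε zero_le_one x)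
      (by positivity)) A.C_nonneg)⟩

/-- Products of a test function with a bounded weight and with the cubic quantity `V L`. -/
theorem integrable_mul_V_mul_L (hm : StronglyMeasurable m) {ζ : Plane → ℝ} (hζ : Continuous ζ)
    (hs : HasCompactSupport ζ) {ε : ℝ} (hε : 0 < ε) {v : Plane} (hv : ‖v‖ ≤ 1) {w : Plane → ℝ}
    (hw : AEStronglyMeasurable w) {M : ℝ} (hM : ∀ x, |w x| ≤ M) :
    Integrable fun x => ζ x * (w x * A.V ε x * A.L ε x v) := by
  obtain ⟨M₁, h₁⟩ := A.exists_bound_V hm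
  obtain ⟨M₂, h₂⟩ := A.exists_bound_L hm hε hv
  refine integrable_mul_of_bounded hζ hs (M := M * M₁ * M₂) ((hw.mul
    (A.measurable_V ε hε).aestronglyMeasurable).mul
      (A.measurable_L ε hε v).aestronglyMeasurable) fun x => ?_
  have h0 : 0 ≤ M := (abs_nonneg _).trans (hM x)
  have h0' : 0 ≤ M₁ := (abs_nonneg _).trans (h₁ ε hε x)
  rw [abs_mul, abs_mul]
  gcongr
  exacts [hM x, h₁ ε hε x, h₂ x]

theorem exists_bound_fderiv_mul_corrected (hu : UniqueDiffOn ℝ (angles J)) (hJ : IsCompact J)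
    (hm : StronglyMeasurable m) (hmJ : ∀ x, m x ∈ J) (hφ : IsCkOn 1 J φ)
    (hα : ∀ j, IsCkOn 1 J (α j)) (hγ : ∀ j, IsCkOn 2 J (γ j)) (hp : 0 ≤ p)
    (h : ∀ θ ∈ angles J, dTheta J φ θ = ∑ j, α j (Circle.exp θ) * dTheta J (γ j) θ)
    {ε : ℝ} (hε : 0 < ε) {v : Plane} (hv : ‖v‖ ≤ 1) :
    ∃ B : ℝ, ∀ x, |fderiv ℝ (fun x => A.χ ε x * A.corrected φ α γ ε x) x v| ≤ B := by
  obtain ⟨M, hM0, hM⟩ := A.exists_bound_corrected hJ hmJ hφ hα hγ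
  obtain ⟨M₁, hM₁⟩ := A.exists_bound_L hm hε hv
  choose M₂ h₂ hM₂ using fun j => exists_bound_of_continuousOn hJ (hα j).continuousOn
  choose M₃ h₃ hM₃ using fun j => exists_bound_of_continuousOn hJ (hγ j).continuousOn
  choose M₄ h₄ hM₄ using fun j =>
    exists_bound_of_periodic hJ periodic_dTheta ((hα j).continuousOn_dTheta hu)
  have hC := A.C_nonneg
  refine ⟨M * (A.C * (ε⁻¹ * 2 ^ p)) + ∑ j, (M₄ j * (M₃ j + M₃ j) * M₁ +
    1 * M₂ j * (ε⁻¹ * (kernelConst * ‖v‖ * M₃ j))), fun x => ?_⟩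
  have hM₁0 : 0 ≤ M₁ := (abs_nonneg _).trans (hM₁ x)
  rw [(A.hasFDerivAt_mul_corrected hu hJ hm hmJ hφ hα hγ h hε x).fderiv]
  simp only [add_apply, smul_apply, sum_apply, smul_eq_mul]
  refine (abs_add_le _ _).trans (add_le_add ?_ ((Finset.abs_sum_le_sum_abs _ _).trans
    (Finset.sum_le_sum fun j _ => (abs_add_le _ _).trans (add_le_add ?_ ?_))))
  · rw [abs_mul]
    refine mul_le_mul (hM ε x) ?_ (abs_nonneg _) hM0
    refine ((A.dχ ε x).le_of_opNorm_le (A.norm_dχ_le ε hε x) v).trans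
      ((mul_le_of_le_one_right ?_ hv).trans ?_)
    · exact mul_nonneg hC (mul_nonneg (by positivity) (osc_nonneg _ _ _))
    · gcongr
      exact osc_le hm ε hp x
  · rw [abs_mul, abs_mul]
    have h5 : |mollify ε (fun y => γ j (m y)) x - γ j (Circle.exp (A.ϑ ε x))| ≤ M₃ j + M₃ j :=
      (abs_sub _ _).trans (add_le_add
        (norm_mollify_le (f := fun y => γ j (m y)) (fun y => hM₃ j _ (hmJ y)) ε x)
        (hM₃ j _ (A.exp_mem ε x)))
    have := h₃ j
    have := h₄ j
    gcongr
    exacts [hM₄ j _ (A.mem_angles ε x), hM₁ x]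
  · rw [abs_mul, abs_mul, abs_of_nonneg (A.χ_nonneg ε x)]
    have := h₂ j
    gcongr
    exacts [A.χ_le_one ε x, hM₂ j _ (A.exp_mem ε x), abs_fderiv_mollify_le
      (stronglyMeasurable_comp_circle hm hmJ (hγ j).continuousOn) (fun y => hM₃ j _ (hmJ y)) hε x v]

/-- Integration by parts against a test function. -/
theorem integral_mul_corrected_eq_zero (hu : UniqueDiffOn ℝ (angles J)) (hJ : IsCompact J)
    (hm : StronglyMeasurable m) (hmJ : ∀ x, m x ∈ J) (hφ : IsCkOn 1 J φ)
    (hα : ∀ j, IsCkOn 1 J (α j)) (hγ : ∀ j, IsCkOn 2 J (γ j)) (hp : 0 ≤ p)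
    (h : ∀ θ ∈ angles J, dTheta J φ θ = ∑ j, α j (Circle.exp θ) * dTheta J (γ j) θ)
    {ε : ℝ} (hε : 0 < ε) {ζ : Plane → ℝ} (hζ : ContDiff ℝ 1 ζ) (hs : HasCompactSupport ζ)
    {v : Plane} (hv : ‖v‖ ≤ 1) :
    Integrable (fun x => fderiv ℝ ζ x v * (A.χ ε x * A.corrected φ α γ ε x) + ζ x *
      fderiv ℝ (fun x => A.χ ε x * A.corrected φ α γ ε x) x v) ∧
    ∫ x, (fderiv ℝ ζ x v * (A.χ ε x * A.corrected φ α γ ε x) + ζ x *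
      fderiv ℝ (fun x => A.χ ε x * A.corrected φ α γ ε x) x v) = 0 := by
  have hX := A.hasFDerivAt_mul_corrected hu hJ hm hmJ hφ hα hγ h hε
  set X : Plane → ℝ := fun x => A.χ ε x * A.corrected φ α γ ε x with hXdef
  obtain ⟨M, hM0, hM⟩ := A.exists_bound_corrected hJ hmJ hφ hα hγ
  have hXd : Differentiable ℝ X := fun x => (hX x).differentiableAt
  have hXM : ∀ x, |X x| ≤ 1 * M := fun x => by
    rw [hXdef, abs_mul, abs_of_nonneg (A.χ_nonneg ε x)]
    exact mul_le_mul (A.χ_le_one ε x) (hM ε x) (abs_nonneg _) zero_le_one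
  have hζ' := continuous_fderiv_apply_of_contDiff hζ v
  have i1 : Integrable fun x => fderiv ℝ ζ x v * X x :=
    integrable_mul_of_bounded hζ' (hs.fderiv_apply (𝕜 := ℝ) v)
      hXd.continuous.aestronglyMeasurable hXM
  have i3 : Integrable fun x => ζ x * X x :=
    integrable_mul_of_bounded hζ.continuous hs hXd.continuous.aestronglyMeasurable hXM
  have i2 : Integrable fun x => ζ x * fderiv ℝ X x v := by
    obtain ⟨B, hB⟩ := A.exists_bound_fderiv_mul_corrected hu hJ hm hmJ hφ hα hγ hp h hε hv
    exact integrable_mul_of_bounded hζ.continuous hs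
      (measurable_fderiv_apply_const ℝ X v).aestronglyMeasurable hB
  refine ⟨i1.add i2, ?_⟩
  rw [integral_add i1 i2, integral_mul_fderiv_eq_neg_fderiv_mul_of_integrable i1 i2 i3
    (fun x _ => hζ.differentiable one_ne_zero x) (fun x _ => hXd x), add_neg_cancel]

/-- The entropy production of fields `φ(m)` with `φₖ' = ∑ⱼ αⱼ γⱼₖ'`, where the fields `γⱼ(m)` are
divergence-free, is the limit of an expression which is cubic in the increments of `m`. -/
theorem tendsto_integral_add_cubic (hu : UniqueDiffOn ℝ (angles J)) (hJ : IsCompact J)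
    (hm : StronglyMeasurable m) (hmJ : ∀ x, m x ∈ J) (hp : 3 < p) {Ω : Opens Plane}
    (hB : HasIncrementBound Ω m p) {φ : Fin 2 → Circle → ℝ} {γ : Fin 2 → Fin 2 → Circle → ℝ}
    (hφ : ∀ k, IsCkOn 1 J (φ k)) (hα : ∀ j, IsCkOn 1 J (α j)) (hγ : ∀ j k, IsCkOn 2 J (γ j k))
    (h : ∀ k, ∀ θ ∈ angles J,
      dTheta J (φ k) θ = ∑ j, α j (Circle.exp θ) * dTheta J (γ j k) θ)
    (hdiv : ∀ j, IsDivFree Ω fun x => WithLp.toLp 2 fun k => γ j k (m x))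
    {ζ : Plane → ℝ} (hζ : ContDiff ℝ 1 ζ) (hs : HasCompactSupport ζ) (hζΩ : tsupport ζ ⊆ Ω) :
    Tendsto (fun ε => ∫ x, ∑ k, (fderiv ℝ ζ x (coordVec k) * φ k (m x) +
      ζ x * ((1 / 2 * ∑ j, dTheta J (α j) (A.ϑ ε x) * dTheta2 J (γ j k) (A.ϑ ε x)) * A.V ε x *
        A.L ε x (coordVec k)))) (𝓝[>] 0) (𝓝 0) := by
  set T : Fin 2 → ℝ → Plane → ℝ := fun k ε x => fderiv ℝ ζ x (coordVec k) * φ k (m x) +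
      ζ x * ((1 / 2 * ∑ j, dTheta J (α j) (A.ϑ ε x) * dTheta2 J (γ j k) (A.ϑ ε x)) * A.V ε x *
        A.L ε x (coordVec k)) with hT
  set X : Fin 2 → ℝ → Plane → ℝ := fun k ε x =>
    A.χ ε x * A.corrected (φ k) α (fun j => γ j k) ε x with hX
  set I : Fin 2 → ℝ → Plane → ℝ := fun k ε x =>
    fderiv ℝ ζ x (coordVec k) * X k ε x + ζ x * fderiv ℝ (X k ε) x (coordVec k) with hI
  -- the contribution of the mollified fields to the difference of `∑ k, T k` and `∑ k, I k`
  set E : ℝ → Plane → ℝ := fun ε x => ∑ k, (fderiv ℝ ζ x (coordVec k) * (φ k (m x) - X k ε x) +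
    (-ζ x) * (A.corrected (φ k) α (fun j => γ j k) ε x * A.dχ ε x (coordVec k) +
      ∑ j, dTheta J (α j) (A.ϑ ε x) * (A.L ε x (coordVec k) *
        (mollify ε (fun y => γ j k (m y)) x - γ j k (Circle.exp (A.ϑ ε x)) -
          1 / 2 * dTheta2 J (γ j k) (A.ϑ ε x) * A.V ε x)))) with hE
  have hζ' := fun k => continuous_fderiv_apply_of_contDiff hζ (coordVec k)
  have hE0 : Tendsto (fun ε => ∫ x, E ε x) (𝓝[>] 0) (𝓝 0) := by
    choose B hB' using fun k => (hζ' k).bounded_above_of_compact_support (hs.fderiv_apply ℝ _)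
    obtain ⟨B', hB''⟩ := hζ.continuous.bounded_above_of_compact_support hs
    have hsm : IsSmall m p E := IsSmall.sum Finset.univ fun k _ =>
      ((A.isSmall_apply_sub_corrected hu hJ hm hmJ hp (hφ k) hα fun j => hγ j k).mul_of_bounded
        (F := fun _ x => fderiv ℝ ζ x (coordVec k)) fun _ _ x => hB' k x).add
      ((A.isSmall_remainder hu hJ hm hmJ hp (hφ k) hα (fun j => hγ j k)
        (norm_coordVec k)).mul_of_bounded (F := fun _ x => -ζ x) (M := B') fun _ _ x => by
          rw [abs_neg]; exact hB'' x)
    refine hsm.tendsto_integral hB hm hp hs hζΩ fun ε x hx => ?_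
    have h1 : ζ x = 0 := image_eq_zero_of_notMem_tsupport hx
    have h2 : fderiv ℝ ζ x = 0 := by
      by_contra hne
      exact hx (support_fderiv_subset ℝ hne)
    simp [hE, h1, h2]
  refine hE0.congr' ?_
  -- at small scales, the mollified fields are divergence-free on the support of `ζ`
  obtain ⟨δ, hδ, hδΩ⟩ := hs.exists_cthickening_subset_open Ω.isOpen hζΩ
  filter_upwards [Ioo_mem_nhdsGT hδ] with ε hε
  have hε0 := hε.1
  have hI0 := fun k => A.integral_mul_corrected_eq_zero hu hJ hm hmJ (hφ k) hα (fun j => hγ j k)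
    (by linarith) (h k) hε0 hζ hs (norm_coordVec k)
  have hTi : ∀ k, Integrable (T k ε) := fun k => by
    obtain ⟨M, -, hM⟩ := exists_bound_of_continuousOn hJ (hφ k).continuousOn
    choose M₁ h₁ hM₁ using fun j =>
      exists_bound_of_periodic hJ periodic_dTheta ((hα j).continuousOn_dTheta hu)
    choose M₂ h₂ hM₂ using fun j =>
      exists_bound_of_periodic hJ periodic_dTheta2 ((hγ j k).continuousOn_dTheta2 hu)
    have i1 : Integrable fun x => fderiv ℝ ζ x (coordVec k) * φ k (m x) :=
      integrable_mul_of_bounded (hζ' k) (hs.fderiv_apply (𝕜 := ℝ) _)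
        (stronglyMeasurable_comp_circle hm hmJ (hφ k).continuousOn).aestronglyMeasurable
        fun x => hM _ (hmJ x)
    refine i1.add (A.integrable_mul_V_mul_L hm hζ.continuous hs hε0 (norm_coordVec k)
      (M := 1 / 2 * ∑ j, M₁ j * M₂ j) ?_ fun x => ?_)
    · refine Measurable.aestronglyMeasurable (Measurable.const_mul
        (Finset.measurable_sum _ fun j _ => Measurable.mul ?_ ?_) _)
      · exact measurable_comp_of_continuousOn ((hα j).continuousOn_dTheta hu)
          (A.measurable_ϑ ε hε0) (A.mem_angles ε)
      · exact measurable_comp_of_continuousOn ((hγ j k).continuousOn_dTheta2 hu)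
          (A.measurable_ϑ ε hε0) (A.mem_angles ε)
    · rw [abs_mul, abs_of_pos one_half_pos]
      gcongr
      refine (Finset.abs_sum_le_sum_abs _ _).trans (Finset.sum_le_sum fun j _ => ?_)
      rw [abs_mul]
      exact mul_le_mul (hM₁ j _ (A.mem_angles ε x)) (hM₂ j _ (A.mem_angles ε x)) (abs_nonneg _)
        (h₁ j)
  have hIT : ∀ x, E ε x = ∑ k, T k ε x - ∑ k, I k ε x := fun x => by
    have hX' := fun k => (A.hasFDerivAt_mul_corrected hu hJ hm hmJ (hφ k) hα (fun j => hγ j k)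
      (h k) hε0 x).fderiv
    by_cases hx : x ∈ tsupport ζ
    · have hball : closedBall x ε ⊆ Ω := (closedBall_subset_closedBall hε.2.le).trans
        ((closedBall_subset_cthickening hx δ).trans hδΩ)
      have hg : ∀ j, ∑ k, fderiv ℝ (mollify ε fun y => γ j k (m y)) x (coordVec k) = 0 :=
        fun j => by
          choose M hM0 hM using fun k => exists_bound_of_continuousOn hJ (hγ j k).continuousOn
          refine (hdiv j).sum_fderiv_mollify_eq_zero (f := fun k y => γ j k (m y))
            (fun k => stronglyMeasurable_comp_circle hm hmJ (hγ j k).continuousOn)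
            (M := ∑ k, M k) (fun k y => (hM k _ (hmJ y)).trans ?_) hε0 hball
          exact Finset.single_le_sum (f := M) (fun i _ => hM0 i) (Finset.mem_univ k)
      have hg0 := hg 0
      have hg1 := hg 1
      simp only [Fin.sum_univ_two] at hg0 hg1
      simp only [hE, hT, hI, hX, hX', add_apply, smul_apply, smul_eq_mul,
        Fin.sum_univ_two]
      linear_combination ζ x * A.χ ε x * α 0 (Circle.exp (A.ϑ ε x)) * hg0 +
        ζ x * A.χ ε x * α 1 (Circle.exp (A.ϑ ε x)) * hg1
    · simp only [hE, hT, hI, image_eq_zero_of_notMem_tsupport hx, Fin.sum_univ_two]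
      ring
  have hIi : Integrable fun x => ∑ k, I k ε x := integrable_finsetSum _ fun k _ => (hI0 k).1
  have hTi' : Integrable fun x => ∑ k, T k ε x := integrable_finsetSum _ fun k _ => hTi k
  simp only [hIT]
  rw [integral_sub hTi' hIi, integral_finsetSum (f := fun k => I k ε) _ fun k _ => (hI0 k).1,
    Finset.sum_eq_zero fun k _ => (hI0 k).2, sub_zero]

end AngularApprox

/-! ### Weak limits of equi-integrable families -/

section Localization

variable {J : Set Circle} {m : Plane → Circle} {p : ℝ}

/-- The mollifications of `g(m)` converge to `g(m)` in `L¹`, with a weight of compact support. -/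
theorem tendsto_integral_abs_sub_mollify (hJ : IsCompact J) (hm : StronglyMeasurable m)
    (hmJ : ∀ x, m x ∈ J) (hp : 3 < p) {Ω : Opens Plane} (hB : HasIncrementBound Ω m p)
    {g : Circle → ℝ} (hg : ContinuousOn g J) {ζ : Plane → ℝ} (hζ : Continuous ζ)
    (hs : HasCompactSupport ζ) (hζΩ : tsupport ζ ⊆ Ω) :
    Tendsto (fun δ => ∫ x, |ζ x| * |g (m x) - mollify δ (fun y => g (m y)) x|) (𝓝[>] 0)
      (𝓝 0) := by
  obtain ⟨M, hM⟩ := hζ.bounded_above_of_compact_support hs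
  obtain ⟨Mg, -, hMg⟩ := exists_bound_of_continuousOn hJ hg
  have hgm := stronglyMeasurable_comp_circle hm hmJ hg
  have h1 : IsSmall m p fun δ x => g (m x) - mollify δ (fun y => g (m y)) x := by
    refine isSmall_of_modulus hm (by linarith) fun η hη => ?_
    obtain ⟨C, hC, h⟩ := exists_modulus hJ hg (div_pos hη kernelConst_pos)
    refine ⟨kernelConst * C, mul_nonneg kernelConst_pos.le hC, fun δ hδ x => ?_⟩
    have hi := (integrableOn_incr_rpow hm δ zero_le_one x).const_mul C
    have h2 := norm_integral_kernel_smul_le (g := fun y => g (m (x - δ • y)) - g (m x))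
      (b := fun y => η / kernelConst + C * incr m δ x y ^ (1 : ℝ))
      ((integrableOn_const_ball _).add hi) fun y _ => by
        rw [Real.rpow_one]
        exact h _ (hmJ _) _ (hmJ x)
    rw [average_add (integrableOn_const_ball _) hi, average_const_ball, average_const_mul,
      mul_add, mul_div_cancel₀ _ kernelConst_pos.ne'] at h2
    rw [abs_sub_comm, mollify_sub_const (f := fun y => g (m y)) hgm (fun y => hMg _ (hmJ y)),
      mul_assoc]
    exact h2
  refine ((h1.of_le (M := 1) (E' := fun δ x => |g (m x) - mollify δ (fun y => g (m y)) x|)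
    fun _ _ _ _ => by rw [abs_abs, one_mul]).mul_of_bounded (F := fun _ x => |ζ x|) (M := M)
      fun _ _ x => by rw [abs_abs]; exact hM x).tendsto_integral hB hm hp hs hζΩ fun δ x hx => ?_
  rw [image_eq_zero_of_notMem_tsupport hx, abs_zero, zero_mul]

/-- If a family with cubic bounds tends to zero weakly, it does so against functions of `m`. -/
theorem tendsto_integral_comp_mul (hJ : IsCompact J) (hm : StronglyMeasurable m)
    (hmJ : ∀ x, m x ∈ J) (hp : 3 < p) {Ω : Opens Plane} (hB : HasIncrementBound Ω m p)
    {W : ℝ → Plane → ℝ} (hW : ∀ ε, 0 < ε → AEStronglyMeasurable (W ε)) {B : ℝ} (hB0 : 0 ≤ B)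
    (hWB : ∀ ε, 0 < ε → ∀ x, |W ε x| ≤ B * (ε⁻¹ * osc m ε 3 x))
    (hlim : ∀ ζ : Plane → ℝ, ContDiff ℝ 1 ζ → HasCompactSupport ζ → tsupport ζ ⊆ Ω →
      Tendsto (fun ε => ∫ x, ζ x * W ε x) (𝓝[>] 0) (𝓝 0))
    {g : Circle → ℝ} (hg : ContinuousOn g J) {ζ : Plane → ℝ} (hζ : ContDiff ℝ 1 ζ)
    (hs : HasCompactSupport ζ) (hζΩ : tsupport ζ ⊆ Ω) :
    Tendsto (fun ε => ∫ x, ζ x * (g (m x) * W ε x)) (𝓝[>] 0) (𝓝 0) := by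
  obtain ⟨M, hM⟩ := hζ.continuous.bounded_above_of_compact_support hs
  obtain ⟨Mg, hMg0, hMg⟩ := exists_bound_of_continuousOn hJ hg
  have hgm := stronglyMeasurable_comp_circle hm hmJ hg
  have hM0 : 0 ≤ M := (norm_nonneg _).trans (hM 0)
  obtain ⟨C, hC, r, hr, hosc⟩ := hB.integral_osc_le hm (by linarith) hs hζΩ
  rw [Metric.tendsto_nhds]
  intro η hη
  -- large values of `ε⁻¹ * osc m ε 3` contribute little, by the bound in `L^p` with `p > 3`
  obtain ⟨N, hN0, hN⟩ : ∃ N : ℝ, 0 < N ∧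
      M * (2 * Mg) * B * N ^ (1 - p / 3) * C < η / 3 := by
    have h1 := (tendsto_rpow_neg_atTop (show 0 < p / 3 - 1 by linarith)).const_mul
      (M * (2 * Mg) * B * C)
    rw [mul_zero] at h1
    obtain ⟨N, h2, h3⟩ := ((h1.eventually_lt_const (show 0 < η / 3 by positivity)).and
      (eventually_gt_atTop 0)).exists
    refine ⟨N, h3, lt_of_eq_of_lt ?_ h2⟩
    rw [show -(p / 3 - 1) = 1 - p / 3 by ring]
    ring
  obtain ⟨δ, hδ, hδ0⟩ : ∃ δ : ℝ,
      B * N * ∫ x, |ζ x| * |g (m x) - mollify δ (fun y => g (m y)) x| < η / 3 ∧ 0 < δ := by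
    have h1 := (tendsto_integral_abs_sub_mollify hJ hm hmJ hp hB hg hζ.continuous hs
      hζΩ).const_mul (B * N)
    rw [mul_zero] at h1
    exact ((h1.eventually_lt_const (show 0 < η / 3 by positivity)).and
      self_mem_nhdsWithin).exists
  set ψ := mollify δ fun y => g (m y) with hψ
  have hψd : ContDiff ℝ 1 ψ := contDiff_mollify hδ0 hgm (fun y => hMg _ (hmJ y)) (n := 1)
  have hψM : ∀ x, |ψ x| ≤ Mg :=
    fun x => norm_mollify_le (f := fun y => g (m y)) (fun y => hMg _ (hmJ y)) δ x
  have h1 := hlim (fun x => ζ x * ψ x) (hζ.mul hψd) hs.mul_right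
    ((tsupport_mul_subset_left (f := ζ) (g := ψ)).trans hζΩ)
  filter_upwards [(Metric.tendsto_nhds.1 h1) (η / 3) (by positivity), Ioo_mem_nhdsGT hr]
    with ε h2 hε
  have hε0 := hε.1
  rw [dist_zero_right] at h2 ⊢
  have hWbd : ∀ x, |W ε x| ≤ B * (ε⁻¹ * 2 ^ (3 : ℝ)) := fun x => (hWB ε hε0 x).trans (by
    gcongr
    exact osc_le hm ε (by norm_num) x)
  have i1 : Integrable fun x => ζ x * ψ x * W ε x :=
    integrable_mul_of_bounded (hζ.continuous.mul hψd.continuous) hs.mul_right (hW ε hε0) hWbd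
  have hd : ∀ x, |g (m x) - ψ x| ≤ 2 * Mg := fun x =>
    (abs_sub _ _).trans (by linarith [hMg _ (hmJ x), hψM x])
  have i2 : Integrable fun x => ζ x * ((g (m x) - ψ x) * W ε x) := by
    refine integrable_mul_of_bounded hζ.continuous hs
      ((hgm.aestronglyMeasurable.sub hψd.continuous.aestronglyMeasurable).mul (hW ε hε0))
      (M := 2 * Mg * (B * (ε⁻¹ * 2 ^ (3 : ℝ)))) fun x => ?_
    rw [abs_mul]
    exact mul_le_mul (hd x) (hWbd x) (abs_nonneg _) (by positivity)
  have i3 : Integrable fun x => |ζ x| * |g (m x) - ψ x| := by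
    refine integrable_mul_of_bounded hζ.continuous.abs (hs.comp_left abs_zero)
      (hgm.aestronglyMeasurable.sub hψd.continuous.aestronglyMeasurable).norm
      (M := 2 * Mg) fun x => ?_
    rw [abs_abs]
    exact hd x
  have h3 : ∫ x, ζ x * (g (m x) * W ε x) =
      (∫ x, ζ x * ψ x * W ε x) + ∫ x, ζ x * ((g (m x) - ψ x) * W ε x) := by
    rw [← integral_add i1 i2]
    congr 1
    ext x
    ring
  have hi := integrableOn_osc hm (by linarith : 0 ≤ p) ε hs.isCompact
  have h4 : ‖∫ x, ζ x * ((g (m x) - ψ x) * W ε x)‖ ≤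
      ∫ x in tsupport ζ, (B * N * (|ζ x| * |g (m x) - ψ x|) +
        M * (2 * Mg) * B * N ^ (1 - p / 3) * ε ^ (-(p / 3)) * osc m ε p x) := by
    rw [← setIntegral_eq_integral_of_forall_compl_eq_zero (s := tsupport ζ) fun x hx => by
      rw [image_eq_zero_of_notMem_tsupport hx, zero_mul]]
    refine norm_integral_le_of_norm_le ((i3.integrableOn.const_mul _).add (hi.const_mul _))
      (Eventually.of_forall fun x => ?_)
    have e1 := osc_three_le hm hp hε0 hN0 x
    have e2 := osc_nonneg (m := m) ε p x
    rw [Real.norm_eq_abs, abs_mul, abs_mul]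
    calc |ζ x| * (|g (m x) - ψ x| * |W ε x|)
        ≤ |ζ x| * (|g (m x) - ψ x| * (B * (N + N ^ (1 - p / 3) *
            (ε ^ (-(p / 3)) * osc m ε p x)))) := by
          gcongr
          exact (hWB ε hε0 x).trans (by gcongr)
      _ = B * N * (|ζ x| * |g (m x) - ψ x|) + |ζ x| * |g (m x) - ψ x| * B * N ^ (1 - p / 3) *
            ε ^ (-(p / 3)) * osc m ε p x := by ring
      _ ≤ _ := by
          gcongr
          exacts [hM x, hd x]
  have h5 : ∫ x in tsupport ζ, |ζ x| * |g (m x) - ψ x| = ∫ x, |ζ x| * |g (m x) - ψ x| :=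
    setIntegral_eq_integral_of_forall_compl_eq_zero fun x hx => by
      rw [image_eq_zero_of_notMem_tsupport hx, abs_zero, zero_mul]
  rw [integral_add (i3.integrableOn.const_mul _) (hi.const_mul _), integral_const_mul,
    integral_const_mul, h5] at h4
  have h6 : M * (2 * Mg) * B * N ^ (1 - p / 3) * ε ^ (-(p / 3)) * ∫ x in tsupport ζ, osc m ε p x ≤
      M * (2 * Mg) * B * N ^ (1 - p / 3) * C := by
    calc _ ≤ M * (2 * Mg) * B * N ^ (1 - p / 3) * ε ^ (-(p / 3)) * (C * ε ^ (p / 3)) := by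
          gcongr
          exact hosc ε hε0 hε.2
      _ = M * (2 * Mg) * B * N ^ (1 - p / 3) * C * (ε ^ (-(p / 3)) * ε ^ (p / 3)) := by ring
      _ = _ := by rw [← Real.rpow_add hε0]; simp
  rw [h3]
  refine (norm_add_le _ _).trans_lt ?_
  linarith

end Localization

/-! ### The derivative as a function on the circle -/

section CircleDerivative

variable {J : Set Circle} {f : Circle → ℝ}

/-- The derivative `∂_θ f` as a function on the circle. -/
noncomputable def circleDeriv (J : Set Circle) (f : Circle → ℝ) (z : Circle) : ℝ :=
  dTheta J f (Complex.arg z)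

theorem circleDeriv_exp (θ : ℝ) : circleDeriv J f (Circle.exp θ) = dTheta J f θ :=
  apply_arg_exp periodic_dTheta θ

theorem IsCkOn.circleDeriv (hu : UniqueDiffOn ℝ (angles J)) (hf : IsCkOn 2 J f) :
    IsCkOn 1 J (circleDeriv J f) := by
  simp only [IsCkOn, circleDeriv_exp]
  exact hf.contDiffOn_dTheta hu (k := 1)

theorem dTheta_circleDeriv (θ : ℝ) : dTheta J (circleDeriv J f) θ = dTheta2 J f θ := by
  simp only [dTheta2]
  rw [dTheta]
  simp only [circleDeriv_exp]

theorem dTheta_neg (θ : ℝ) : dTheta J (fun z => -f z) θ = -dTheta J f θ :=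
  derivWithin.fun_neg

end CircleDerivative

/-! ### Vanishing of the entropy production -/

section Vanishing

variable {J : Set Circle} {m : Plane → Circle} {p : ℝ}
  {γ : Fin 2 → Fin 2 → Circle → ℝ} {Ω : Opens Plane} {ζ : Plane → ℝ}

namespace AngularApprox

/-- The rows of the adjugate of `∂_θ γ` are admissible coefficients for the zero entropy, because
`∂_θ γ` is singular; the corresponding cubic expressions carry the factor `det (∂_θ² γ)`. -/
theorem tendsto_integral_det (A : AngularApprox J m p)
    (hu : UniqueDiffOn ℝ (angles J)) (hJ : IsCompact J)
    (hm : StronglyMeasurable m) (hmJ : ∀ x, m x ∈ J) (hp : 3 < p)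
    (hB : HasIncrementBound Ω m p) (hγ : ∀ j k, IsCkOn 2 J (γ j k))
    (hdet : ∀ θ ∈ angles J, dTheta J (γ 0 0) θ * dTheta J (γ 1 1) θ -
      dTheta J (γ 0 1) θ * dTheta J (γ 1 0) θ = 0)
    (hdiv : ∀ j, IsDivFree Ω fun x => WithLp.toLp 2 fun k => γ j k (m x))
    (hζ : ContDiff ℝ 1 ζ) (hs : HasCompactSupport ζ) (hζΩ : tsupport ζ ⊆ Ω) (l : Fin 2) :
    Tendsto (fun ε => ∫ x, ζ x * ((dTheta2 J (γ 0 0) (A.ϑ ε x) * dTheta2 J (γ 1 1) (A.ϑ ε x) -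
      dTheta2 J (γ 0 1) (A.ϑ ε x) * dTheta2 J (γ 1 0) (A.ϑ ε x)) * A.V ε x *
        A.L ε x (coordVec l))) (𝓝[>] 0) (𝓝 0) := by
  have h0 : IsCkOn 1 J fun _ => (0 : ℝ) := contDiffOn_const
  have h0' : ∀ θ, dTheta J (fun _ => (0 : ℝ)) θ = 0 := fun θ => by simp [dTheta]
  have key : ∀ α : Fin 2 → Circle → ℝ, (∀ j, IsCkOn 1 J (α j)) →
      (∀ k, ∀ θ ∈ angles J, ∑ j, α j (Circle.exp θ) * dTheta J (γ j k) θ = 0) →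
      Tendsto (fun ε => ∫ x, ∑ k, (ζ x * ((∑ j, dTheta J (α j) (A.ϑ ε x) *
        dTheta2 J (γ j k) (A.ϑ ε x)) * A.V ε x * A.L ε x (coordVec k)))) (𝓝[>] 0) (𝓝 0) := by
    intro α hα hα0
    have h1 := (A.tendsto_integral_add_cubic hu hJ hm hmJ hp hB (φ := fun _ _ => 0)
      (fun _ => h0) hα hγ (fun k θ hθ => by rw [h0', hα0 k θ hθ]) hdiv hζ hs hζΩ).const_mul 2
    rw [mul_zero] at h1
    refine h1.congr fun ε => ?_
    rw [← integral_const_mul]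
    congr 1
    ext x
    simp only [Fin.sum_univ_two]
    ring
  have hd := fun j k => (hγ j k).circleDeriv hu
  fin_cases l
  · refine (key ![circleDeriv J (γ 1 1), fun z => -circleDeriv J (γ 0 1) z] (fun j => ?_)
      fun k θ hθ => ?_).congr fun ε => ?_
    · fin_cases j
      exacts [hd 1 1, ContDiffOn.neg (hd 0 1)]
    · have := hdet θ hθ
      fin_cases k <;> simp [Fin.sum_univ_two, circleDeriv_exp] <;> linarith
    · congr 1
      ext x
      simp only [Fin.sum_univ_two, Matrix.cons_val_zero, Matrix.cons_val_one, dTheta_neg,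
        dTheta_circleDeriv, Fin.zero_eta]
      ring
  · refine (key ![fun z => -circleDeriv J (γ 1 0) z, circleDeriv J (γ 0 0)] (fun j => ?_)
      fun k θ hθ => ?_).congr fun ε => ?_
    · fin_cases j
      exacts [ContDiffOn.neg (hd 1 0), hd 0 0]
    · have := hdet θ hθ
      fin_cases k <;> simp [Fin.sum_univ_two, circleDeriv_exp] <;> linarith
    · congr 1
      ext x
      simp only [Fin.sum_univ_two, Matrix.cons_val_zero, Matrix.cons_val_one, dTheta_neg,
        dTheta_circleDeriv, Fin.mk_one]
      ring

/-- The cubic quantity `V L` tends to zero weakly, with any continuous weight. -/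
theorem tendsto_integral_V_mul_L (A : AngularApprox J m p)
    (hu : UniqueDiffOn ℝ (angles J)) (hJ : IsCompact J)
    (hm : StronglyMeasurable m) (hmJ : ∀ x, m x ∈ J) (hp : 3 < p)
    (hB : HasIncrementBound Ω m p) (hγ : ∀ j k, IsCkOn 2 J (γ j k))
    (hdet : ∀ θ ∈ angles J, dTheta J (γ 0 0) θ * dTheta J (γ 1 1) θ -
      dTheta J (γ 0 1) θ * dTheta J (γ 1 0) θ = 0)
    (hdet2 : ∀ θ ∈ angles J, dTheta2 J (γ 0 0) θ * dTheta2 J (γ 1 1) θ -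
      dTheta2 J (γ 0 1) θ * dTheta2 J (γ 1 0) θ ≠ 0)
    (hdiv : ∀ j, IsDivFree Ω fun x => WithLp.toLp 2 fun k => γ j k (m x))
    (hζ : ContDiff ℝ 1 ζ) (hs : HasCompactSupport ζ) (hζΩ : tsupport ζ ⊆ Ω) (l : Fin 2)
    {f : Circle → ℝ} (hf : ContinuousOn f J) :
    Tendsto (fun ε => ∫ x, ζ x * (f (Circle.exp (A.ϑ ε x)) * A.V ε x * A.L ε x (coordVec l)))
      (𝓝[>] 0) (𝓝 0) := by
  set D : ℝ → ℝ := fun θ => dTheta2 J (γ 0 0) θ * dTheta2 J (γ 1 1) θ -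
      dTheta2 J (γ 0 1) θ * dTheta2 J (γ 1 0) θ with hD
  have hc := fun j k => (hγ j k).continuousOn_dTheta2 hu
  have hDc : ContinuousOn D (angles J) :=
    ((hc 0 0).mul (hc 1 1)).sub ((hc 0 1).mul (hc 1 0))
  have hDp : Function.Periodic D (2 * Real.pi) := fun θ => by
    simp only [hD, periodic_dTheta2 θ]
  obtain ⟨M, hM0, hM⟩ := exists_bound_of_periodic hJ hDp hDc
  set g : Circle → ℝ := fun z => f z / D (Complex.arg z) with hg
  have hgc : ContinuousOn g J := hf.div (continuousOn_comp_arg hDp hDc) fun z hz =>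
    hdet2 _ (arg_mem_angles hz)
  have hfg : ∀ θ ∈ angles J, f (Circle.exp θ) = g (Circle.exp θ) * D θ := fun θ hθ => by
    simp only [hg]
    rw [apply_arg_exp hDp, div_mul_cancel₀ _ (hdet2 θ hθ)]
  obtain ⟨Mg, hMg0, hMg⟩ := exists_bound_of_continuousOn hJ hgc
  set W : ℝ → Plane → ℝ := fun ε x => D (A.ϑ ε x) * A.V ε x * A.L ε x (coordVec l) with hW
  have hC := A.C_nonneg
  have hDm : ∀ ε, 0 < ε → Measurable fun x => D (A.ϑ ε x) := fun ε hε =>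
    measurable_comp_of_continuousOn hDc (A.measurable_ϑ ε hε) (A.mem_angles ε)
  have hWm : ∀ ε, 0 < ε → AEStronglyMeasurable (W ε) := fun ε hε =>
    (((hDm ε hε).mul (A.measurable_V ε hε)).mul
      (A.measurable_L ε hε (coordVec l))).aestronglyMeasurable
  have hWb : ∀ ε, 0 < ε → ∀ x, |W ε x| ≤
      M * A.C * A.C * (ε⁻¹ * osc m ε 1 x * osc m ε 2 x) := fun ε hε x => by
    have h1 := osc_nonneg (m := m) ε 1 x
    have h2 := osc_nonneg (m := m) ε 2 x
    rw [hW, abs_mul, abs_mul]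
    calc _ ≤ M * (A.C * osc m ε 2 x) * (A.C * (ε⁻¹ * osc m ε 1 x)) := by
          gcongr
          exacts [hM _ (A.mem_angles ε x), A.abs_V_le ε hε x,
            A.abs_L_apply_le hε x (norm_coordVec l)]
      _ = _ := by ring
  have hWb' : ∀ ε, 0 < ε → ∀ x, |W ε x| ≤ M * A.C * A.C * 2 * (ε⁻¹ * osc m ε 3 x) :=
    fun ε hε x => (hWb ε hε x).trans (by
      have := osc_one_mul_osc_two_le hm ε x
      calc _ = M * A.C * A.C * ε⁻¹ * (osc m ε 1 x * osc m ε 2 x) := by ring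
        _ ≤ M * A.C * A.C * ε⁻¹ * (2 * osc m ε 3 x) := by gcongr
        _ = _ := by ring)
  have h1 := tendsto_integral_comp_mul hJ hm hmJ hp hB hWm (by positivity) hWb'
    (fun ζ hζ hs hζΩ => A.tendsto_integral_det hu hJ hm hmJ hp hB hγ hdet hdiv hζ hs hζΩ l)
    hgc hζ hs hζΩ
  obtain ⟨Mζ, hMζ⟩ := hζ.continuous.bounded_above_of_compact_support hs
  have h2 : IsSmall m p fun ε x => (g (m x) - g (Circle.exp (A.ϑ ε x))) * W ε x := by
    refine isSmall_cubic hm hp fun η hη => ?_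
    set c := M * A.C * A.C with hc'
    have hc0 : 0 ≤ c := by positivity
    set η' := η / (2 * (c + 1)) with hη'
    have hη'0 : 0 < η' := by positivity
    obtain ⟨C₁, hC₁, h⟩ := A.exists_modulus_apply_sub hJ hmJ hgc η' hη'0
    set s := η' / (C₁ + 1) with hs'
    have hs0 : 0 < s := by positivity
    refine ⟨c * (C₁ * 2 ^ (1 : ℝ) * 2 ^ (2 : ℝ) * (s ^ p)⁻¹), by positivity,
      fun ε hε _ x => ?_⟩
    have o1 := osc_nonneg (m := m) ε 1 x
    have o2 := osc_nonneg (m := m) ε 2 x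
    have op := osc_nonneg (m := m) ε p x
    -- where `osc m ε 1 x` is not small, it is at most a multiple of its `p`-th power
    have h5 : C₁ * osc m ε 1 x * osc m ε 2 x ≤
        η' * osc m ε 2 x + C₁ * 2 ^ (1 : ℝ) * 2 ^ (2 : ℝ) * (s ^ p)⁻¹ * osc m ε p x := by
      rcases le_total (osc m ε 1 x) s with hle | hle
      · have h6 : C₁ * osc m ε 1 x ≤ η' := by
          calc _ ≤ (C₁ + 1) * s := by gcongr; linarith
            _ = η' := by rw [hs']; field_simp
        have : 0 ≤ C₁ * 2 ^ (1 : ℝ) * 2 ^ (2 : ℝ) * (s ^ p)⁻¹ * osc m ε p x := by positivity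
        nlinarith
      · have h6 : s ^ p ≤ osc m ε p x :=
          (Real.rpow_le_rpow hs0.le hle (by linarith)).trans
            (osc_one_rpow_le hm ε (by linarith) x)
        have h7 : 1 ≤ (s ^ p)⁻¹ * osc m ε p x := by
          rw [inv_mul_eq_div]
          exact (one_le_div (by positivity)).2 h6
        have h8 : C₁ * osc m ε 1 x * osc m ε 2 x ≤ C₁ * 2 ^ (1 : ℝ) * 2 ^ (2 : ℝ) := by
          gcongr
          exacts [osc_le hm ε zero_le_one x, osc_le hm ε zero_le_two x]
        have h9 : C₁ * 2 ^ (1 : ℝ) * 2 ^ (2 : ℝ) ≤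
            C₁ * 2 ^ (1 : ℝ) * 2 ^ (2 : ℝ) * ((s ^ p)⁻¹ * osc m ε p x) :=
          le_mul_of_one_le_right (by positivity) h7
        have : 0 ≤ η' * osc m ε 2 x := by positivity
        linarith
    have h6 : c * (2 * η') ≤ η := by
      rw [hη', show c * (2 * (η / (2 * (c + 1)))) = c * η / (c + 1) by field_simp,
        div_le_iff₀ (by positivity)]
      nlinarith
    rw [abs_mul]
    calc _ ≤ (η' + C₁ * osc m ε 1 x) * (c * (ε⁻¹ * osc m ε 1 x * osc m ε 2 x)) :=
          mul_le_mul (h ε hε x) (hWb ε hε x) (abs_nonneg _) (by positivity)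
      _ = c * (ε⁻¹ * osc m ε 1 x) * (η' * osc m ε 2 x + C₁ * osc m ε 1 x * osc m ε 2 x) := by
          ring
      _ ≤ c * (ε⁻¹ * osc m ε 1 x) * (η' * osc m ε 2 x + (η' * osc m ε 2 x +
            C₁ * 2 ^ (1 : ℝ) * 2 ^ (2 : ℝ) * (s ^ p)⁻¹ * osc m ε p x)) := by gcongr
      _ = ε⁻¹ * osc m ε 1 x * (c * (2 * η') * osc m ε 2 x +
            c * (C₁ * 2 ^ (1 : ℝ) * 2 ^ (2 : ℝ) * (s ^ p)⁻¹) * osc m ε p x) := by ring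
      _ ≤ _ := by gcongr
  have h3 := (h2.mul_of_bounded (F := fun _ x => ζ x) fun _ _ x => hMζ x).tendsto_integral hB hm
    hp hs hζΩ fun ε x hx => by rw [image_eq_zero_of_notMem_tsupport hx, zero_mul]
  have h4 := h1.sub h3
  rw [sub_zero] at h4
  refine h4.congr' ?_
  filter_upwards [self_mem_nhdsWithin] with ε hε
  have hgP : Measurable fun x => g (Circle.exp (A.ϑ ε x)) :=
    measurable_comp_of_continuousOn (hgc.comp (by fun_prop) fun θ hθ => hθ)
      (A.measurable_ϑ ε hε) (A.mem_angles ε)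
  have i1 : ∀ u : Plane → ℝ, AEStronglyMeasurable u → (∀ x, |u x| ≤ Mg) →
      Integrable fun x => ζ x * (u x * W ε x) := fun u hu hb => by
    have := A.integrable_mul_V_mul_L hm hζ.continuous hs hε (norm_coordVec l)
      (hu.mul (hDm ε hε).aestronglyMeasurable) (M := Mg * M) fun x => by
        simp only [Pi.mul_apply]
        rw [abs_mul]
        exact mul_le_mul (hb x) (hM _ (A.mem_angles ε x)) (abs_nonneg _) hMg0
    refine this.congr (Eventually.of_forall fun x => ?_)
    simp only [hW, Pi.mul_apply]
    ring
  have i2 := i1 _ (stronglyMeasurable_comp_circle hm hmJ hgc).aestronglyMeasurable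
    fun x => hMg _ (hmJ x)
  have i3 := i1 _ hgP.aestronglyMeasurable fun x => hMg _ (A.exp_mem ε x)
  have i4 : Integrable fun x => ζ x * ((g (m x) - g (Circle.exp (A.ϑ ε x))) * W ε x) :=
    (i2.sub i3).congr (Eventually.of_forall fun x => by simp only [Pi.sub_apply]; ring)
  rw [← integral_sub i2 i4]
  congr 1
  ext x
  rw [hfg _ (A.mem_angles ε x)]
  simp only [hW]
  ring

/-- The entropy production of `φ(m)` vanishes, if `φₖ' = ∑ⱼ αⱼ γⱼₖ'`. -/
theorem integral_sum_fderiv_mul_eq_zero (A : AngularApprox J m p)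
    (hu : UniqueDiffOn ℝ (angles J)) (hJ : IsCompact J)
    (hm : StronglyMeasurable m) (hmJ : ∀ x, m x ∈ J) (hp : 3 < p)
    (hB : HasIncrementBound Ω m p) (hγ : ∀ j k, IsCkOn 2 J (γ j k))
    (hdet : ∀ θ ∈ angles J, dTheta J (γ 0 0) θ * dTheta J (γ 1 1) θ -
      dTheta J (γ 0 1) θ * dTheta J (γ 1 0) θ = 0)
    (hdet2 : ∀ θ ∈ angles J, dTheta2 J (γ 0 0) θ * dTheta2 J (γ 1 1) θ -
      dTheta2 J (γ 0 1) θ * dTheta2 J (γ 1 0) θ ≠ 0)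
    (hdiv : ∀ j, IsDivFree Ω fun x => WithLp.toLp 2 fun k => γ j k (m x))
    {φ : Fin 2 → Circle → ℝ} {α : Fin 2 → Circle → ℝ} (hφ : ∀ k, IsCkOn 1 J (φ k))
    (hα : ∀ j, IsCkOn 1 J (α j))
    (h : ∀ k, ∀ θ ∈ angles J,
      dTheta J (φ k) θ = ∑ j, α j (Circle.exp θ) * dTheta J (γ j k) θ)
    (hζ : ContDiff ℝ 1 ζ) (hs : HasCompactSupport ζ) (hζΩ : tsupport ζ ⊆ Ω) :
    ∫ x, ∑ k, fderiv ℝ ζ x (coordVec k) * φ k (m x) = 0 := by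
  set H : Fin 2 → Circle → ℝ := fun k z => 1 / 2 * ∑ j, dTheta J (α j) (Complex.arg z) *
    dTheta2 J (γ j k) (Complex.arg z) with hH
  have hHc : ∀ k, ContinuousOn (H k) J := fun k =>
    (continuousOn_finsetSum _ fun j _ =>
      (continuousOn_comp_arg periodic_dTheta ((hα j).continuousOn_dTheta hu)).mul
        (continuousOn_comp_arg periodic_dTheta2 ((hγ j k).continuousOn_dTheta2 hu))).const_mul _
  have hHe : ∀ k θ, H k (Circle.exp θ) =
      1 / 2 * ∑ j, dTheta J (α j) θ * dTheta2 J (γ j k) θ := fun k θ => by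
    simp only [hH]
    congr 1
    exact Finset.sum_congr rfl fun j _ => by
      rw [apply_arg_exp periodic_dTheta, apply_arg_exp periodic_dTheta2]
  have h1 := A.tendsto_integral_add_cubic hu hJ hm hmJ hp hB hφ hα hγ h hdiv hζ hs hζΩ
  have h2 := tendsto_finsetSum Finset.univ fun k _ => A.tendsto_integral_V_mul_L hu hJ hm hmJ hp
    hB hγ hdet hdet2 hdiv hζ hs hζΩ k (hHc k)
  have h3 := h1.sub h2
  simp only [Finset.sum_const_zero, sub_zero] at h3
  refine tendsto_nhds_unique (tendsto_const_nhds.congr' ?_) h3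
  filter_upwards [self_mem_nhdsWithin] with ε hε
  have i1 : ∀ k, Integrable fun x => fderiv ℝ ζ x (coordVec k) * φ k (m x) := fun k => by
    obtain ⟨M, -, hM⟩ := exists_bound_of_continuousOn hJ (hφ k).continuousOn
    exact integrable_mul_of_bounded (continuous_fderiv_apply_of_contDiff hζ _)
      (hs.fderiv_apply (𝕜 := ℝ) _)
      (stronglyMeasurable_comp_circle hm hmJ (hφ k).continuousOn).aestronglyMeasurable
      fun x => hM _ (hmJ x)
  have i2 : ∀ k, Integrable fun x =>
      ζ x * (H k (Circle.exp (A.ϑ ε x)) * A.V ε x * A.L ε x (coordVec k)) := fun k => by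
    obtain ⟨M, -, hM⟩ := exists_bound_of_continuousOn hJ (hHc k)
    exact A.integrable_mul_V_mul_L hm hζ.continuous hs hε (norm_coordVec k)
      (measurable_comp_of_continuousOn ((hHc k).comp (by fun_prop) fun θ hθ => hθ)
        (A.measurable_ϑ ε hε) (A.mem_angles ε)).aestronglyMeasurable
      fun x => hM _ (A.exp_mem ε x)
  simp only [← hHe]
  have i3 : ∀ k, Integrable fun x => fderiv ℝ ζ x (coordVec k) * φ k (m x) +
      ζ x * (H k (Circle.exp (A.ϑ ε x)) * A.V ε x * A.L ε x (coordVec k)) :=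
    fun k => (i1 k).add (i2 k)
  rw [integral_finsetSum _ fun k _ => i1 k, integral_finsetSum _ fun k _ => i3 k,
    ← Finset.sum_sub_distrib]
  exact Finset.sum_congr rfl fun k _ => by rw [integral_add (i1 k) (i2 k), add_sub_cancel_right]

end AngularApprox

end Vanishing

/-! ### Linear images and components -/

section LinearImages

variable {J : Set Circle} {E F : Type*} [NormedAddCommGroup E] [NormedSpace ℝ E]
  [NormedAddCommGroup F] [NormedSpace ℝ F] {f : Circle → E}

theorem IsCkOn.clm_comp {k : ℕ} (hf : IsCkOn k J f) (L : E →L[ℝ] F) :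
    IsCkOn k J fun z => L (f z) :=
  L.contDiff.comp_contDiffOn hf

theorem IsCkOn.dTheta_clm (hu : UniqueDiffOn ℝ (angles J)) (hf : IsCkOn 1 J f) (L : E →L[ℝ] F)
    {θ : ℝ} (hθ : θ ∈ angles J) : dTheta J (fun z => L (f z)) θ = L (dTheta J f θ) :=
  dTheta_eq_of_hasDerivWithinAt hu hθ
    (L.hasFDerivAt.comp_hasDerivWithinAt θ (hf.hasDerivWithinAt one_ne_zero hθ))

theorem IsCkOn.dTheta2_clm (hu : UniqueDiffOn ℝ (angles J)) (hf : IsCkOn 2 J f) (L : E →L[ℝ] F)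
    {θ : ℝ} (hθ : θ ∈ angles J) : dTheta2 J (fun z => L (f z)) θ = L (dTheta2 J f θ) := by
  have h1 : ∀ t ∈ angles J, dTheta J (fun z => L (f z)) t = L (dTheta J f t) := fun t ht =>
    (hf.of_le one_le_two).dTheta_clm hu L ht
  rw [dTheta2, derivWithin_congr h1 (h1 θ hθ)]
  exact (L.hasFDerivAt.comp_hasDerivWithinAt θ
    (hf.hasDerivWithinAt_dTheta hu hθ)).derivWithin (hu θ hθ)

/-- A map with nonvanishing derivative rules out isolated angles, where `derivWithin` would be zero;
thus `J` is not a single point. -/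
theorem uniqueDiffOn_angles (h : ∀ θ ∈ angles J, dTheta J f θ ≠ 0) :
    UniqueDiffOn ℝ (angles J) := fun θ hθ => by
  by_contra hcon
  exact h θ hθ (derivWithin_zero_of_not_uniqueDiffWithinAt hcon)

/-- The entries of a matrix, as continuous linear functionals. -/
noncomputable def entryCLM (j k : Fin 2) : Matrix (Fin 2) (Fin 2) ℝ →L[ℝ] ℝ :=
  LinearMap.toContinuousLinearMap (Matrix.entryLinearMap ℝ ℝ j k)

theorem isCkOn_row {n : ℕ} {Γ : Circle → Matrix (Fin 2) (Fin 2) ℝ} (hΓ : IsCkOn n J Γ)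
    (j : Fin 2) : IsCkOn n J (row Γ j) :=
  contDiffOn_euclidean.2 fun k => hΓ.clm_comp (entryCLM j k)

theorem dTheta_apply (hu : UniqueDiffOn ℝ (angles J)) {Φ : Circle → Plane} (hΦ : IsCkOn 1 J Φ)
    (k : Fin 2) {θ : ℝ} (hθ : θ ∈ angles J) : dTheta J (fun z => Φ z k) θ = dTheta J Φ θ k :=
  hΦ.dTheta_clm hu (EuclideanSpace.proj k) hθ

end LinearImages

/-! ### Representatives and the Besov bound -/

section Representatives

variable {J : Set Circle} {Ω : Opens Plane} {m : Plane → Circle}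

theorem IsDivFree.congr_ae {F G : Plane → Plane} (hF : IsDivFree Ω F)
    (h : F =ᵐ[volume.restrict (Ω : Set Plane)] G) : IsDivFree Ω G := by
  refine ⟨fun x hx => ?_, fun ζ => ?_⟩
  · obtain ⟨t, ht, hi⟩ := hF.1 x hx
    exact ⟨t ∩ Ω, inter_mem ht self_mem_nhdsWithin,
      (hi.mono_set Set.inter_subset_left).congr_fun_ae
        (ae_restrict_of_ae_restrict_of_subset Set.inter_subset_right h)⟩
  · rw [← hF.2 ζ]
    refine integral_congr_ae ?_
    filter_upwards [h] with x hx
    rw [hx]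

theorem exists_stronglyMeasurable_representative (hJ : IsCompact J) (hJn : J.Nonempty)
    (hm : AEStronglyMeasurable m (volume.restrict (Ω : Set Plane)))
    (hmJ : ∀ᵐ x ∂volume.restrict (Ω : Set Plane), m x ∈ J) :
    ∃ n : Plane → Circle, StronglyMeasurable n ∧ (∀ x, n x ∈ J) ∧
      m =ᵐ[volume.restrict (Ω : Set Plane)] n := by
  classical
  borelize Circle
  obtain ⟨z, hz⟩ := hJn
  have hS : MeasurableSet (hm.mk m ⁻¹' J) :=
    hm.stronglyMeasurable_mk.measurable hJ.isClosed.measurableSet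
  refine ⟨(hm.mk m ⁻¹' J).piecewise (hm.mk m) fun _ => z,
    hm.stronglyMeasurable_mk.piecewise hS stronglyMeasurable_const, fun x => ?_, ?_⟩
  · by_cases hx : x ∈ hm.mk m ⁻¹' J
    · rwa [Set.piecewise_eq_of_mem _ _ _ hx]
    · rwa [Set.piecewise_eq_of_notMem _ _ _ hx]
  · filter_upwards [hm.ae_eq_mk, hmJ] with x h1 h2
    rw [Set.piecewise_eq_of_mem _ _ _ (by rwa [Set.mem_preimage, ← h1]), h1]

/-- On bounded sets, the Besov bound in `L^p` implies the one in `L^q`, for every `q ≤ p`. -/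
theorem IsBesovLoc.hasIncrementBound {p : ℝ≥0∞} (hm : IsBesovLoc (1 / 3) p Ω m)
    {n : Plane → Circle} (hn : StronglyMeasurable n)
    (hmn : m =ᵐ[volume.restrict (Ω : Set Plane)] n) {q : ℝ≥0} (hq : 0 < q) (hqp : q ≤ p) :
    HasIncrementBound Ω n q := by
  intro K hK hKΩ
  obtain ⟨U, hU, hKU, hUΩ, hUc⟩ := exists_open_between_and_isCompact_closure hK Ω.isOpen hKΩ
  obtain ⟨C, hC⟩ := hm.2 U hU hUc hUΩ
  obtain ⟨δ, hδ, hδΩ⟩ := hK.exists_cthickening_subset_open Ω.isOpen hKΩ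
  have hfin : IsFiniteMeasure (volume.restrict K) := ⟨by simpa using hK.measure_lt_top⟩
  set c : ℝ≥0∞ := volume.restrict K Set.univ ^ (1 / (q : ℝ≥0∞).toReal - 1 / p.toReal) with hc
  have hcfin : c ≠ ∞ := by
    refine ENNReal.rpow_ne_top_of_nonneg ?_ (measure_ne_top _ _)
    rw [sub_nonneg, ENNReal.coe_toReal]
    rcases eq_or_ne p ∞ with rfl | hp
    · simp
    · exact one_div_le_one_div_of_le (by exact_mod_cast hq)
        (by simpa using ENNReal.toReal_mono hp hqp)
  set B : ℝ := C * c.toReal with hB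
  refine ⟨B ^ (q : ℝ), by positivity, min δ 1, lt_min hδ one_pos, fun h hh => ?_⟩
  set D : Plane → ℂ := fun x => (n (x + h) : ℂ) - n x with hD
  have hDm : StronglyMeasurable D :=
    (continuous_subtype_val.comp_stronglyMeasurable (hn.comp_measurable (by fun_prop))).sub
      (continuous_subtype_val.comp_stronglyMeasurable hn)
  have hDb : ∀ x, ‖D x‖ ≤ 2 := fun x => (norm_sub_le _ _).trans (by
    rw [Circle.norm_coe, Circle.norm_coe]
    norm_num)
  have hDL : MemLp D q (volume.restrict K) :=
    MemLp.of_bound hDm.aestronglyMeasurable 2 (Eventually.of_forall hDb)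
  have heq : D =ᵐ[volume.restrict K] diffOn Ω m h := by
    have h1 : ∀ᵐ x, x ∈ Ω → m x = n x := by
      exact (ae_restrict_iff' Ω.isOpen.measurableSet).1 hmn
    have h2 : ∀ᵐ x : Plane, x + h ∈ Ω → m (x + h) = n (x + h) :=
      (measurePreserving_add_right (volume : Measure Plane) h).quasiMeasurePreserving.ae h1
    filter_upwards [ae_restrict_of_ae h1, ae_restrict_of_ae h2,
      ae_restrict_mem hK.measurableSet] with x e1 e2 hx
    have hx' : x + h ∈ Ω := hδΩ (closedBall_subset_cthickening hx δ (by
      rw [mem_closedBall, dist_eq_norm, add_sub_cancel_left]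
      exact (hh.trans_le (min_le_left _ _)).le))
    rw [diffOn, Set.indicator_of_mem (show x ∈ {x | x ∈ Ω ∧ x + h ∈ Ω} from ⟨hKΩ hx, hx'⟩),
      e1 (hKΩ hx), e2 hx']
  have h1 : eLpNorm D q (volume.restrict K) ≤ ENNReal.ofReal (B * ‖h‖ ^ (1 / 3 : ℝ)) := by
    calc eLpNorm D q (volume.restrict K) ≤ eLpNorm D p (volume.restrict K) * c :=
          eLpNorm_le_eLpNorm_mul_rpow_measure_univ hqp hDm.aestronglyMeasurable
      _ = eLpNorm (diffOn Ω m h) p (volume.restrict K) * c := by rw [eLpNorm_congr_ae heq]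
      _ ≤ eLpNorm (diffOn Ω m h) p (volume.restrict U) * c := by
          gcongr
      _ ≤ C * ENNReal.ofReal (‖h‖ ^ (1 / 3 : ℝ)) * c := by
          gcongr
          exact hC h (hh.trans_le (min_le_right _ _)).le
      _ = _ := by
          rw [hB, ENNReal.ofReal_mul (by positivity), ENNReal.ofReal_mul (by positivity),
            ENNReal.ofReal_toReal hcfin, ENNReal.ofReal_coe_nnreal, mul_right_comm]
  rw [hDL.eLpNorm_eq_integral_rpow_norm (by simpa using hq.ne') ENNReal.coe_ne_top,
    ENNReal.ofReal_le_ofReal_iff (by positivity), ENNReal.coe_toReal] at h1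
  set I := ∫ x in K, ‖D x‖ ^ (q : ℝ) with hI
  have hI0 : 0 ≤ I := integral_nonneg fun x => by positivity
  have h2 := Real.rpow_le_rpow (by positivity) h1 q.coe_nonneg
  rw [← Real.rpow_mul hI0, inv_mul_cancel₀ (by exact_mod_cast hq.ne'), Real.rpow_one,
    Real.mul_rpow (by positivity) (by positivity), ← Real.rpow_mul (norm_nonneg _)] at h2
  rwa [show 1 / 3 * (q : ℝ) = q / 3 by ring] at h2

end Representatives

end EntropyProduction

theorem proposition1p4
    (J : Set Circle) (hJc : IsCompact J) (hJconn : IsConnected J)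
    (Γ : Circle → Matrix (Fin 2) (Fin 2) ℝ) (hΓ : IsCkOn 2 J Γ)
    (hnorm : ∀ θ ∈ angles J, ‖dTheta J Γ θ‖ = 1)
    (hdet : ∀ θ ∈ angles J, (dTheta J Γ θ).det = 0)
    (hdet2 : ∀ θ ∈ angles J, 0 < |(dTheta2 J Γ θ).det|)
    (Ω : Opens Plane) (m : Plane → Circle)
    (hmJ : ∀ᵐ x ∂volume.restrict (Ω : Set Plane), m x ∈ J)
    (hdiv : ∀ j : Fin 2, IsDivFree Ω (fun x => row Γ j (m x)))
    (p : ℝ≥0∞) (hp : 3 < p) (hm : IsBesovLoc (1 / 3) p Ω m) :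
    ∀ Φ ∈ ENT J Γ, IsDivFree Ω (fun x => Φ (m x)) := by
  intro Φ ⟨hΦ, α₁, α₂, hα₁, hα₂, hΦα⟩
  have hu : UniqueDiffOn ℝ (angles J) := uniqueDiffOn_angles fun θ hθ h0 => by
    have := hnorm θ hθ
    rw [h0, norm_zero] at this
    exact zero_ne_one this
  obtain ⟨n, hn, hnJ, hmn⟩ := exists_stronglyMeasurable_representative hJc hJconn.nonempty hm.1 hmJ
  obtain ⟨q, hq3, hqp⟩ := ENNReal.lt_iff_exists_nnreal_btwn.1 hp
  have hq : (3 : ℝ) < q := by exact_mod_cast hq3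
  have hB : HasIncrementBound Ω n q :=
    hm.hasIncrementBound hn hmn (by
    have : (0 : ℝ) < q := by linarith
    exact_mod_cast this) hqp.le
  obtain ⟨A⟩ : Nonempty (AngularApprox J n q) := by
    rcases eq_or_ne J Set.univ with rfl | hJ
    · exact nonempty_angularApprox_univ hn hq.le
    · exact nonempty_angularApprox_of_ne_univ hu hJc hJconn hJ hn hnJ (by linarith)
  set γ : Fin 2 → Fin 2 → Circle → ℝ := fun j k z => Γ z j k with hγdef
  have hγ : ∀ j k, IsCkOn 2 J (γ j k) := fun j k => hΓ.clm_comp (entryCLM j k)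
  have hγ1 : ∀ j k, ∀ θ ∈ angles J, dTheta J (γ j k) θ = dTheta J Γ θ j k := fun j k θ hθ =>
    (hΓ.of_le one_le_two).dTheta_clm hu (entryCLM j k) hθ
  have hγ2 : ∀ j k, ∀ θ ∈ angles J, dTheta2 J (γ j k) θ = dTheta2 J Γ θ j k := fun j k θ hθ =>
    hΓ.dTheta2_clm hu (entryCLM j k) hθ
  have hφ : ∀ k, IsCkOn 1 J fun z => Φ z k := fun k =>
    (hΦ.of_le one_le_two).clm_comp (EuclideanSpace.proj k)
  have hrel : ∀ k, ∀ θ ∈ angles J, dTheta J (fun z => Φ z k) θ =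
      ∑ j, ![α₁, α₂] j (Circle.exp θ) * dTheta J (γ j k) θ := fun k θ hθ => by
    have h1 := fun j => isCkOn_row (hΓ.of_le one_le_two) j
    have h2 : ∀ j, dTheta J (γ j k) θ = dTheta J (row Γ j) θ k := fun j =>
      dTheta_apply hu (h1 j) k hθ
    rw [dTheta_apply hu (hΦ.of_le one_le_two) k hθ, hΦα θ hθ]
    simp [Fin.sum_univ_two, h2]
  have hdiv' : ∀ j, IsDivFree Ω fun x => WithLp.toLp 2 fun k => γ j k (n x) := fun j =>
    (hdiv j).congr_ae (hmn.mono fun x hx => by simp only [hx]; rfl)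
  refine IsDivFree.congr_ae (F := fun x => Φ (n x)) ⟨?_, fun ζ => ?_⟩
    (hmn.mono fun x hx => by simp only [hx])
  · obtain ⟨M, hM⟩ := hJc.exists_bound_of_continuousOn hΦ.continuousOn
    refine (locallyIntegrable_of_bounded (M := M) ?_ fun y => hM _ (hnJ y)).locallyIntegrableOn _
    have h1 : StronglyMeasurable fun x => fun k => Φ (n x) k :=
      (measurable_pi_iff.2 fun k =>
        (stronglyMeasurable_comp_circle hn hnJ (hφ k).continuousOn).measurable).stronglyMeasurable
    exact (PiLp.continuous_toLp 2 _).comp_stronglyMeasurable h1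
  · have h0 := A.integral_sum_fderiv_mul_eq_zero hu hJc hn hnJ hq hB hγ
      (fun θ hθ => by
        rw [hγ1 _ _ θ hθ, hγ1 _ _ θ hθ, hγ1 _ _ θ hθ, hγ1 _ _ θ hθ, ← Matrix.det_fin_two]
        exact hdet θ hθ)
      (fun θ hθ => by
        rw [hγ2 _ _ θ hθ, hγ2 _ _ θ hθ, hγ2 _ _ θ hθ, hγ2 _ _ θ hθ, ← Matrix.det_fin_two]
        exact abs_pos.1 (hdet2 θ hθ))
      hdiv' hφ (α := ![α₁, α₂]) (fun j => by fin_cases j; exacts [hα₁, hα₂]) hrel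
      (ζ := ζ) (ζ.contDiff.of_le (by exact_mod_cast le_top)) ζ.hasCompactSupport ζ.tsupport_subset
    rw [setIntegral_eq_integral_of_forall_compl_eq_zero fun x hx => ?_, ← h0]
    · exact integral_congr_ae (Filter.Eventually.of_forall fun x => apply_eq_sum_coordVec _ _)
    · have hx' : fderiv ℝ ζ x = 0 := by
        by_contra hne
        exact hx (ζ.tsupport_subset (support_fderiv_subset ℝ hne))
      rw [hx', zero_apply]
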